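/- Let $d\ge 1$ be an integer and let $S^d$ be the unit sphere in $\mathbb R^{d+1}$ with its standard Riemannian metric of curvature $+1$ (for $d=1$, the circle of length $2\pi$). Let $\Delta$ be its (nonnegative) Laplace–Beltrami operator acting on smooth functions. Then every eigenspace of $\Delta$ is finite-dimensional, and for every $t>0$ the heat trace $$\operatorname{tr} e^{-t\Delta}=\sum_{\lambda} e^{-t\lambda},$$ where $\lambda$ runs over the eigenvalues of $\Delta$ counted with multiplicity, converges. As $t\to0^+$ it has an asymptotic expansion $$\sum_{\lambda} e^{-t\lambda}\;\sim\;\sum_{n=0}^{\infty}a_{n,d}\,t^{\,n-\frac d2},$$ i.e. $\sum_\lambda e^{-t\lambda}-\sum_{n=0}^{N}a_{n,d}t^{n-d/2}=o(t^{N-d/2})$ for every integer $N\ge0$. For every integer $n\ge 1$ and every integer $\omega\ge 2n$, its coefficients (the heat invariants of $S^d$) are $$ a_{n,d}=\sum_{j=1}^{\omega}\frac{2(-1)^n\,\Gamma\!\left(\omega+\frac d2+1\right)}{(\omega-j)!\,(j+n)!\,(2j+d)!}\;\sum_{k=1}^{j}(-1)^k\binom{2j+d-1}{j-k}\,\mu_{k,d}\,\lambda_{k,d}^{\,j+n},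 $$ where $$\lambda_{k,d}=k(k+d-1),\qquad \mu_{k,d}=\frac{(2k+d-1)\,(k+d-2)!}{k!\,(d-1)!}\qquad(k\ge1).$$ -/

import Mathlib

namespace SphereHeat

noncomputable section

open scoped Manifold ContDiff Topology

/-- Euclidean space `ℝ^(d+1)`. -/
abbrev Ambient (d : ℕ) : Type := EuclideanSpace ℝ (Fin (d + 1))

/-- The unit sphere `S^d` in `ℝ^(d+1)`, with Mathlib's smooth structure. -/
abbrev Sph (d : ℕ) : Type := Metric.sphere (0 : Ambient d) 1

/-- The real vector space of smooth real-valued functions on `S^d`. -/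
abbrev SmoothFun (d : ℕ) : Type := ContMDiffMap (𝓡 d) 𝓘(ℝ, ℝ) (Sph d) ℝ ∞

/-- The radial retraction `x ↦ x / ‖x‖` of `ℝ^(d+1) \ {0}` onto `S^d`
(with an arbitrary value at the origin). -/
def radial (d : ℕ) (x : Ambient d) : Sph d :=
  if h : x = 0 then ⟨EuclideanSpace.single 0 1, by simp⟩
  else ⟨‖x‖⁻¹ • x, by simp [norm_smul, h]⟩

theorem coe_radial {d : ℕ} {x : Ambient d} (h : x ≠ 0) :
    (radial d x : Ambient d) = ‖x‖⁻¹ • x := by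
  simp [radial, h]

theorem contMDiffAt_radial {d : ℕ} {x : Ambient d} (h : x ≠ 0) :
    ContMDiffAt 𝓘(ℝ, Ambient d) (𝓡 d) ∞ (radial d) x := by
  have : Fact (Module.finrank ℝ (Ambient d) = d + 1) := ⟨finrank_euclideanSpace_fin⟩
  let U : TopologicalSpace.Opens (Ambient d) := ⟨{0}ᶜ, isOpen_compl_singleton⟩
  have hU : ∀ y : U, (y : Ambient d) ≠ 0 := fun y => y.2
  have h1 : ContMDiff 𝓘(ℝ, Ambient d) 𝓘(ℝ, Ambient d) ∞
      (fun y : U => (radial d (y : Ambient d) : Ambient d)) := by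
    have h2 : (fun y : U => (radial d (y : Ambient d) : Ambient d))
        = (fun z : Ambient d => ‖z‖⁻¹ • z) ∘ (Subtype.val : U → Ambient d) := by
      funext y
      exact coe_radial (hU y)
    rw [h2]
    intro y
    refine ContMDiffAt.comp y ?_ (contMDiff_subtype_val y)
    refine ContDiffAt.contMDiffAt ?_
    exact ((contDiffAt_norm ℝ (hU y)).inv (norm_ne_zero_iff.2 (hU y))).smul contDiffAt_id
  have h3 := h1.codRestrict_sphere (n := d) (fun y => (radial d (y : Ambient d)).2)
  have h4 : ContMDiffAt 𝓘(ℝ, Ambient d) (𝓡 d) ∞ (fun y : U => radial d (y : Ambient d)) ⟨x, h⟩ :=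
    h3 (⟨x, h⟩ : U)
  exact (contMDiffAt_subtype_iff (U := U) (f := radial d) (x := ⟨x, h⟩)).1 h4

/-- The extension of a function on `S^d` to `ℝ^(d+1) \ {0}` that is constant along rays. -/
def rayExtension {d : ℕ} (f : Sph d → ℝ) : Ambient d → ℝ := fun x => f (radial d x)

theorem contDiffAt_rayExtension {d : ℕ} (f : SmoothFun d) {x : Ambient d} (h : x ≠ 0) :
    ContDiffAt ℝ ∞ (rayExtension f) x :=
  (ContMDiffAt.comp x (f.contMDiff (radial d x)) (contMDiffAt_radial h)).contDiffAt

theorem contDiffAt_laplacian {d : ℕ} {F : Ambient d → ℝ} {x : Ambient d}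
    (h : ContDiffAt ℝ ∞ F x) : ContDiffAt ℝ ∞ (Laplacian.laplacian F) x := by
  rw [InnerProductSpace.laplacian_eq_iteratedFDeriv_stdOrthonormalBasis]
  refine ContDiffAt.sum fun i _ => ?_
  have h1 : ContDiffAt ℝ ∞ (iteratedFDeriv ℝ 2 F) x :=
    h.iteratedFDeriv_right (m := ∞) (i := 2) (by norm_cast)
  exact (ContinuousMultilinearMap.apply ℝ (fun _ : Fin 2 => Ambient d) ℝ
    ![stdOrthonormalBasis ℝ (Ambient d) i, stdOrthonormalBasis ℝ (Ambient d) i]).contDiff.contDiffAt.comp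
      x h1

theorem sph_ne_zero {d : ℕ} (x : Sph d) : (x : Ambient d) ≠ 0 :=
  ne_zero_of_mem_unit_sphere x

/-- The (nonnegative) Laplace-Beltrami operator of the unit sphere: for smooth `f`, `Δ f` is minus
the Euclidean Laplacian of the extension `x ↦ f (x / ‖x‖)`, restricted to the sphere. -/
def laplaceBeltrami (d : ℕ) : SmoothFun d →ₗ[ℝ] SmoothFun d where
  toFun f :=
    ⟨fun x => -(Laplacian.laplacian (rayExtension f) (x : Ambient d)), by
      have : Fact (Module.finrank ℝ (Ambient d) = d + 1) := ⟨finrank_euclideanSpace_fin⟩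
      intro x
      have h := (contDiffAt_laplacian (contDiffAt_rayExtension f (sph_ne_zero x))).neg
      have h2 : ContMDiffAt (𝓡 d) 𝓘(ℝ, Ambient d) ∞ (Subtype.val : Sph d → Ambient d) x :=
        contMDiff_coe_sphere x
      exact ContMDiffAt.comp
        (g := fun y : Ambient d => -(Laplacian.laplacian (rayExtension f) y)) x h.contMDiffAt h2⟩
  map_add' f g := by
    ext x
    have hf := (contDiffAt_rayExtension f (sph_ne_zero x)).of_le (m := 2) (by norm_cast)
    have hg := (contDiffAt_rayExtension g (sph_ne_zero x)).of_le (m := 2) (by norm_cast)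
    have h := hf.laplacian_add hg
    change -(Laplacian.laplacian (rayExtension f + rayExtension g) (x : Ambient d)) =
      -(Laplacian.laplacian (rayExtension f) (x : Ambient d)) +
        -(Laplacian.laplacian (rayExtension g) (x : Ambient d))
    rw [h]
    ring
  map_smul' c f := by
    ext x
    have hf := (contDiffAt_rayExtension f (sph_ne_zero x)).of_le (m := 2) (by norm_cast)
    have h := InnerProductSpace.laplacian_smul c hf
    change -(Laplacian.laplacian (c • rayExtension f) (x : Ambient d)) =
      c * -(Laplacian.laplacian (rayExtension f) (x : Ambient d))
    rw [h, smul_eq_mul]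
    ring

/-- The eigenspace `{f | Δ f = lam f}` of the Laplace-Beltrami operator of `S^d`. -/
def eigenspace (d : ℕ) (lam : ℝ) : Submodule ℝ (SmoothFun d) :=
  Module.End.eigenspace (laplaceBeltrami d) lam

/-- The summand of the eigenvalue `lam` in the trace of `exp (-t Δ)` on `S^d`: the multiplicity of
`lam` (which is `0` if `lam` is not an eigenvalue) times `exp (-t lam)`. -/
def heatTerm (d : ℕ) (t lam : ℝ) : ℝ :=
  (Module.finrank ℝ (eigenspace d lam) : ℝ) * Real.exp (-t * lam)

/-- The trace of the heat operator `exp (-t Δ)` on `S^d`: the sum of `exp (-t lam)` over the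
eigenvalues `lam` of `Δ`, counted with multiplicity. -/
def heatTrace (d : ℕ) (t : ℝ) : ℝ := ∑' lam : ℝ, heatTerm d t lam

/-- The heat trace of `S^d` has the asymptotic expansion
`heatTrace d t ∼ ∑ a n * t ^ (n - d / 2)` as `t → 0+`. -/
def HasHeatExpansion (d : ℕ) (a : ℕ → ℝ) : Prop :=
  ∀ N : ℕ, (fun t : ℝ => heatTrace d t -
      ∑ n ∈ Finset.range (N + 1), a n * t ^ ((n : ℝ) - (d : ℝ) / 2))
    =o[𝓝[>] (0 : ℝ)] fun t : ℝ => t ^ ((N : ℝ) - (d : ℝ) / 2)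

/-- The number `k (k + d - 1)`. -/
def sphEigenvalue (k d : ℕ) : ℝ := (k : ℝ) * ((k : ℝ) + (d : ℝ) - 1)

/-- The number `(2k + d - 1) (k + d - 2)! / (k! (d - 1)!)` for `k ≥ 1`, and `1` for `k = 0`
(only used for `d ≥ 1`). -/
def sphMultiplicity (k d : ℕ) : ℝ :=
  if k = 0 then 1
  else (2 * (k : ℝ) + (d : ℝ) - 1) * ((k + d - 2).factorial : ℝ) /
    ((k.factorial : ℝ) * ((d - 1).factorial : ℝ))

/-- The double sum
`∑_{j=1}^w 2 (-1)^n Γ(w+d/2+1) / ((w-j)! (j+n)! (2j+d)!)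
  * ∑_{k=1}^j (-1)^k C(2j+d-1, j-k) μ_{k,d} λ_{k,d}^{j+n}`. -/
def heatSum (n d w : ℕ) : ℝ :=
  ∑ j ∈ Finset.Icc 1 w,
    2 * (-1 : ℝ) ^ n * Real.Gamma ((w : ℝ) + (d : ℝ) / 2 + 1) /
        (((w - j).factorial : ℝ) * ((j + n).factorial : ℝ) * ((2 * j + d).factorial : ℝ)) *
      ∑ k ∈ Finset.Icc 1 j,
        (-1 : ℝ) ^ k * ((2 * j + d - 1).choose (j - k) : ℝ) *
          sphMultiplicity k d * sphEigenvalue k d ^ (j + n)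

end

end SphereHeat

/-! Let the sphere have dimension `d + 1` and put ρ = d/2. Then λ_k + ρ² = (k + ρ)², so e^{-tρ²}
times the heat trace is the Gaussian sum Σ μ_k e^{-t(k+ρ)²}; the factor e^{tρ²} is restored at the
end by a Cauchy product. The double sum and the expansion of this Gaussian sum are both expressed
through one family of polynomials and then compared.

The family is q_n = `shellPoly ρ n`. Its generating function Q(u) = Σ q_n(u) yⁿ satisfies Q(u) = (1
+ u²y) Q(u+1) and Q(ρ) = 1. Hence Q(ρ-e) is a product of e factors 1 + (ρ-e+m)²y, while Q(ρ+j+1) is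
the reciprocal of the product of 1 + (ρ+m)²y over m ≤ j: the same polynomials give elementary
symmetric functions below ρ and, up to sign, complete symmetric functions above it. Each q_n has
degree at most 3n and vanishes at ρ, ..., ρ-n+1, so q_n = ∏ (u-ρ+m) · r_n with deg r_n ≤ 2n.

Double sum: the inner sum is a divided difference of powers at the points (k+ρ)², hence a value of q
at j+ρ+1 (`zonalSum_eq`). The outer sum is then Lagrange interpolation of r_i at ω+1 nodes,
evaluated at u = 1/2; ω ≥ 2n is what the degree requires. The result, `heatSum_eq_heatCoeff`, is
free of ω.

Heat trace: d! μ_k is a polynomial in k+ρ with coefficients 2(-1)^i q_i(1/2), at least for k ≥ 1.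
Euler-Maclaurin on the grid a + ℕ, with a = 1/2 for odd d and a = 1 for even d, gives Gaussian
moments, which account for the r_i(1/2) with 2i ≤ d, and boundary terms with Bernoulli values at a.
For even d ≥ 2 the boundary terms vanish, as do the later r_i(1/2); for d = 0 the only one cancels a
defect of the constant mode. For odd d the later r_n(1/2) are derivatives q_n'(1/2) up to
factorials, and Newton's recursion turns these into the same Bernoulli values (`shiftedCoeff_odd`).

Spectrum: on restrictions of homogeneous polynomials of degree k, Δ is λ_k modulo those of degree
k-2. Symmetry of Δ splits off eigenspaces (`exists_add_of_mem_polySpace`), Stone-Weierstrass shows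
that nothing else occurs, and dimensions of polynomial spaces give μ_k. -/

namespace SphereHeat

/-! ### Newton's recursion and formal power series -/

noncomputable section

open Polynomial

/-- The formal derivative of a power series. -/
abbrev dps {R : Type*} [CommRing R] (F : PowerSeries R) : PowerSeries R :=
  PowerSeries.derivative R F

theorem coeff_dps {R : Type*} [CommRing R] (F : PowerSeries R) (n : ℕ) :
    PowerSeries.coeff n (dps F) = PowerSeries.coeff (n + 1) F * (n + 1) :=
  PowerSeries.coeff_derivative F n

theorem dps_mul {R : Type*} [CommRing R] (F G : PowerSeries R) :
    dps (F * G) = F * dps G + G * dps F := by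
  simp

theorem dps_sub {R : Type*} [CommRing R] (F G : PowerSeries R) :
    dps (F - G) = dps F - dps G := map_sub _ _ _

/-- As S has no constant term, the equation expresses n Fₙ through earlier coefficients. This
uniqueness replaces any use of formal exponentials below. -/
theorem powerSeries_eq_zero_of_euler {R : Type*} [CommRing R] [IsDomain R] [CharZero R]
    {F S : PowerSeries R} (hS : PowerSeries.coeff 0 S = 0) (hF : PowerSeries.coeff 0 F = 0)
    (h : PowerSeries.X * dps F = F * S) : F = 0 := by
  ext n
  induction n using Nat.strong_induction_on with
  | _ n ih =>
    rcases n with _ | n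
    · simpa using hF
    · have h1 := congrArg (PowerSeries.coeff (n + 1)) h
      rw [PowerSeries.coeff_succ_X_mul, coeff_dps, PowerSeries.coeff_mul] at h1
      rw [Finset.sum_eq_zero] at h1
      · have h2 : ((n : R) + 1) ≠ 0 := by exact_mod_cast Nat.succ_ne_zero n
        simpa [h2] using h1
      · rintro ⟨i, j⟩ hij
        rw [Finset.HasAntidiagonal.mem_antidiagonal] at hij
        rcases j with _ | j
        · simp [hS]
        · simp only at hij
          rw [ih i (by omega)]
          simp

/-- The elementary-symmetric-like sequence with prescribed power sums, given by Newton's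
recursion `n qₙ = ∑ sᵢ qₙ₋ᵢ`. -/
def newton {R : Type*} [CommRing R] [Algebra ℝ R] (s : ℕ → R) : ℕ → R
  | 0 => 1
  | n + 1 => ((n : ℝ) + 1)⁻¹ • ∑ i : Fin (n + 1), newton s (n - i) * s (i + 1)

theorem newton_zero {R : Type*} [CommRing R] [Algebra ℝ R] (s : ℕ → R) : newton s 0 = 1 := by
  rw [newton]

theorem newton_succ {R : Type*} [CommRing R] [Algebra ℝ R] (s : ℕ → R) (n : ℕ) :
    newton s (n + 1) =
      ((n : ℝ) + 1)⁻¹ • ∑ i ∈ Finset.range (n + 1), newton s (n - i) * s (i + 1) := by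
  rw [newton, Finset.sum_range]

theorem newton_map {R R' : Type*} [CommRing R] [Algebra ℝ R] [CommRing R'] [Algebra ℝ R']
    (φ : R →ₐ[ℝ] R') (s : ℕ → R) (n : ℕ) : φ (newton s n) = newton (fun i => φ (s i)) n := by
  induction n using Nat.strong_induction_on with
  | _ n ih =>
    rcases n with _ | n
    · simp [newton_zero]
    · rw [newton_succ, newton_succ, map_smul, map_sum]
      congr 1
      refine Finset.sum_congr rfl fun i _ => ?_
      rw [map_mul, ih _ (by omega)]

/-- The power series of power sums `∑_{i ≥ 1} sᵢ Yⁱ`. -/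
def powerSumSeries {R : Type*} [CommRing R] (s : ℕ → R) : PowerSeries R :=
  PowerSeries.mk fun i => if i = 0 then 0 else s i

/-- Logarithmic-derivative form of Σ qₙYⁿ = exp(Σ sᵢYⁱ/i). -/
theorem newton_series {R : Type*} [CommRing R] [Algebra ℝ R] (s : ℕ → R) :
    PowerSeries.X * dps (PowerSeries.mk (newton s)) =
      PowerSeries.mk (newton s) * powerSumSeries s := by
  ext n
  rcases n with _ | n
  · simp [powerSumSeries]
  · rw [PowerSeries.coeff_succ_X_mul, coeff_dps, PowerSeries.coeff_mul,
      Finset.Nat.antidiagonal_succ']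
    simp only [powerSumSeries, PowerSeries.coeff_mk, Finset.sum_cons, if_true, mul_zero, zero_add,
      Finset.sum_map, Function.Embedding.prodMap, Function.Embedding.coeFn_mk, Prod.map,
      Function.Embedding.refl_apply]
    rw [newton_succ, ← Finset.Nat.sum_antidiagonal_swap,
      Finset.Nat.sum_antidiagonal_eq_sum_range_succ_mk]
    simp only [Nat.succ_eq_add_one, Nat.add_eq_zero_iff, one_ne_zero, and_false, if_false,
      Prod.swap]
    rw [mul_comm, ← Nat.cast_one, ← Nat.cast_add, ← nsmul_eq_mul, ← Nat.cast_smul_eq_nsmul ℝ,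
      smul_smul, Nat.cast_add, Nat.cast_one, mul_inv_cancel₀ (by positivity), one_smul]

theorem newton_unique {R : Type*} [CommRing R] [IsDomain R] [CharZero R] [Algebra ℝ R]
    {s : ℕ → R} {F : PowerSeries R} (h0 : PowerSeries.coeff 0 F = 1)
    (h : PowerSeries.X * dps F = F * powerSumSeries s) :
    F = PowerSeries.mk (newton s) := by
  rw [← sub_eq_zero]
  refine powerSeries_eq_zero_of_euler (S := powerSumSeries s) (by simp [powerSumSeries]) ?_ ?_
  · rw [map_sub, h0]; simp [newton_zero]
  · rw [dps_sub, mul_sub, h, newton_series]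
    ring

/-- Since -log(1 + vY) = Σ (-v)ⁱYⁱ/i, removing (-v)ⁱ from the power sums multiplies the exponential
by 1 + vY. -/
theorem newton_shift (s s' : ℕ → ℝ) (v : ℝ) (h : ∀ i, 1 ≤ i → s' i = s i - (-v) ^ i) (n : ℕ) :
    newton s' (n + 1) = newton s (n + 1) + v * newton s n := by
  set P := PowerSeries.mk (newton s)
  have key : (1 + PowerSeries.C v * PowerSeries.X) * P = PowerSeries.mk (newton s') := by
    apply newton_unique
    · simp [P, newton_zero, add_mul, mul_assoc]
    · have hd : dps ((1 + PowerSeries.C v * PowerSeries.X) * P) =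
          (1 + PowerSeries.C v * PowerSeries.X) * dps P
            + P * PowerSeries.C v := by
        have h1 : dps (1 + PowerSeries.C v * PowerSeries.X) = PowerSeries.C v := by
          ext n
          rw [coeff_dps]
          rcases n with _ | n <;> simp [PowerSeries.coeff_one, PowerSeries.coeff_C]
        rw [dps_mul, h1]
      have hs : (1 + PowerSeries.C v * PowerSeries.X) * powerSumSeries s' =
          (1 + PowerSeries.C v * PowerSeries.X) * powerSumSeries s
            + PowerSeries.C v * PowerSeries.X := by
        ext n
        rcases n with _ | n
        · simp [powerSumSeries, add_mul, mul_assoc]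
        · simp only [add_mul, one_mul, mul_assoc, map_add, PowerSeries.coeff_C_mul,
            PowerSeries.coeff_succ_X_mul]
          rcases n with _ | n
          · simp [powerSumSeries, h, PowerSeries.coeff_X]
          · simp [powerSumSeries, h, PowerSeries.coeff_X]
            ring
      have := newton_series s
      change PowerSeries.X * dps P = P * powerSumSeries s at this
      rw [hd]
      linear_combination (1 + PowerSeries.C v * PowerSeries.X) * this - P * hs
  have := congrArg (PowerSeries.coeff (n + 1)) key
  simp only [add_mul, one_mul, mul_assoc, map_add, PowerSeries.coeff_C_mul,
            PowerSeries.coeff_succ_X_mul, P, PowerSeries.coeff_mk] at this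
  exact this.symm

/-- Differentiating P = exp(Σ sᵢYⁱ/i) in the parameter gives D = P E with E = Σ sᵢ'Yⁱ/i. Formally, D
and P E solve the same inhomogeneous Euler equation, so their difference solves the homogeneous one
with zero constant term. -/
theorem derivative_newton (s : ℕ → ℝ[X]) (n : ℕ) :
    derivative (newton s n) =
      ∑ i ∈ Finset.range n, newton s (n - 1 - i) * ((i + 1 : ℝ)⁻¹ • derivative (s (i + 1))) := by
  set P := PowerSeries.mk (newton s) with hP
  set D := PowerSeries.mk (fun n => derivative (newton s n)) with hD
  set E := PowerSeries.mk (fun n : ℕ => (n : ℝ)⁻¹ • derivative (s n)) with hE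
  have hs : PowerSeries.mk (fun n => derivative (PowerSeries.coeff n (powerSumSeries s))) =
      PowerSeries.X * dps E := by
    ext1 n
    rcases n with _ | n
    · simp [powerSumSeries]
    · rw [PowerSeries.coeff_succ_X_mul, coeff_dps]
      simp only [powerSumSeries, E, PowerSeries.coeff_mk]
      have h1 : ((n : ℝ[X]) + 1) = C ((n : ℝ) + 1) := by simp
      rw [if_neg (Nat.succ_ne_zero n), mul_comm, h1, ← smul_eq_C_mul, smul_smul, Nat.cast_succ,
        mul_inv_cancel₀ (by positivity), one_smul]
  have hDe : PowerSeries.X * dps D =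
      D * powerSumSeries s + P * (PowerSeries.X * dps E) := by
    rw [← hs]
    ext1 n
    have := congrArg (fun f => derivative (PowerSeries.coeff n f)) (newton_series s)
    simp only [PowerSeries.coeff_mul n (PowerSeries.mk (newton s)), map_sum, derivative_mul,
      Finset.sum_add_distrib] at this
    rw [map_add, PowerSeries.coeff_mul _ D, PowerSeries.coeff_mul _ P]
    simp only [D, P, PowerSeries.coeff_mk] at this ⊢
    refine Eq.trans ?_ this
    rcases n with _ | n
    · simp
    · rw [PowerSeries.coeff_succ_X_mul, PowerSeries.coeff_succ_X_mul,
        coeff_dps, coeff_dps]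
      simp [derivative_mul]
  have hF : D - P * E = 0 := by
    refine powerSeries_eq_zero_of_euler (S := powerSumSeries s) (by simp [powerSumSeries]) ?_ ?_
    · simp [D, E, newton_zero]
    · have h1 : dps (D - P * E) = dps D -
          (P * dps E + E * dps P) := by
        rw [dps_sub, dps_mul]
      have h4 := newton_series s
      rw [← hP] at h4
      rw [h1]
      linear_combination hDe - E * h4
  have := congrArg (PowerSeries.coeff n) (sub_eq_zero.1 hF)
  rw [PowerSeries.coeff_mul, ← Finset.Nat.sum_antidiagonal_swap,
      Finset.Nat.sum_antidiagonal_eq_sum_range_succ_mk, Finset.sum_range_succ'] at this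
  simp only [D, P, E, PowerSeries.coeff_mk, Prod.swap] at this
  rw [this]
  simp only [Nat.cast_zero, inv_zero, zero_smul, mul_zero, add_zero]
  refine Finset.sum_congr rfl fun i _ => ?_
  rw [Nat.sub_sub, add_comm 1 i]
  push_cast
  rfl

end

end SphereHeat

/-! ### The polynomials q_n, built from Bernoulli polynomials, and Lagrange interpolation -/

namespace SphereHeat

noncomputable section

open Polynomial

/-- The Bernoulli polynomials with real coefficients. -/
def bernoulliReal (n : ℕ) : ℝ[X] := (Polynomial.bernoulli n).map (algebraMap ℚ ℝ)

theorem bernoulliReal_eval_add_one (n : ℕ) (x : ℝ) :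
    (bernoulliReal n).eval (x + 1) = (bernoulliReal n).eval x + n * x ^ (n - 1) := by
  have h := congrArg (fun p => (p.map (algebraMap ℚ ℝ)).eval x) (bernoulli_comp_one_add_X n)
  simpa [Polynomial.map_comp, add_comm, bernoulliReal] using h

theorem bernoulliReal_eval_one_sub (n : ℕ) (x : ℝ) :
    (bernoulliReal n).eval (1 - x) = (-1) ^ n * (bernoulliReal n).eval x := by
  have h := congrArg (fun p => (p.map (algebraMap ℚ ℝ)).eval x) (bernoulli_comp_one_sub_X n)
  simpa [Polynomial.map_comp, add_comm, bernoulliReal] using h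

theorem derivative_bernoulliReal (n : ℕ) :
    derivative (bernoulliReal (n + 1)) = C ((n : ℝ) + 1) * bernoulliReal n := by
  have h := congrArg (fun p => (p.map (algebraMap ℚ ℝ))) (derivative_bernoulli_add_one n)
  simpa [bernoulliReal, Polynomial.derivative_map] using h

theorem natDegree_bernoulliReal_le (n : ℕ) : (bernoulliReal n).natDegree ≤ n := by
  refine natDegree_map_le.trans ?_
  rw [natDegree_le_iff_coeff_eq_zero]
  intro N hN
  rw [coeff_bernoulli, if_neg (by omega)]

theorem bernoulliReal_eval_half_odd (i : ℕ) : (bernoulliReal (2 * i + 1)).eval (1 / 2) = 0 := by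
  have h := bernoulliReal_eval_one_sub (2 * i + 1) (1 / 2)
  rw [pow_succ, pow_mul] at h
  norm_num at h
  norm_num
  linarith

theorem bernoulliReal_eval_one_odd {i : ℕ} (hi : i ≠ 0) :
    (bernoulliReal (2 * i + 1)).eval 1 = 0 := by
  have h := bernoulliReal_eval_one_sub (2 * i + 1) 0
  have h2 := bernoulliReal_eval_add_one (2 * i + 1) 0
  rw [pow_succ, pow_mul] at h
  simp [hi] at h h2
  linarith

/-- The power sums `(-1)ⁱ (B_{2i+1}(u) - B_{2i+1}(ρ)) / (2i+1)`. -/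
def shellPowerSum (ρ : ℝ) (i : ℕ) : ℝ[X] :=
  C ((-1 : ℝ) ^ i / (2 * (i : ℝ) + 1)) * (bernoulliReal (2 * i + 1) - C ((bernoulliReal (2 * i + 1)).eval ρ))

/-- The polynomials `qₙ` with `∑ qₙ(u) yⁿ = (1 + u² y) ∑ qₙ(u + 1) yⁿ` and `qₙ(ρ) = 0` for
`n ≥ 1`. -/
def shellPoly (ρ : ℝ) (n : ℕ) : ℝ[X] := newton (shellPowerSum ρ) n

theorem shellPoly_zero (ρ : ℝ) : shellPoly ρ 0 = 1 := newton_zero _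

theorem eval_shellPoly (ρ u : ℝ) (n : ℕ) :
    (shellPoly ρ n).eval u = newton (fun i => (shellPowerSum ρ i).eval u) n := by
  have := newton_map (Polynomial.aeval (R := ℝ) u) (shellPowerSum ρ) n
  simpa [coe_aeval_eq_eval, shellPoly] using this

/-- This is B_{2i+1}(u+1) - B_{2i+1}(u) = (2i+1) u^{2i}: Bernoulli polynomials make sums of even
powers of u, u+1, ... polynomial in u. -/
theorem shellPowerSum_eval_succ (ρ u : ℝ) (i : ℕ) :
    (shellPowerSum ρ i).eval u = (shellPowerSum ρ i).eval (u + 1) - (-(u ^ 2)) ^ i := by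
  simp only [shellPowerSum, eval_mul, eval_C, eval_sub, bernoulliReal_eval_add_one]
  rw [neg_pow (u ^ 2), ← pow_mul, show 2 * i + 1 - 1 = 2 * i from rfl]
  push_cast
  field_simp
  ring

theorem shellPoly_eval_succ (ρ u : ℝ) (n : ℕ) : (shellPoly ρ (n + 1)).eval u =
    (shellPoly ρ (n + 1)).eval (u + 1) + u ^ 2 * (shellPoly ρ n).eval (u + 1) := by
  simp only [eval_shellPoly]
  exact newton_shift _ _ _ (fun i _ => shellPowerSum_eval_succ ρ u i) n

theorem newton_eq_zero_of_forall {s : ℕ → ℝ} (h : ∀ i, s i = 0) (n : ℕ) : newton s (n + 1) = 0 := by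
  rw [newton_succ]
  simp [h]

theorem shellPoly_eval_base (ρ : ℝ) (n : ℕ) : (shellPoly ρ (n + 1)).eval ρ = 0 := by
  rw [eval_shellPoly]
  exact newton_eq_zero_of_forall (fun i => by simp [shellPowerSum]) n

/-- The i-th power sum has degree at most 2i+1 ≤ 3i for i ≥ 1, so weight n costs degree at most 3n.
-/
theorem natDegree_shellPoly_le (ρ : ℝ) (n : ℕ) : (shellPoly ρ n).natDegree ≤ 3 * n := by
  induction n using Nat.strong_induction_on with
  | _ n ih =>
    rcases n with _ | n
    · simp [shellPoly_zero]
    · rw [shellPoly, newton_succ]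
      refine (natDegree_smul_le _ _).trans (natDegree_sum_le_of_forall_le _ _ fun i hi => ?_)
      rw [Finset.mem_range] at hi
      refine natDegree_mul_le.trans ?_
      have h1 := ih (n - i) (by omega)
      have h2 : (shellPowerSum ρ (i + 1)).natDegree ≤ 2 * (i + 1) + 1 := by
        refine natDegree_C_mul_le _ _ |>.trans ?_
        rw [natDegree_sub_C]
        exact natDegree_bernoulliReal_le _
      rw [shellPoly] at h1
      omega

/-- At u = ρ - m the generating function is a product of m linear factors in y, so its coefficients
beyond degree m vanish. -/
theorem shellPoly_eval_sub_nat (ρ : ℝ) {m n : ℕ} (h : m < n) :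
    (shellPoly ρ n).eval (ρ - m) = 0 := by
  induction m generalizing n with
  | zero =>
    obtain ⟨n, rfl⟩ := Nat.exists_eq_succ_of_ne_zero h.ne'
    simpa using shellPoly_eval_base ρ n
  | succ m ih =>
    obtain ⟨n, rfl⟩ := Nat.exists_eq_succ_of_ne_zero (by omega : n ≠ 0)
    rw [Nat.succ_eq_add_one, shellPoly_eval_succ]
    have : ρ - ((m + 1 : ℕ) : ℝ) + 1 = ρ - m := by push_cast; ring
    rw [this, ih (by omega), ih (by omega)]
    simp

theorem exists_shellPoly_factor (ρ : ℝ) (n : ℕ) : ∃ r : ℝ[X], r.natDegree ≤ 2 * n ∧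
    shellPoly ρ n = (∏ m ∈ Finset.range n, (X - C (ρ - m))) * r := by
  have hdvd : (∏ m ∈ Finset.range n, (X - C (ρ - (m : ℝ)))) ∣ shellPoly ρ n := by
    refine Finset.prod_dvd_of_coprime ?_ ?_
    · intro i _ j _ hij
      refine isCoprime_X_sub_C_of_isUnit_sub ?_
      rw [isUnit_iff_ne_zero]
      simpa [sub_eq_zero] using fun h => hij h.symm
    · intro i hi
      exact dvd_iff_isRoot.2 (shellPoly_eval_sub_nat ρ (Finset.mem_range.1 hi))
  obtain ⟨r, hr⟩ := hdvd
  refine ⟨r, ?_, hr⟩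
  rcases eq_or_ne r 0 with rfl | h0
  · simp
  have hm : (∏ m ∈ Finset.range n, (X - C (ρ - (m : ℝ)))).Monic :=
    monic_prod_of_monic _ _ fun i _ => monic_X_sub_C _
  have h1 := natDegree_shellPoly_le ρ n
  rw [hr, hm.natDegree_mul' h0, natDegree_prod_of_monic _ _ fun i _ => monic_X_sub_C _] at h1
  simp only [natDegree_X_sub_C, Finset.sum_const, Finset.card_range, smul_eq_mul] at h1
  omega

/-- The quotient of `shellPoly ρ n` by the product of its factors `u - ρ + m`, `m < n`. -/
def shellQuot (ρ : ℝ) (n : ℕ) : ℝ[X] := (exists_shellPoly_factor ρ n).choose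

theorem natDegree_shellQuot_le (ρ : ℝ) (n : ℕ) : (shellQuot ρ n).natDegree ≤ 2 * n :=
  (exists_shellPoly_factor ρ n).choose_spec.1

theorem shellPoly_eq_mul_shellQuot (ρ : ℝ) (n : ℕ) :
    shellPoly ρ n = (∏ m ∈ Finset.range n, (X - C (ρ - m))) * shellQuot ρ n :=
  (exists_shellPoly_factor ρ n).choose_spec.2

theorem eval_shellPoly_eq_mul (ρ u : ℝ) (n : ℕ) : (shellPoly ρ n).eval u =
    (∏ m ∈ Finset.range n, (u - ρ + m)) * (shellQuot ρ n).eval u := by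
  conv_lhs => rw [shellPoly_eq_mul_shellQuot, eval_mul, eval_prod]
  congr 1
  refine Finset.prod_congr rfl fun m _ => ?_
  simp
  ring

/-- Lagrange interpolation at the nodes `0, …, w`, evaluated at `-x`. -/
theorem eval_neg_eq_sum_nodes (p : ℝ[X]) (w : ℕ) (hp : p.natDegree ≤ w) (x : ℝ) (hx : 0 < x) :
    p.eval (-x) * Real.Gamma x = ∑ j ∈ Finset.range (w + 1), (-1) ^ j * Real.Gamma (w + x + 1) /
      ((w - j).factorial * j.factorial * (j + x)) * p.eval (j : ℝ) := by
  have hinj : Set.InjOn (fun j : ℕ => (j : ℝ)) (Finset.range (w + 1)) :=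
    fun a _ b _ h => by simpa using h
  have hdeg : p.degree < (Finset.range (w + 1)).card := by
    rw [Finset.card_range]
    exact lt_of_le_of_lt degree_le_natDegree (by exact_mod_cast Nat.lt_succ_of_le hp)
  have h := congrArg (fun q => q.eval (-x)) (Lagrange.eq_interpolate hinj hdeg)
  rw [Lagrange.eval_interpolate_not_at_node _ (fun i _ => by
    have : (0 : ℝ) ≤ i := i.cast_nonneg
    intro h; linarith)] at h
  rw [h, Lagrange.eval_nodal]
  -- Up to sign, Γ(w+x+1)/Γ(x) is the nodal polynomial of 0, ..., w at -x.
  have hG : Real.Gamma (w + x + 1) = (∏ i ∈ Finset.range (w + 1), (x + i)) * Real.Gamma x := by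
    clear h hdeg hinj hp
    induction w with
    | zero => simp [Real.Gamma_add_one hx.ne']
    | succ w ih =>
      rw [Finset.prod_range_succ, mul_right_comm, ← ih, mul_comm]
      push_cast
      rw [show x + (w + 1 : ℝ) = w + x + 1 by ring, ← Real.Gamma_add_one (by positivity)]
      congr 1
      ring
  have hprod : ∏ i ∈ Finset.range (w + 1), (-x - i) =
      (-1) ^ (w + 1) * ∏ i ∈ Finset.range (w + 1), (x + i) := by
    rw [← Finset.card_range (w + 1), ← Finset.prod_const, Finset.card_range,
      ← Finset.prod_mul_distrib]
    exact Finset.prod_congr rfl fun i _ => by ring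
  rw [hprod, Finset.mul_sum, Finset.sum_mul]
  refine Finset.sum_congr rfl fun j hj => ?_
  have hjw : j ≤ w := Nat.lt_succ_iff.1 (Finset.mem_range.1 hj)
  have hw : Lagrange.nodalWeight (Finset.range (w + 1)) (fun j : ℕ => (j : ℝ)) j =
      ((-1) ^ (w - j) * ((w - j).factorial * j.factorial : ℝ))⁻¹ := by
    rw [Lagrange.nodalWeight, Finset.prod_inv_distrib]
    congr 1
    have hr : (Finset.range (w + 1)).erase j = Finset.range j ∪ Finset.Ico (j + 1) (w + 1) := by
      ext a; simp; omega
    rw [hr, Finset.prod_union (by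
      rw [Finset.disjoint_left]; intro a; simp; omega), Finset.prod_Ico_eq_prod_range]
    have h1 : ∏ i ∈ Finset.range j, ((j : ℝ) - i) = j.factorial := by
      rw [← Finset.prod_range_add_one_eq_factorial, ← Finset.prod_range_reflect]
      push_cast
      refine Finset.prod_congr rfl fun i hi => ?_
      rw [Finset.mem_range] at hi
      rw [Nat.cast_sub (by omega), Nat.cast_sub (by omega)]
      push_cast; ring
    have h2 : ∏ i ∈ Finset.range (w + 1 - (j + 1)), ((j : ℝ) - ((j + 1 + i : ℕ) : ℝ)) =
        (-1) ^ (w - j) * (w - j).factorial := by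
      rw [Nat.add_sub_add_right, ← Finset.prod_range_add_one_eq_factorial]
      push_cast
      conv_rhs => rw [← Finset.card_range (w - j), ← Finset.prod_const, Finset.card_range,
        ← Finset.prod_mul_distrib]
      exact Finset.prod_congr rfl fun i _ => by ring
    rw [h1, h2]
    ring
  rw [hw, hG]
  have hsgn : ((-1 : ℝ) ^ (w + 1)) = (-1) ^ (w - j) * (-1) ^ j * (-1) := by
    rw [← pow_add, ← pow_succ]; congr 1; omega
  rw [hsgn]
  have e1 : ((-1 : ℝ) ^ (w - j)) ≠ 0 := by positivity
  have e2 : (-x - j : ℝ) ≠ 0 := by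
    have : (0 : ℝ) ≤ j := j.cast_nonneg
    intro h; linarith
  have e3 : (j + x : ℝ) ≠ 0 := by positivity
  have e4 : (-x - j : ℝ) = -(j + x) := by ring
  rw [e4]
  field_simp

end

end SphereHeat

/-! ### Evaluation of the double sum -/

namespace SphereHeat

noncomputable section

open Polynomial

theorem sphMultiplicity_succ (k d : ℕ) : sphMultiplicity (k + 1) (d + 1) =
    (2 * k + d + 2) * (k + d).factorial / ((k + 1).factorial * d.factorial) := by
  rw [sphMultiplicity, if_neg (Nat.succ_ne_zero k), show k + 1 + (d + 1) - 2 = k + d by omega,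
    Nat.add_sub_cancel]
  push_cast
  ring

theorem choose_step (N m : ℕ) (h : m < N) :
    ((N.choose (m + 1) : ℝ)) * (m + 1) = N.choose m * ((N : ℝ) - m) := by
  have := Nat.choose_succ_right_eq N m
  rw [← Nat.cast_sub h.le]
  exact_mod_cast this

/-- The partial sums telescope to a closed form containing j - K, so the full sum K = j vanishes
when j > 0. The factor j clears a denominator. -/
theorem mul_sum_choose_sphMultiplicity (d j K : ℕ) (hK : K ≤ j) :
    (j : ℝ) * ∑ k ∈ Finset.range (K + 1), (-1 : ℝ) ^ k * ((2 * j + d).choose (j - k) : ℝ) *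
      sphMultiplicity k (d + 1) = (-1) ^ K * (j - K) * (2 * j + d).choose (j - K) *
        ((K + d).factorial / (K.factorial * d.factorial)) := by
  induction K with
  | zero => 
    have : (d.factorial : ℝ) ≠ 0 := by positivity
    simp [sphMultiplicity, this]
  | succ K ih =>
    rw [Finset.sum_range_succ, mul_add, ih (by omega), sphMultiplicity_succ]
    obtain ⟨m, rfl⟩ := Nat.exists_eq_add_of_le hK
    have h1 : K + 1 + m - K = m + 1 := by omega
    have h2 : K + 1 + m - (K + 1) = m := by omega
    rw [h1, h2]
    have hc := choose_step (2 * (K + 1 + m) + d) m (by omega)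
    rw [show K + 1 + d = (K + d) + 1 by ring, Nat.factorial_succ (K + d), Nat.factorial_succ K]
    have e1 : (K.factorial : ℝ) ≠ 0 := by positivity
    have e2 : (d.factorial : ℝ) ≠ 0 := by positivity
    have e3 : (K + 1 : ℝ) ≠ 0 := by positivity
    push_cast at hc ⊢
    rw [pow_succ]
    have hc2 : ((K + 1 + m : ℝ) - K) * ((2 * (K + 1 + m) + d).choose (m + 1)) =
        ((2 * (K + 1 + m) + d).choose m) * (2 * (K + 1 + m) + d - m) := by
      linear_combination hc
    rw [show (-1 : ℝ) ^ K * (K + 1 + m - K) * ((2 * (K + 1 + m) + d).choose (m + 1)) =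
      (-1 : ℝ) ^ K * (((K + 1 + m : ℝ) - K) * ((2 * (K + 1 + m) + d).choose (m + 1))) by ring, hc2]
    field_simp
    ring

/-- The alternating sums `∑ (-1)^k C(2j+d-1, j-k) μ_k (k + (d-1)/2)^(2m)`. -/
def zonalSum (d j m : ℕ) : ℝ := ∑ k ∈ Finset.range (j + 1), (-1 : ℝ) ^ k *
  ((2 * j + d - 1).choose (j - k) : ℝ) * sphMultiplicity k d * (((k : ℝ) + (d - 1) / 2) ^ 2) ^ m

theorem zonalSum_succ_zero (d j : ℕ) : zonalSum (d + 1) (j + 1) 0 = 0 := by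
  have := mul_sum_choose_sphMultiplicity d (j + 1) (j + 1) le_rfl
  simp only [sub_self, mul_zero, zero_mul] at this
  rw [mul_eq_zero] at this
  rcases this with h | h
  · exact absurd h (by positivity)
  · simpa [zonalSum, ← add_assoc] using h

/-- The difference of squares is (j+1-k)(j+1+k+d), exactly the factors lost between the two binomial
coefficients. -/
theorem choose_two_step (d j k : ℕ) (hk : k ≤ j) :
    ((j + 1 + (d : ℝ) / 2) ^ 2 - (k + (d : ℝ) / 2) ^ 2) * (2 * j + d + 2).choose (j + 1 - k) =
      (2 * j + d + 2) * (2 * j + d + 1) * (2 * j + d).choose (j - k) := by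
  obtain ⟨m, rfl⟩ := Nat.exists_eq_add_of_le hk
  rw [show k + m + 1 - k = m + 1 by omega, show k + m - k = m by omega,
    Nat.cast_choose ℝ (by omega : m + 1 ≤ 2 * (k + m) + d + 2),
    Nat.cast_choose ℝ (by omega : m ≤ 2 * (k + m) + d),
    show 2 * (k + m) + d + 2 - (m + 1) = (2 * k + m + d) + 1 by omega,
    show 2 * (k + m) + d - m = 2 * k + m + d by omega, Nat.factorial_succ (2 * (k + m) + d + 1),
    Nat.factorial_succ (2 * (k + m) + d), Nat.factorial_succ m, Nat.factorial_succ (2 * k + m + d)]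
  have e1 : (m.factorial : ℝ) ≠ 0 := by positivity
  have e2 : ((2 * k + m + d).factorial : ℝ) ≠ 0 := by positivity
  have e3 : (2 * k + m + d + 1 : ℝ) ≠ 0 := by positivity
  push_cast
  field_simp
  ring

/-- The recursion of divided differences: write one factor (k+ρ)² as (j+1+ρ)² minus their
difference. The difference kills k = j+1 and lowers j by `choose_two_step`. -/
theorem zonalSum_succ_succ (d j m : ℕ) : zonalSum (d + 1) (j + 1) (m + 1) =
    (j + 1 + (d : ℝ) / 2) ^ 2 * zonalSum (d + 1) (j + 1) m -
      (2 * j + d + 2) * (2 * j + d + 1) * zonalSum (d + 1) j m := by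
  have h1 : ∀ m, zonalSum (d + 1) j m = ∑ k ∈ Finset.range (j + 1), (-1 : ℝ) ^ k *
      ((2 * j + d).choose (j - k) : ℝ) * sphMultiplicity k (d + 1) *
        (((k : ℝ) + d / 2) ^ 2) ^ m := by
    intro m; simp [zonalSum, ← add_assoc]
  have h2 : ∀ m, zonalSum (d + 1) (j + 1) m = ∑ k ∈ Finset.range (j + 1 + 1), (-1 : ℝ) ^ k *
      ((2 * j + d + 2).choose (j + 1 - k) : ℝ) * sphMultiplicity k (d + 1) *
        (((k : ℝ) + d / 2) ^ 2) ^ m := by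
    intro m
    rw [zonalSum, show 2 * (j + 1) + (d + 1) - 1 = 2 * j + d + 2 by omega]
    simp
  rw [h1, h2, h2, Finset.sum_range_succ _ (j + 1), Finset.sum_range_succ _ (j + 1), mul_add,
    Finset.mul_sum,
    Finset.mul_sum]
  push_cast
  rw [pow_succ ((j + 1 + (d : ℝ) / 2) ^ 2) m]
  have : ∀ a b c e f : ℝ, a = b - c → e = f → a + e = b + f - c := by intros; linarith
  refine this _ _ _ _ _ ?_ (by ring)
  rw [← Finset.sum_sub_distrib]
  refine Finset.sum_congr rfl fun k hk => ?_
  have hc := choose_two_step d j k (by rw [Finset.mem_range] at hk; omega)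
  rw [pow_succ]
  linear_combination -((-1 : ℝ) ^ k * sphMultiplicity k (d + 1) * (((k : ℝ) + d / 2) ^ 2) ^ m) * hc

theorem zonalSum_zero_left (d m : ℕ) : zonalSum (d + 1) 0 m = (((d : ℝ) / 2) ^ 2) ^ m := by
  simp [zonalSum, sphMultiplicity]

/-- Up to a factor, this is the divided difference of x^m at (k+ρ)², k ≤ j: zero for m < j,
otherwise the complete symmetric function of degree m - j. In the induction on m,
`zonalSum_succ_succ` mirrors the functional equation of q_n. -/
theorem zonalSum_eq (d m : ℕ) : ∀ j, (m < j → zonalSum (d + 1) j m = 0) ∧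
    ∀ n, m = j + n → zonalSum (d + 1) j m = (-1) ^ (j + n) * ((2 * j + d).factorial / d.factorial) *
      (shellPoly (d / 2) n).eval (j + (d : ℝ) / 2 + 1) := by
  have hstep : ∀ j n : ℕ, (shellPoly (d / 2) (n + 1)).eval ((j : ℝ) + d / 2) =
      (shellPoly (d / 2) (n + 1)).eval ((j : ℝ) + d / 2 + 1) + ((j : ℝ) + d / 2) ^ 2 *
        (shellPoly (d / 2) n).eval ((j : ℝ) + d / 2 + 1) := fun j n => shellPoly_eval_succ _ _ _
  have hd : (d.factorial : ℝ) ≠ 0 := by positivity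
  induction m with
  | zero =>
    intro j
    refine ⟨fun h => ?_, fun n hn => ?_⟩
    · obtain ⟨j, rfl⟩ := Nat.exists_eq_succ_of_ne_zero h.ne'
      exact zonalSum_succ_zero d j
    · obtain ⟨rfl, rfl⟩ : j = 0 ∧ n = 0 := by omega
      simp [zonalSum_zero_left, shellPoly_zero, hd]
  | succ m ih =>
    rintro (_ | j)
    · refine ⟨fun h => absurd h (by omega), fun n hn => ?_⟩
      obtain rfl : n = m + 1 := by omega
      have h1 := (ih 0).2 m (by omega)
      have h2 := hstep 0 m
      have h3 := shellPoly_eval_base ((d : ℝ) / 2) m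
      rw [zonalSum_zero_left] at h1 ⊢
      simp only [Nat.cast_zero, zero_add, mul_zero, div_self hd, mul_one] at h1 h2 ⊢
      rw [pow_succ, h1, pow_succ]
      rw [h3] at h2
      linear_combination -(-1 : ℝ) ^ m * h2
    · rw [zonalSum_succ_succ]
      refine ⟨fun h => ?_, fun n hn => ?_⟩
      · rw [(ih (j + 1)).1 (by omega), (ih j).1 (by omega)]
        simp
      · rw [(ih j).2 n (by omega)]
        have hf : ((2 * (j + 1) + d).factorial : ℝ) =
            (2 * j + d + 2) * (2 * j + d + 1) * (2 * j + d).factorial := by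
          rw [show 2 * (j + 1) + d = 2 * j + d + 1 + 1 by ring, Nat.factorial_succ,
            Nat.factorial_succ]
          push_cast; ring
        rw [hf]
        rcases n with _ | n
        · rw [(ih (j + 1)).1 (by omega)]
          simp only [shellPoly_zero, eval_one]
          ring
        · rw [(ih (j + 1)).2 n (by omega), hf]
          have h2 := hstep (j + 1) n
          push_cast at h2 ⊢
          rw [show (j : ℝ) + 1 + d / 2 = j + d / 2 + 1 by ring] at h2 ⊢
          rw [h2]
          ring

theorem eval_shellPoly_node (ρ : ℝ) (j n : ℕ) : (shellPoly ρ n).eval (j + ρ + 1) =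
    ((j + n).factorial / j.factorial) * (shellQuot ρ n).eval (j + ρ + 1) := by
  rw [eval_shellPoly_eq_mul]
  congr 1
  have hj : (j.factorial : ℝ) ≠ 0 := by positivity
  rw [eq_div_iff hj, mul_comm]
  induction n with
  | zero => simp
  | succ n ih =>
    rw [Finset.prod_range_succ, ← mul_assoc, ih, ← add_assoc, Nat.factorial_succ]
    push_cast
    ring

/-- The heat coefficient of `e^{-t ρ²} tr e^{-tΔ}`, `ρ = d / 2`, on the sphere of dimension
`d + 1`. -/
def shiftedCoeff (d n : ℕ) : ℝ :=
  Real.Gamma (((d : ℝ) + 1) / 2) / d.factorial * (shellQuot (d / 2) n).eval (1 / 2)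

/-- Expand ((k+ρ)² - ρ²)^{j+n}: the powers below j contribute nothing, which leaves n+1 terms
whatever j is. -/
theorem sum_sphEigenvalue_pow (d j n : ℕ) :
    ∑ k ∈ Finset.range (j + 1), (-1 : ℝ) ^ k * ((2 * j + (d + 1) - 1).choose (j - k) : ℝ) *
      sphMultiplicity k (d + 1) * sphEigenvalue k (d + 1) ^ (j + n) =
    ∑ i ∈ Finset.range (n + 1), ((j + n).factorial / ((n - i).factorial * j.factorial)) *
      (-1) ^ (j + n) * (((d : ℝ) / 2) ^ 2) ^ (n - i) * ((2 * j + d).factorial / d.factorial) *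
        (shellQuot (d / 2) i).eval (j + (d : ℝ) / 2 + 1) := by
  have h1 : ∀ k : ℕ, sphEigenvalue k (d + 1) ^ (j + n) = ∑ m ∈ Finset.range (j + n + 1),
      (((k : ℝ) + d / 2) ^ 2) ^ m * (-((d : ℝ) / 2) ^ 2) ^ (j + n - m) * (j + n).choose m := by
    intro k
    rw [← add_pow, sphEigenvalue]
    congr 1
    push_cast
    ring
  simp_rw [h1, Finset.mul_sum]
  rw [Finset.sum_comm]
  have h2 : ∀ m, ∑ k ∈ Finset.range (j + 1), (-1 : ℝ) ^ k *
      ((2 * j + (d + 1) - 1).choose (j - k) : ℝ) * sphMultiplicity k (d + 1) *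
      ((((k : ℝ) + d / 2) ^ 2) ^ m * (-((d : ℝ) / 2) ^ 2) ^ (j + n - m) * (j + n).choose m) =
      (-((d : ℝ) / 2) ^ 2) ^ (j + n - m) * (j + n).choose m * zonalSum (d + 1) j m := by
    intro m
    rw [zonalSum, Finset.mul_sum]
    refine Finset.sum_congr rfl fun k _ => ?_
    push_cast
    rw [show ((d : ℝ) + 1 - 1) = d by ring]
    ring
  simp_rw [h2]
  rw [add_assoc, Finset.sum_range_add, Finset.sum_eq_zero, zero_add]
  · refine Finset.sum_congr rfl fun i hi => ?_
    rw [Finset.mem_range] at hi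
    rw [(zonalSum_eq d (j + i) j).2 i rfl, eval_shellPoly_node, Nat.add_sub_add_left,
      Nat.cast_choose ℝ (by omega : j + i ≤ j + n), Nat.add_sub_add_left]
    have e1 : ((j + i).factorial : ℝ) ≠ 0 := by positivity
    have e2 : ((n - i).factorial : ℝ) ≠ 0 := by positivity
    have e3 : (j.factorial : ℝ) ≠ 0 := by positivity
    have e4 : ((-1 : ℝ)) ^ (j + n) = (-1) ^ (n - i) * (-1) ^ (j + i) := by
      rw [← pow_add]; congr 1; omega
    rw [neg_pow (((d : ℝ) / 2) ^ 2), e4]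
    field_simp
  · intro m hm
    rw [(zonalSum_eq d m j).1 (Finset.mem_range.1 hm), mul_zero]

theorem heatSum_eq_sum (d n w : ℕ) (hn : 1 ≤ n) (hw : 2 * n ≤ w) : heatSum n (d + 1) w =
    ∑ i ∈ Finset.range (n + 1), (((d : ℝ) / 2) ^ 2) ^ (n - i) / (n - i).factorial *
      shiftedCoeff d i := by
  have h0 : ∀ (j : ℕ), ∑ k ∈ Finset.Icc 1 j, (-1 : ℝ) ^ k *
      ((2 * j + (d + 1) - 1).choose (j - k) : ℝ) * sphMultiplicity k (d + 1) *
        sphEigenvalue k (d + 1) ^ (j + n) = ∑ k ∈ Finset.range (j + 1), (-1 : ℝ) ^ k *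
      ((2 * j + (d + 1) - 1).choose (j - k) : ℝ) * sphMultiplicity k (d + 1) *
        sphEigenvalue k (d + 1) ^ (j + n) := by
    intro j
    refine Finset.sum_subset (fun k hk => by
      rw [Finset.mem_Icc] at hk; rw [Finset.mem_range]; omega) fun k hk hk' => ?_
    rw [Finset.mem_range] at hk
    rw [Finset.mem_Icc] at hk'
    obtain rfl : k = 0 := by omega
    -- For n ≥ 1 the power of λ₀ = 0 vanishes even when j = 0, so the sums may start at 0.
    have hjn : j + n ≠ 0 := by omega
    rw [sphEigenvalue, Nat.cast_zero, zero_mul, zero_pow hjn, mul_zero]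
  have h1 : heatSum n (d + 1) w = ∑ j ∈ Finset.range (w + 1), 2 * (-1 : ℝ) ^ n *
      Real.Gamma ((w : ℝ) + (d + 1) / 2 + 1) /
        (((w - j).factorial : ℝ) * ((j + n).factorial : ℝ) * ((2 * j + d + 1).factorial : ℝ)) *
      ∑ k ∈ Finset.range (j + 1), (-1 : ℝ) ^ k *
      ((2 * j + (d + 1) - 1).choose (j - k) : ℝ) * sphMultiplicity k (d + 1) *
        sphEigenvalue k (d + 1) ^ (j + n) := by
    simp_rw [← h0]
    rw [heatSum]
    push_cast
    refine Finset.sum_subset (fun k hk => by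
      rw [Finset.mem_Icc] at hk; rw [Finset.mem_range]; omega) fun k hk hk' => ?_
    rw [Finset.mem_range] at hk
    rw [Finset.mem_Icc] at hk'
    obtain rfl : k = 0 := by omega
    simp
  rw [h1]
  simp_rw [sum_sphEigenvalue_pow, Finset.mul_sum]
  rw [Finset.sum_comm]
  refine Finset.sum_congr rfl fun i hi => ?_
  rw [Finset.mem_range] at hi
  -- With u = j + ρ + 1 the node j becomes the argument of r_i, and the evaluation point -(d+1)/2
  -- becomes u = 1/2. The degree bound is 2i ≤ 2n ≤ w.
  have hL := eval_neg_eq_sum_nodes ((shellQuot (d / 2) i).comp (X + C ((d : ℝ) / 2 + 1))) w (by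
    rw [natDegree_comp, natDegree_X_add_C, mul_one]
    have := natDegree_shellQuot_le (d / 2) i
    omega) (((d : ℝ) + 1) / 2) (by positivity)
  simp only [eval_comp, eval_add, eval_X, eval_C] at hL
  rw [show -(((d : ℝ) + 1) / 2) + (d / 2 + 1) = 1 / 2 by ring] at hL
  rw [shiftedCoeff, div_mul_eq_mul_div (Real.Gamma _), mul_comm (Real.Gamma _), hL, Finset.sum_div,
    Finset.mul_sum]
  refine Finset.sum_congr rfl fun j _ => ?_
  rw [Nat.factorial_succ (2 * j + d), ← add_assoc (j : ℝ)]
  generalize Polynomial.eval ((j : ℝ) + d / 2 + 1) (shellQuot (d / 2) i) = E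
  generalize (((d : ℝ) / 2) ^ 2) ^ (n - i) = F
  have e1 : ((j + n).factorial : ℝ) ≠ 0 := by positivity
  have e2 : ((n - i).factorial : ℝ) ≠ 0 := by positivity
  have e3 : (j.factorial : ℝ) ≠ 0 := by positivity
  have e4 : (d.factorial : ℝ) ≠ 0 := by positivity
  have e5 : ((w - j).factorial : ℝ) ≠ 0 := by positivity
  have e6 : ((2 * j + d).factorial : ℝ) ≠ 0 := by positivity
  have e7 : (2 * j + d + 1 : ℝ) ≠ 0 := by positivity
  have e8 : (j + ((d : ℝ) + 1) / 2) ≠ 0 := by positivity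
  have e9 : (-1 : ℝ) ^ n * (-1) ^ n = 1 := by rw [← mul_pow]; simp
  rw [show (j + ((d : ℝ) + 1) / 2) = (2 * j + d + 1) / 2 by ring, pow_add]
  push_cast
  field_simp
  linear_combination (E * F) * e9

end

end SphereHeat

/-! ### Euler-Maclaurin summation and Gaussian sums -/

namespace SphereHeat

noncomputable section

open Polynomial MeasureTheory Filter Topology

/-- The normalised Bernoulli polynomials `B_n / n!`. -/
def bernoulliKernel (n : ℕ) : ℝ[X] := C ((n.factorial : ℝ)⁻¹) * bernoulliReal n

theorem hasDerivAt_bernoulliKernel (n : ℕ) (x : ℝ) :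
    HasDerivAt (fun y => (bernoulliKernel (n + 1)).eval y) ((bernoulliKernel n).eval x) x := by
  have h := (bernoulliKernel (n + 1)).hasDerivAt x
  refine h.congr_deriv ?_
  simp only [bernoulliKernel, derivative_C_mul, derivative_bernoulliReal, Nat.factorial_succ,
    eval_mul, eval_C]
  push_cast
  field_simp

theorem bernoulliKernel_zero : bernoulliKernel 0 = 1 := by
  simp [bernoulliKernel, bernoulliReal]

theorem bernoulliKernel_eval_one_sub (n : ℕ) (x : ℝ) :
    (bernoulliKernel n).eval (1 - x) = (-1) ^ n * (bernoulliKernel n).eval x := by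
  simp only [bernoulliKernel, eval_mul, eval_C, bernoulliReal_eval_one_sub]
  ring

theorem bernoulliKernel_one_sub_zero (n : ℕ) :
    (bernoulliKernel (n + 1)).eval 1 - (bernoulliKernel (n + 1)).eval 0 =
      if n = 0 then 1 else 0 := by
  have h := bernoulliReal_eval_add_one (n + 1) 0
  rw [zero_add] at h
  simp only [bernoulliKernel, eval_mul, eval_C, h]
  rcases n with _ | n <;> simp

/-- Repeated integration by parts along the chain of antiderivatives B_n/n!, starting from the
constant 1. -/
theorem integral_mul_bernoulliKernel {F : ℕ → ℝ → ℝ}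
    (hF : ∀ i x, HasDerivAt (F i) (F (i + 1) x) x) (u v c : ℝ) (N : ℕ) :
    ∫ x in u..v, F 0 x = ∑ i ∈ Finset.range N, (-1) ^ i *
      (F i v * (bernoulliKernel (i + 1)).eval (v - c) -
        F i u * (bernoulliKernel (i + 1)).eval (u - c)) +
      (-1) ^ N * ∫ x in u..v, F N x * (bernoulliKernel N).eval (x - c) := by
  have hcF : ∀ i, Continuous (F i) := fun i =>
    continuous_iff_continuousAt.2 fun x => (hF i x).continuousAt
  induction N with
  | zero => simp [bernoulliKernel_zero]
  | succ N ih =>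
    have hk : ∀ x, HasDerivAt (fun y => (bernoulliKernel (N + 1)).eval (y - c))
        ((bernoulliKernel N).eval (x - c)) x := fun x =>
      HasDerivAt.comp_sub_const x c (hasDerivAt_bernoulliKernel N (x - c))
    have h := intervalIntegral.integral_mul_deriv_eq_deriv_mul (a := u) (b := v)
      (fun x _ => hF N x) (fun x _ => hk x) ((hcF (N + 1)).intervalIntegrable _ _)
      (Continuous.intervalIntegrable (by fun_prop) _ _)
    rw [ih, h, Finset.sum_range_succ, pow_succ]
    ring

theorem exists_bernoulliKernel_bound (N : ℕ) :
    ∃ M : ℝ, 0 ≤ M ∧ ∀ x ∈ Set.Icc (0 : ℝ) 1, |(bernoulliKernel N).eval x| ≤ M := by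
  obtain ⟨M, hM⟩ := isCompact_Icc.exists_bound_of_continuousOn (s := Set.Icc (0 : ℝ) 1)
    (f := fun x => (bernoulliKernel N).eval x) (by fun_prop)
  exact ⟨M, (norm_nonneg _).trans (hM 0 (by simp)), fun x hx => hM x hx⟩

theorem abs_integral_mul_bernoulliKernel_le {N : ℕ} {M : ℝ}
    (hM : ∀ x ∈ Set.Icc (0 : ℝ) 1, |(bernoulliKernel N).eval x| ≤ M) {G : ℝ → ℝ}
    (hG : Continuous G) {u v c : ℝ} (huv : u ≤ v) (hu : c ≤ u) (hv : v ≤ c + 1) :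
    |∫ x in u..v, G x * (bernoulliKernel N).eval (x - c)| ≤ M * ∫ x in u..v, |G x| := by
  rw [← intervalIntegral.integral_const_mul]
  refine (intervalIntegral.abs_integral_le_integral_abs huv).trans ?_
  refine intervalIntegral.integral_mono_on huv (Continuous.intervalIntegrable (by fun_prop) _ _)
    (Continuous.intervalIntegrable (by fun_prop) _ _) fun x hx => ?_
  rw [abs_mul, mul_comm]
  gcongr
  exact hM _ ⟨by linarith [hx.1], by linarith [hx.2]⟩

/-- The Euler-Maclaurin formula for `∑_{k < K} F (a + k)`. -/
theorem euler_maclaurin_finite {F : ℕ → ℝ → ℝ}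
    (hF : ∀ i x, HasDerivAt (F i) (F (i + 1) x) x) {a : ℝ} (ha0 : 0 ≤ a) (ha1 : a ≤ 1)
    {N : ℕ} {M : ℝ} (hM : ∀ x ∈ Set.Icc (0 : ℝ) 1, |(bernoulliKernel (N + 1)).eval x| ≤ M)
    (K : ℕ) :
    |(∫ x in 0..(a + K), F 0 x) - (∑ k ∈ Finset.range K, F 0 (a + k) +
      ∑ i ∈ Finset.range (N + 1), (-1) ^ i * (F i (a + K) * (bernoulliKernel (i + 1)).eval 1 -
        F i 0 * (bernoulliKernel (i + 1)).eval (1 - a)))| ≤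
      M * ∫ x in 0..(a + K), |F (N + 1) x| := by
  have hcF : ∀ i, Continuous (F i) := fun i =>
    continuous_iff_continuousAt.2 fun x => (hF i x).continuousAt
  induction K with
  | zero =>
    -- The shift a - 1 puts the kernel argument at 1 when x = a and at 1 - a when x = 0, so this
    -- incomplete interval matches the full ones that follow.
    have h1 := integral_mul_bernoulliKernel hF 0 a (a - 1) (N + 1)
    rw [sub_sub_cancel, zero_sub, neg_sub] at h1
    have h2 := abs_integral_mul_bernoulliKernel_le hM (hcF (N + 1)) ha0
      (c := a - 1) (by linarith) (by linarith)
    simp only [Nat.cast_zero, add_zero, Finset.range_zero, Finset.sum_empty, zero_add]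
    rw [h1, add_sub_cancel_left, abs_mul, abs_pow, abs_neg, abs_one, one_pow, one_mul]
    exact h2
  | succ K ih =>
    have h1 := integral_mul_bernoulliKernel hF (a + K) (a + (K + 1 : ℕ)) (a + K) (N + 1)
    have h2 := abs_integral_mul_bernoulliKernel_le hM (hcF (N + 1)) (u := a + K)
      (v := a + (K + 1 : ℕ)) (c := a + K) (by push_cast; linarith) le_rfl
      (by push_cast; linarith)
    have hi : ∀ G : ℝ → ℝ, Continuous G → ∫ x in 0..(a + (K + 1 : ℕ)), G x =
        (∫ x in 0..(a + K), G x) + ∫ x in (a + K)..(a + (K + 1 : ℕ)), G x := fun G hG =>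
      (intervalIntegral.integral_add_adjacent_intervals (hG.intervalIntegrable _ _)
        (hG.intervalIntegrable _ _)).symm
    rw [hi _ (hcF 0), hi _ (hcF (N + 1)).abs, mul_add, Finset.sum_range_succ]
    rw [sub_self, show a + ((K + 1 : ℕ) : ℝ) - (a + K) = 1 by push_cast; ring] at h1
    have h3 : ∑ i ∈ Finset.range (N + 1), (-1) ^ i *
        (F i (a + (K + 1 : ℕ)) * (bernoulliKernel (i + 1)).eval 1 -
          F i (a + K) * (bernoulliKernel (i + 1)).eval 0) =
        ∑ i ∈ Finset.range (N + 1), (-1) ^ i *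
        (F i (a + (K + 1 : ℕ)) * (bernoulliKernel (i + 1)).eval 1 -
          F i 0 * (bernoulliKernel (i + 1)).eval (1 - a)) -
        ∑ i ∈ Finset.range (N + 1), (-1) ^ i *
        (F i (a + K) * (bernoulliKernel (i + 1)).eval 1 -
          F i 0 * (bernoulliKernel (i + 1)).eval (1 - a)) + F 0 (a + K) := by
      -- Among the B_n with n ≥ 1 only B₁ differs at 0 and 1; its jump produces the sample at the
      -- common endpoint.
      have h4 : F 0 (a + K) = ∑ i ∈ Finset.range (N + 1), (-1) ^ i * (F i (a + K) *
          ((bernoulliKernel (i + 1)).eval 1 - (bernoulliKernel (i + 1)).eval 0)) := by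
        rw [Finset.sum_range_succ']
        simp [bernoulliKernel_one_sub_zero]
      rw [h4, ← Finset.sum_sub_distrib, ← Finset.sum_add_distrib]
      refine Finset.sum_congr rfl fun i _ => ?_
      ring
    rw [h3] at h1
    rw [h1]
    refine le_trans (le_of_eq ?_) ((abs_add_le _ ((-1) ^ (N + 1) * ∫ x in (a + K)..(a + (K + 1 : ℕ)),
      F (N + 1) x * (bernoulliKernel (N + 1)).eval (x - (a + K)))).trans
        (add_le_add ih ((le_of_eq ?_).trans h2)))
    · congr 1
      ring
    · rw [abs_mul, abs_pow, abs_neg, abs_one, one_pow, one_mul]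

theorem euler_maclaurin {F : ℕ → ℝ → ℝ}
    (hF : ∀ i x, HasDerivAt (F i) (F (i + 1) x) x) {a : ℝ} (ha0 : 0 ≤ a) (ha1 : a ≤ 1)
    {N : ℕ} {M : ℝ} (hM : ∀ x ∈ Set.Icc (0 : ℝ) 1, |(bernoulliKernel (N + 1)).eval x| ≤ M)
    (hlim : ∀ i, Tendsto (F i) atTop (𝓝 0)) (hint : ∀ i, IntegrableOn (F i) (Set.Ioi 0))
    (hsum : Summable fun k : ℕ => F 0 (a + k)) :
    |(∑' k : ℕ, F 0 (a + k)) - (∫ x in Set.Ioi 0, F 0 x) +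
      ∑ i ∈ Finset.range (N + 1), F i 0 * (bernoulliKernel (i + 1)).eval a| ≤
      M * ∫ x in Set.Ioi 0, |F (N + 1) x| := by
  have hatop : Tendsto (fun K : ℕ => a + (K : ℝ)) atTop atTop :=
    tendsto_atTop_add_const_left _ _ tendsto_natCast_atTop_atTop
  have h1 := intervalIntegral_tendsto_integral_Ioi 0 (hint 0) hatop
  have h2 := (intervalIntegral_tendsto_integral_Ioi 0 (hint (N + 1)).abs hatop).const_mul M
  have h3 : Tendsto (fun K : ℕ => ∑ i ∈ Finset.range (N + 1), (-1) ^ i *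
      (F i (a + K) * (bernoulliKernel (i + 1)).eval 1 -
        F i 0 * (bernoulliKernel (i + 1)).eval (1 - a))) atTop
      (𝓝 (∑ i ∈ Finset.range (N + 1), (-1) ^ i * (0 * (bernoulliKernel (i + 1)).eval 1 -
        F i 0 * (bernoulliKernel (i + 1)).eval (1 - a)))) := by
    refine tendsto_finsetSum _ fun i _ => ?_
    exact ((((hlim i).comp hatop).mul_const _).sub_const _).const_mul _
  have h := le_of_tendsto_of_tendsto (h1.sub (hsum.hasSum.tendsto_sum_nat.add h3)).abs h2
    (Eventually.of_forall fun K => euler_maclaurin_finite hF ha0 ha1 hM K)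
  refine le_trans (le_of_eq ?_) h
  rw [← abs_neg]
  congr 1
  have h4 : ∑ i ∈ Finset.range (N + 1), F i 0 * (bernoulliKernel (i + 1)).eval a =
      ∑ i ∈ Finset.range (N + 1), (-1) ^ i * (0 * (bernoulliKernel (i + 1)).eval 1 -
        F i 0 * (bernoulliKernel (i + 1)).eval (1 - a)) := by
    refine Finset.sum_congr rfl fun i _ => ?_
    have : (-1 : ℝ) ^ i * (-1) ^ i = 1 := by rw [← mul_pow]; simp
    rw [bernoulliKernel_eval_one_sub, pow_succ]
    linear_combination -(F i 0 * (bernoulliKernel (i + 1)).eval a) * this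
  rw [h4]
  ring

/-- The iterated derivatives of `x ^ p * exp (-x ^ 2)`. -/
def gaussDeriv : ℕ → ℕ → ℝ → ℝ
  | 0, p, x => x ^ p * Real.exp (-x ^ 2)
  -- The truncated `p - 1` at p = 0 is harmless, being multiplied by p.
  | i + 1, p, x => p * gaussDeriv i (p - 1) x - 2 * gaussDeriv i (p + 1) x

theorem hasDerivAt_gaussDeriv (i p : ℕ) (x : ℝ) :
    HasDerivAt (gaussDeriv i p) (gaussDeriv (i + 1) p x) x := by
  induction i generalizing p with
  | zero =>
    have h : HasDerivAt (fun x : ℝ => x ^ p * Real.exp (-x ^ 2)) (p * x ^ (p - 1) *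
        Real.exp (-x ^ 2) + x ^ p * (Real.exp (-x ^ 2) * (-(2 * x)))) x := by
      refine (hasDerivAt_pow p x).mul ?_
      have := (hasDerivAt_pow 2 x).neg.exp
      simpa using this
    have e : gaussDeriv 0 p = fun x : ℝ => x ^ p * Real.exp (-x ^ 2) := by
      funext x; rw [gaussDeriv]
    rw [e]
    convert h using 1
    simp only [gaussDeriv]
    ring
  | succ i ih =>
    have h := ((ih (p - 1)).const_mul (p : ℝ)).sub ((ih (p + 1)).const_mul 2)
    have e : gaussDeriv (i + 1) p = fun x => p * gaussDeriv i (p - 1) x -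
        2 * gaussDeriv i (p + 1) x := by
      funext x; rw [gaussDeriv]
    rw [e]
    exact h

/-- The i-th derivative at 0 is i! times a Taylor coefficient of x^p e^{-x²}, whose exponents are p
+ 2l. -/
theorem gaussDeriv_zero_apply (i : ℕ) : ∀ p, (∀ l, i = p + 2 * l →
      gaussDeriv i p 0 = i.factorial * (-1) ^ l / l.factorial) ∧
    ((∀ l, i ≠ p + 2 * l) → gaussDeriv i p 0 = 0) := by
  induction i with
  | zero =>
    refine fun p => ⟨fun l hl => ?_, fun h => ?_⟩
    · obtain ⟨rfl, rfl⟩ : p = 0 ∧ l = 0 := by omega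
      simp [gaussDeriv]
    · have : p ≠ 0 := fun hp => h 0 (by simp [hp])
      simp [gaussDeriv, this]
  | succ i ih =>
    intro p
    refine ⟨fun l hl => ?_, fun h => ?_⟩
    · have h1 : (p : ℝ) * gaussDeriv i (p - 1) 0 = p * (i.factorial * (-1) ^ l / l.factorial) := by
        rcases p with _ | p
        · simp
        · rw [(ih _).1 l (by omega)]
      have h2 : gaussDeriv i (p + 1) 0 = - l * (i.factorial * (-1) ^ l / l.factorial) := by
        rcases l with _ | l
        · rw [(ih _).2 (by omega)]; simp
        · rw [(ih _).1 l (by omega), Nat.factorial_succ]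
          push_cast
          field_simp
          ring
      rw [gaussDeriv, h1, h2, Nat.factorial_succ, hl]
      have : (i : ℝ) + 1 = p + 2 * l := by exact_mod_cast hl
      push_cast
      ring
    · rw [gaussDeriv, (ih (p + 1)).2 (fun l hl => h (l + 1) (by omega))]
      rcases p with _ | p
      · simp
      · rw [(ih _).2 (fun l hl => h l (by omega))]
        simp

theorem integrableOn_gaussDeriv (i p : ℕ) : IntegrableOn (gaussDeriv i p) (Set.Ioi 0) := by
  induction i generalizing p with
  | zero =>
    have h := integrable_rpow_mul_exp_neg_mul_sq (b := 1) one_pos (s := p)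
      (by have : (0 : ℝ) ≤ p := p.cast_nonneg
          linarith)
    refine (h.congr (ae_of_all _ fun x => ?_)).integrableOn
    simp [gaussDeriv]
  | succ i ih =>
    have h := ((ih (p - 1)).const_mul (p : ℝ)).sub ((ih (p + 1)).const_mul 2)
    exact h.congr (ae_of_all _ fun x => by simp [gaussDeriv])

theorem tendsto_gaussDeriv (i p : ℕ) : Tendsto (gaussDeriv i p) atTop (𝓝 0) := by
  induction i generalizing p with
  | zero =>
    refine squeeze_zero' (g := fun x : ℝ => x ^ p * Real.exp (-x)) ?_ ?_
      (Real.tendsto_pow_mul_exp_neg_atTop_nhds_zero p)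
    · filter_upwards [eventually_ge_atTop 0] with x hx
      rw [gaussDeriv]
      positivity
    · filter_upwards [eventually_ge_atTop 1] with x hx
      rw [gaussDeriv]
      gcongr
      nlinarith
  | succ i ih =>
    have h := ((ih (p - 1)).const_mul (p : ℝ)).sub ((ih (p + 1)).const_mul 2)
    simpa [gaussDeriv] using h

theorem integral_pow_mul_exp_neg_sq (p : ℕ) :
    ∫ x in Set.Ioi (0 : ℝ), gaussDeriv 0 p x = Real.Gamma (((p : ℝ) + 1) / 2) / 2 := by
  have h := integral_rpow_mul_exp_neg_rpow (p := 2) (q := p) two_pos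
    (by have : (0 : ℝ) ≤ p := p.cast_nonneg
        linarith)
  have e : ∫ x in Set.Ioi (0 : ℝ), gaussDeriv 0 p x =
      ∫ x in Set.Ioi (0 : ℝ), x ^ (p : ℝ) * Real.exp (-x ^ (2 : ℝ)) := by
    refine setIntegral_congr_fun measurableSet_Ioi fun x _ => ?_
    simp [gaussDeriv]
  rw [e, h]
  ring

theorem summable_pow_mul_exp_neg_sq (p : ℕ) {a t : ℝ} (ha0 : 0 ≤ a) (ha1 : a ≤ 1) (ht : 0 < t) :
    Summable fun k : ℕ => (a + k) ^ p * Real.exp (-t * (a + k) ^ 2) := by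
  have h := (((summable_nat_add_iff 1).2 (Real.summable_pow_mul_exp_neg_nat_mul p ht)).mul_left
    (Real.exp t))
  refine Summable.of_nonneg_of_le (fun k => by positivity) (fun k => ?_) h
  rw [mul_left_comm, ← Real.exp_add]
  push_cast
  gcongr ?_ ^ p * Real.exp ?_
  · linarith
  · have h1 : (k : ℝ) ≤ (a + k) ^ 2 := by
      rcases k with _ | k
      · simp; positivity
      · have : (0 : ℝ) ≤ k := k.cast_nonneg
        push_cast
        nlinarith
    nlinarith

theorem gauss_sum_asymptotics (p L : ℕ) {a : ℝ} (ha0 : 0 ≤ a) (ha1 : a ≤ 1) :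
    ∃ C : ℝ, ∀ s : ℝ, 0 < s → 
      |(∑' k : ℕ, (a + k) ^ p * Real.exp (-s ^ 2 * (a + k) ^ 2)) -
        Real.Gamma (((p : ℝ) + 1) / 2) / 2 / s ^ (p + 1) +
        ∑ l ∈ Finset.range (L + 1), (bernoulliReal (p + 2 * l + 1)).eval a / (p + 2 * l + 1) *
          ((-1) ^ l * (s ^ 2) ^ l / l.factorial)| ≤ C * s ^ (2 * L + 1) := by
  -- Euler-Maclaurin is applied to (sx)^p e^{-(sx)²}. At order p + 2L + 2 the remainder scales as
  -- s^{p+2L+1}; dividing by s^p leaves s^{2L+1}.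
  obtain ⟨M, hM0, hM⟩ := exists_bernoulliKernel_bound (p + 2 * L + 1 + 1)
  refine ⟨M * ∫ x in Set.Ioi (0 : ℝ), |gaussDeriv (p + 2 * L + 1 + 1) p x|, fun s hs => ?_⟩
  set F : ℕ → ℝ → ℝ := fun i x => s ^ i * gaussDeriv i p (s * x) with hFdef
  have hF : ∀ i x, HasDerivAt (F i) (F (i + 1) x) x := by
    intro i x
    have h1 := ((hasDerivAt_gaussDeriv i p (s * x)).comp x
      ((hasDerivAt_id x).const_mul s)).const_mul (s ^ i)
    refine h1.congr_deriv ?_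
    simp only [hFdef, pow_succ]
    ring
  have hsx : Tendsto (fun x : ℝ => s * x) atTop atTop := tendsto_id.const_mul_atTop hs
  have hF0 : ∀ k : ℕ, F 0 (a + k) = s ^ p * ((a + k) ^ p * Real.exp (-s ^ 2 * (a + k) ^ 2)) := by
    intro k
    simp only [hFdef, gaussDeriv, mul_pow]
    ring_nf
  have hsum : Summable fun k : ℕ => F 0 (a + k) := by
    simp_rw [hF0]
    exact (summable_pow_mul_exp_neg_sq p ha0 ha1 (by positivity : 0 < s ^ 2)).mul_left _
  have h := euler_maclaurin hF ha0 ha1 hM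
    (fun i => by simpa using ((tendsto_gaussDeriv i p).comp hsx).const_mul (s ^ i))
    (fun i => by
      have := (integrableOn_Ioi_comp_mul_left_iff (gaussDeriv i p) 0 hs).2
        (by simpa using integrableOn_gaussDeriv i p)
      exact this.const_mul _) hsum
  have hI : ∫ x in Set.Ioi 0, F 0 x = s⁻¹ * (Real.Gamma (((p : ℝ) + 1) / 2) / 2) := by
    simp only [hFdef, pow_zero, one_mul]
    rw [integral_comp_mul_left_Ioi (gaussDeriv 0 p) 0 hs, mul_zero, integral_pow_mul_exp_neg_sq,
      smul_eq_mul]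
  have hR : ∫ x in Set.Ioi 0, |F (p + 2 * L + 1 + 1) x| = s ^ (p + 2 * L + 1) *
      ∫ x in Set.Ioi (0 : ℝ), |gaussDeriv (p + 2 * L + 1 + 1) p x| := by
    simp only [hFdef, abs_mul, abs_pow, abs_of_pos hs]
    rw [integral_const_mul, integral_comp_mul_left_Ioi (fun x => |gaussDeriv _ p x|) 0 hs, mul_zero,
      smul_eq_mul, pow_succ]
    field_simp
  have hB : ∑ i ∈ Finset.range (p + 2 * L + 1 + 1), F i 0 * (bernoulliKernel (i + 1)).eval a =
      s ^ p * ∑ l ∈ Finset.range (L + 1), (bernoulliReal (p + 2 * l + 1)).eval a /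
        (p + 2 * l + 1) * ((-1) ^ l * (s ^ 2) ^ l / l.factorial) := by
    have hz : ∀ i, (∀ l, i ≠ p + 2 * l) → F i 0 * (bernoulliKernel (i + 1)).eval a = 0 := by
      intro i hi
      simp only [hFdef, mul_zero]
      rw [(gaussDeriv_zero_apply i p).2 hi]
      simp
    rw [Finset.mul_sum]
    symm
    refine Finset.sum_of_injOn (fun l => p + 2 * l) (fun l _ l' _ h => by simpa using h)
      (fun l hl => ?_) (fun i hi hi' => ?_) (fun l hl => ?_)
    · simp only [Finset.coe_range, Set.mem_Iio] at hl ⊢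
      omega
    · refine hz i fun l hl => hi' ?_
      rw [Finset.mem_range] at hi
      exact ⟨l, by simp; omega, hl.symm⟩
    · simp only [hFdef, mul_zero]
      rw [(gaussDeriv_zero_apply (p + 2 * l) p).1 l rfl]
      simp only [bernoulliKernel, eval_mul, eval_C, Nat.factorial_succ (p + 2 * l)]
      have : ((p + 2 * l).factorial : ℝ) ≠ 0 := by positivity
      push_cast
      rw [pow_add, ← pow_mul]
      field_simp
  rw [hI, hR, hB] at h
  simp_rw [hF0] at h
  rw [tsum_mul_left] at h
  have hsp : (0 : ℝ) < s ^ p := by positivity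
  refine le_of_mul_le_mul_left ?_ hsp
  rw [← abs_of_pos hsp, ← abs_mul, abs_of_pos hsp]
  refine le_trans (le_of_eq ?_) (h.trans (le_of_eq ?_))
  · have hg : s ^ p * (Real.Gamma (((p : ℝ) + 1) / 2) / 2 / s ^ (p + 1)) =
        s⁻¹ * (Real.Gamma (((p : ℝ) + 1) / 2) / 2) := by
      rw [pow_succ]
      field_simp
    rw [mul_add, mul_sub, hg]
  · ring

end

end SphereHeat

/-! ### Values at 1/2: multiplicities and heat coefficients -/

namespace SphereHeat

noncomputable section

open Polynomial

theorem shellPoly_eval_eq_zero {ρ : ℝ} {e n : ℕ} (h : e < n) : 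
    (shellPoly ρ n).eval (ρ - e) = 0 := shellPoly_eval_sub_nat ρ h

/-- The product formula for Q(ρ - e), homogenized by putting y = -1/X and clearing X^e. -/
theorem sum_shellPoly_eq_prod (ρ X : ℝ) (e : ℕ) :
    ∑ i ∈ Finset.range (e + 1), (-1) ^ i * (shellPoly ρ i).eval (ρ - e) * X ^ (e - i) =
      ∏ m ∈ Finset.range e, (X - (ρ - e + m) ^ 2) := by
  induction e with
  | zero => simp [shellPoly_zero]
  | succ e ih =>
    have hs : ∀ i, (shellPoly ρ (i + 1)).eval (ρ - (e + 1 : ℕ)) =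
        (shellPoly ρ (i + 1)).eval (ρ - e) +
          (ρ - (e + 1 : ℕ)) ^ 2 * (shellPoly ρ i).eval (ρ - e) := by
      intro i
      rw [shellPoly_eval_succ]
      push_cast
      rw [show ρ - (e + 1 : ℝ) + 1 = ρ - e by ring]
    have hp : ∏ m ∈ Finset.range (e + 1), (X - (ρ - (e + 1 : ℕ) + m) ^ 2) =
        (∏ m ∈ Finset.range e, (X - (ρ - e + m) ^ 2)) * (X - (ρ - (e + 1 : ℕ)) ^ 2) := by
      rw [Finset.prod_range_succ']
      simp only [Nat.cast_zero, add_zero]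
      congr 1
      refine Finset.prod_congr rfl fun m _ => ?_
      push_cast
      ring
    rw [hp, ← ih, Finset.sum_range_succ']
    simp_rw [hs]
    have h1 : ∑ i ∈ Finset.range (e + 1), (-1 : ℝ) ^ (i + 1) * ((shellPoly ρ (i + 1)).eval (ρ - e) +
        (ρ - (e + 1 : ℕ)) ^ 2 * (shellPoly ρ i).eval (ρ - e)) * X ^ (e + 1 - (i + 1)) =
        ∑ i ∈ Finset.range (e + 1), (-1 : ℝ) ^ (i + 1) * (shellPoly ρ (i + 1)).eval (ρ - e) *
          X ^ (e + 1 - (i + 1)) - (ρ - (e + 1 : ℕ)) ^ 2 *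
        ∑ i ∈ Finset.range (e + 1), (-1 : ℝ) ^ i * (shellPoly ρ i).eval (ρ - e) * X ^ (e - i) := by
      rw [Finset.mul_sum, ← Finset.sum_sub_distrib]
      refine Finset.sum_congr rfl fun i _ => ?_
      rw [Nat.add_sub_add_right, pow_succ]
      ring
    have h2 : ∑ i ∈ Finset.range (e + 1), (-1 : ℝ) ^ (i + 1) * (shellPoly ρ (i + 1)).eval (ρ - e) *
          X ^ (e + 1 - (i + 1)) + X ^ (e + 1) =
        X * ∑ i ∈ Finset.range (e + 1), (-1 : ℝ) ^ i * (shellPoly ρ i).eval (ρ - e) *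
          X ^ (e - i) := by
      have h3 := Finset.sum_range_succ' (fun i => (-1 : ℝ) ^ i * (shellPoly ρ i).eval (ρ - e) *
          X ^ (e + 1 - i)) (e + 1)
      simp only [pow_zero, shellPoly_zero, eval_one, one_mul, Nat.sub_zero] at h3
      rw [← h3, Finset.sum_range_succ, shellPoly_eval_eq_zero (Nat.lt_succ_self e), mul_zero,
        zero_mul, add_zero, Finset.mul_sum]
      refine Finset.sum_congr rfl fun i hi => ?_
      rw [Finset.mem_range] at hi
      rw [Nat.succ_sub (by omega), pow_succ]
      ring
    rw [h1]
    simp only [shellPoly_zero, eval_one, pow_zero, one_mul, Nat.sub_zero]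
    linear_combination h2

/-- The values at `u = 1/2` of the polynomials `shellPoly (d / 2)`. -/
def shellVal (d i : ℕ) : ℝ := (shellPoly (d / 2) i).eval (1 / 2)

theorem shellVal_odd (e i : ℕ) : shellVal (2 * e + 1) i =
    (shellPoly (((2 * e + 1 : ℕ) : ℝ) / 2) i).eval (((2 * e + 1 : ℕ) : ℝ) / 2 - e) := by
  rw [shellVal]
  congr 1
  push_cast
  ring

theorem shellPowerSum_eval_half (ρ : ℝ) {i : ℕ} (hi : i ≠ 0) :
    (shellPowerSum ρ i).eval (1 / 2) = (shellPowerSum ρ i).eval 1 := by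
  simp only [shellPowerSum, eval_mul, eval_C, eval_sub, bernoulliReal_eval_half_odd,
    bernoulliReal_eval_one_odd hi]

theorem newton_congr {s s' : ℕ → ℝ} (h : ∀ i, i ≠ 0 → s i = s' i) (n : ℕ) :
    newton s n = newton s' n := by
  induction n using Nat.strong_induction_on with
  | _ n ih =>
    rcases n with _ | n
    · simp [newton_zero]
    · rw [newton_succ, newton_succ]
      congr 1
      refine Finset.sum_congr rfl fun i _ => ?_
      rw [ih _ (by omega), h _ (Nat.succ_ne_zero i)]

/-- For even d the point 1/2 is not of the form ρ - e. But B_{2i+1} vanishes at both 1/2 and 1 for i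
≥ 1, so the relevant power sums agree there, and 1 = ρ - e. -/
theorem shellVal_even (e i : ℕ) : shellVal (2 * (e + 1)) i =
    (shellPoly (((2 * (e + 1) : ℕ) : ℝ) / 2) i).eval (((2 * (e + 1) : ℕ) : ℝ) / 2 - e) := by
  have h : (((2 * (e + 1) : ℕ) : ℝ) / 2 - e) = 1 := by push_cast; ring
  rw [shellVal, h, eval_shellPoly, eval_shellPoly]
  exact newton_congr (fun i hi => shellPowerSum_eval_half _ hi) i

theorem shellVal_zero (d : ℕ) : shellVal d 0 = 1 := by simp [shellVal, shellPoly_zero]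

theorem shellVal_zero_left (i : ℕ) : shellVal 0 (i + 1) = 0 := by
  have h : ∀ i, (shellPoly 0 (i + 1)).eval 1 = 0 := by
    intro i
    have h1 := shellPoly_eval_succ 0 0 i
    rw [shellPoly_eval_base] at h1
    simpa using h1.symm
  rw [shellVal, ← h i, eval_shellPoly, eval_shellPoly, Nat.cast_zero, zero_div]
  exact newton_congr (fun i hi => shellPowerSum_eval_half _ hi) _

theorem shellVal_odd_eq_zero {e i : ℕ} (h : e < i) : shellVal (2 * e + 1) i = 0 := by
  rw [shellVal_odd, shellPoly_eval_eq_zero h]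

theorem shellVal_even_eq_zero {e i : ℕ} (h : e < i) : shellVal (2 * (e + 1)) i = 0 := by
  rw [shellVal_even, shellPoly_eval_eq_zero h]

/-- The polynomial interpolating `d! μ_k` at the points `k + d / 2`, for the sphere of dimension
`d + 1`. -/
def multPoly (d : ℕ) (x : ℝ) : ℝ :=
  ∑ i ∈ Finset.range (d / 2 + 1), 2 * (-1) ^ i * shellVal d i * x ^ (d - 2 * i)

theorem multPoly_odd (e : ℕ) (x : ℝ) : multPoly (2 * e + 1) x =
    2 * x * ∏ m ∈ Finset.range e, (x ^ 2 - (1 / 2 + m) ^ 2) := by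
  have h := sum_shellPoly_eq_prod (((2 * e + 1 : ℕ) : ℝ) / 2) (x ^ 2) e
  have h1 : (((2 * e + 1 : ℕ) : ℝ) / 2) - e = 1 / 2 := by push_cast; ring
  rw [h1] at h
  rw [← h, multPoly, Finset.mul_sum, show (2 * e + 1) / 2 = e by omega]
  refine Finset.sum_congr rfl fun i hi => ?_
  rw [Finset.mem_range] at hi
  rw [shellVal, show 2 * e + 1 - 2 * i = 2 * (e - i) + 1 by omega, pow_succ, pow_mul]
  ring

theorem multPoly_even (e : ℕ) (x : ℝ) : multPoly (2 * (e + 1)) x =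
    2 * x ^ 2 * ∏ m ∈ Finset.range e, (x ^ 2 - (1 + m) ^ 2) := by
  have h := sum_shellPoly_eq_prod (((2 * (e + 1) : ℕ) : ℝ) / 2) (x ^ 2) e
  have h1 : (((2 * (e + 1) : ℕ) : ℝ) / 2) - e = 1 := by push_cast; ring
  simp_rw [← shellVal_even] at h
  rw [h1] at h
  rw [← h, multPoly, Finset.mul_sum, show 2 * (e + 1) / 2 = e + 1 by omega,
    Finset.sum_range_succ, shellVal_even_eq_zero (Nat.lt_succ_self e)]
  simp only [mul_zero, zero_mul, add_zero]
  refine Finset.sum_congr rfl fun i hi => ?_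
  rw [Finset.mem_range] at hi
  rw [show 2 * (e + 1) - 2 * i = 2 * (e - i) + 2 by omega, pow_add, pow_mul]
  ring

theorem multPoly_zero (x : ℝ) : multPoly 0 x = 2 := by
  simp [multPoly, shellVal_zero]

/-- Because of these zeros the sum over k + ρ extends to the whole grid 1/2 + ℕ at no cost. -/
theorem multPoly_odd_eq_zero {e k : ℕ} (h : k < e) : multPoly (2 * e + 1) (1 / 2 + k) = 0 := by
  rw [multPoly_odd, Finset.prod_eq_zero (Finset.mem_range.2 h) (by ring), mul_zero]

theorem multPoly_even_eq_zero {e k : ℕ} (h : k < e) : multPoly (2 * (e + 1)) (1 + k) = 0 := by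
  rw [multPoly_even, Finset.prod_eq_zero (Finset.mem_range.2 h) (by ring), mul_zero]

theorem prod_odd_eq_factorial (k e : ℕ) : (k.factorial : ℝ) *
    ∏ m ∈ Finset.range e, ((1 / 2 + (k + e : ℕ) : ℝ) ^ 2 - (1 / 2 + m) ^ 2) =
      (k + 2 * e).factorial := by
  induction e generalizing k with
  | zero => simp
  | succ e ih =>
    have h := ih (k + 1)
    rw [Finset.prod_range_succ, show k + (e + 1) = k + 1 + e by ring]
    rw [Nat.factorial_succ] at h
    rw [show k + 2 * (e + 1) = (k + 1 + 2 * e) + 1 by ring, Nat.factorial_succ (k + 1 + 2 * e)]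
    push_cast at h ⊢
    rw [← h]
    ring

theorem prod_even_eq_factorial (k e : ℕ) : (k.factorial : ℝ) * ((1 + (k + e : ℕ) : ℝ) *
    ∏ m ∈ Finset.range e, ((1 + (k + e : ℕ) : ℝ) ^ 2 - (1 + m) ^ 2)) =
      (k + 2 * e + 1).factorial := by
  induction e generalizing k with
  | zero => simp [Nat.factorial_succ]; ring
  | succ e ih =>
    have h := ih (k + 1)
    rw [Finset.prod_range_succ, show k + (e + 1) = k + 1 + e by ring]
    rw [Nat.factorial_succ] at h
    rw [show k + 2 * (e + 1) + 1 = (k + 1 + 2 * e + 1) + 1 by ring,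
      Nat.factorial_succ (k + 1 + 2 * e + 1)]
    push_cast at h ⊢
    rw [← h]
    ring

theorem sphMultiplicity_odd (e k : ℕ) : sphMultiplicity k (2 * e + 1 + 1) =
    multPoly (2 * e + 1) (1 / 2 + (k + e : ℕ)) / (2 * e + 1).factorial := by
  have h := prod_odd_eq_factorial k e
  have hk : (k.factorial : ℝ) ≠ 0 := by positivity
  have hd : ((2 * e + 1).factorial : ℝ) ≠ 0 := by positivity
  rw [multPoly_odd, eq_div_iff hd]
  have hg : ∀ a b c : ℝ, a * (b * c) = b * (a * c) := mul_left_comm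
  rw [← mul_right_inj' hk, hg _ (2 * _), h, sphMultiplicity]
  rcases k with _ | k
  · simp [Nat.factorial_succ]
    left
    ring
  · rw [if_neg (Nat.succ_ne_zero k), show k + 1 + (2 * e + 1 + 1) - 2 = k + 1 + 2 * e by omega,
      show 2 * e + 1 + 1 - 1 = 2 * e + 1 by omega]
    push_cast
    field_simp
    ring

theorem sphMultiplicity_even (e k : ℕ) : sphMultiplicity k (2 * (e + 1) + 1) =
    multPoly (2 * (e + 1)) (1 + (k + e : ℕ)) / (2 * (e + 1)).factorial := by
  have h := prod_even_eq_factorial k e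
  have hk : (k.factorial : ℝ) ≠ 0 := by positivity
  have hd : ((2 * (e + 1)).factorial : ℝ) ≠ 0 := by positivity
  rw [multPoly_even, eq_div_iff hd]
  have hg : ∀ a b c : ℝ, a * (2 * b ^ 2 * c) = 2 * b * (a * (b * c)) := fun a b c => by ring
  rw [← mul_right_inj' hk, hg, h, sphMultiplicity]
  rcases k with _ | k
  · simp [Nat.factorial_succ, mul_add]
    left
    ring
  · rw [if_neg (Nat.succ_ne_zero k), show k + 1 + (2 * (e + 1) + 1) - 2 = k + 1 + 2 * e + 1 by omega,
      show 2 * (e + 1) + 1 - 1 = 2 * (e + 1) by omega]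
    push_cast
    field_simp
    ring

theorem sphMultiplicity_zero_succ (k : ℕ) : sphMultiplicity (k + 1) (0 + 1) = 2 := by
  have := sphMultiplicity_succ k 0
  rw [this, Nat.factorial_succ]
  have : (k.factorial : ℝ) ≠ 0 := by positivity
  have : (k + 1 : ℝ) ≠ 0 := by positivity
  simp
  field_simp

theorem shellVal_eq_mul (d n : ℕ) : shellVal d n =
    (∏ m ∈ Finset.range n, (1 / 2 - (d : ℝ) / 2 + m)) * (shellQuot (d / 2) n).eval (1 / 2) :=
  eval_shellPoly_eq_mul _ _ _

/-- At u = 1/2 the linear factors of q_i are, up to sign, those by which Γ descends from (d+1)/2 to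
(d-2i+1)/2; what remains is a Gaussian moment. -/
theorem shiftedCoeff_of_le {d i : ℕ} (h : 2 * i ≤ d) : shiftedCoeff d i =
    (-1) ^ i * shellVal d i * Real.Gamma (((d - 2 * i : ℕ) + 1 : ℝ) / 2) / d.factorial := by
  have hG : ∀ i : ℕ, 2 * i ≤ d → Real.Gamma (((d : ℝ) + 1) / 2) =
      (∏ m ∈ Finset.range i, -(1 / 2 - (d : ℝ) / 2 + m)) *
        Real.Gamma (((d - 2 * i : ℕ) + 1 : ℝ) / 2) := by
    intro i
    induction i with
    | zero => simp
    | succ i ih =>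
      intro hi
      obtain ⟨c, rfl⟩ := Nat.exists_eq_add_of_le hi
      rw [ih (by omega), Finset.prod_range_succ]
      have h1 : 2 * (i + 1) + c - 2 * i = c + 2 := by omega
      have h2 : 2 * (i + 1) + c - 2 * (i + 1) = c := by omega
      rw [h1, h2, show (((c + 2 : ℕ) : ℝ) + 1) / 2 = ((c : ℝ) + 1) / 2 + 1 by push_cast; ring,
        Real.Gamma_add_one (by positivity), mul_assoc]
      congr 2
      push_cast
      ring
  rw [shiftedCoeff, hG i h, shellVal_eq_mul]
  have : ∏ m ∈ Finset.range i, -(1 / 2 - (d : ℝ) / 2 + m) =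
      (-1) ^ i * ∏ m ∈ Finset.range i, (1 / 2 - (d : ℝ) / 2 + m) := by
    rw [Finset.prod_neg, Finset.card_range]
  rw [this]
  ring

/-- For even d the linear factors at 1/2 are half-integers, never zero, so the zero of q_i belongs
to r_i. -/
theorem shiftedCoeff_even_eq_zero {e i : ℕ} (h : e < i) : shiftedCoeff (2 * e) i = 0 := by
  have h0 : shellVal (2 * e) i = 0 := by
    rcases e with _ | e
    · obtain ⟨i, rfl⟩ := Nat.exists_eq_succ_of_ne_zero h.ne'
      exact shellVal_zero_left i
    · exact shellVal_even_eq_zero (by omega)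
  rw [shellVal_eq_mul, mul_eq_zero] at h0
  rcases h0 with h0 | h0
  · rw [Finset.prod_eq_zero_iff] at h0
    obtain ⟨m, -, hm⟩ := h0
    exfalso
    have h1 : ((1 + 2 * m : ℕ) : ℝ) = (2 * e : ℕ) := by
      push_cast at hm ⊢
      linarith
    have h2 := Nat.cast_injective h1
    omega
  · rw [shiftedCoeff, h0, mul_zero]

theorem derivative_shellPowerSum (ρ : ℝ) (i : ℕ) :
    derivative (shellPowerSum ρ i) = C ((-1 : ℝ) ^ i) * bernoulliReal (2 * i) := by
  rw [shellPowerSum, derivative_C_mul, derivative_sub, derivative_C, sub_zero,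
    derivative_bernoulliReal, ← mul_assoc, ← C_mul]
  congr 2
  push_cast
  field_simp

/-- Here the linear factor m = e of q_n vanishes at 1/2, so r_n(1/2) is q_n'(1/2) divided by the
other factors, whose product is (-1)^e e! l!. By `derivative_newton`, q_n'(1/2) is a combination of
B_{2(n-i)}(1/2) with weights q_i(1/2), which vanish for i > e. These are the Euler-Maclaurin
boundary terms. -/
theorem shiftedCoeff_odd (e l : ℕ) : shiftedCoeff (2 * e + 1) (e + 1 + l) =
    -((-1) ^ l / l.factorial) * (∑ i ∈ Finset.range (e + 1), 2 * (-1) ^ i *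
      shellVal (2 * e + 1) i * ((bernoulliReal (2 * e + 1 - 2 * i + 2 * l + 1)).eval (1 / 2) /
        ((2 * e + 1 - 2 * i : ℕ) + 2 * l + 1))) / (2 * e + 1).factorial := by
  set ρ : ℝ := ((2 * e + 1 : ℕ) : ℝ) / 2 with hρ
  set n := e + 1 + l with hn
  have hρe : (1 / 2 : ℝ) - ρ = -e := by rw [hρ]; push_cast; ring
  have h1 : (derivative (shellPoly ρ n)).eval (1 / 2) =
      (-1) ^ e * e.factorial * l.factorial * (shellQuot ρ n).eval (1 / 2) := by
    rw [shellPoly_eq_mul_shellQuot, derivative_mul, eval_add, eval_mul, eval_mul]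
    have hz : (∏ m ∈ Finset.range n, (X - C (ρ - (m : ℝ)))).eval (1 / 2) = 0 := by
      rw [eval_prod]
      refine Finset.prod_eq_zero (i := e) (Finset.mem_range.2 (by omega)) ?_
      simp only [eval_sub, eval_X, eval_C]
      linarith
    rw [hz, zero_mul, add_zero]
    congr 1
    have hsplit : ∏ m ∈ Finset.range n, (X - C (ρ - (m : ℝ))) = (X - C (ρ - (e : ℝ))) *
        ((∏ m ∈ Finset.range e, (X - C (ρ - (m : ℝ)))) *
          ∏ m ∈ Finset.range l, (X - C (ρ - ((e + 1 + m : ℕ) : ℝ)))) := by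
      rw [hn, Finset.prod_range_add, Finset.prod_range_succ]
      ring
    rw [hsplit, derivative_mul, eval_add, eval_mul, eval_mul (p := X - C (ρ - (e : ℝ)))]
    have hz2 : (X - C (ρ - (e : ℝ))).eval (1 / 2) = 0 := by
      simp only [eval_sub, eval_X, eval_C]
      linarith
    rw [hz2, zero_mul, add_zero, derivative_X_sub_C, eval_one, one_mul, eval_mul, eval_prod,
      eval_prod]
    congr 1
    · have : ∀ m ∈ Finset.range e, (X - C (ρ - (m : ℝ))).eval (1 / 2) = -((e - 1 - m : ℕ) + 1 : ℝ) := by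
        intro m hm
        rw [Finset.mem_range] at hm
        rw [Nat.cast_sub (by omega), Nat.cast_sub (by omega)]
        simp only [eval_sub, eval_X, eval_C]
        push_cast
        linarith
      rw [Finset.prod_congr rfl this, Finset.prod_neg, Finset.card_range,
        Finset.prod_range_reflect (fun m => ((m : ℝ) + 1)), ← Finset.prod_range_add_one_eq_factorial]
      push_cast
      rfl
    · rw [← Finset.prod_range_add_one_eq_factorial]
      push_cast
      refine Finset.prod_congr rfl fun m _ => ?_
      simp only [eval_sub, eval_X, eval_C]
      linarith
  have h2 : (derivative (shellPoly ρ n)).eval (1 / 2) = ∑ i ∈ Finset.range (e + 1),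
      (-1) ^ (n - i) * shellVal (2 * e + 1) i * (2 * ((bernoulliReal (2 * e + 1 - 2 * i + 2 * l + 1)).eval (1 / 2) /
        ((2 * e + 1 - 2 * i : ℕ) + 2 * l + 1))) := by
    rw [shellPoly, derivative_newton, eval_finsetSum, ← Finset.sum_range_reflect]
    have hsub : Finset.range (e + 1) ⊆ Finset.range n := Finset.range_subset_range.2 (by omega)
    refine Eq.symm (Finset.sum_subset_zero_on_sdiff hsub ?_ ?_)
    · intro i hi
      rw [Finset.mem_sdiff, Finset.mem_range, Finset.mem_range] at hi
      rw [eval_mul, show n - 1 - (n - 1 - i) = i by omega]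
      change shellVal (2 * e + 1) i * _ = 0
      rw [shellVal_odd_eq_zero (by omega), zero_mul]
    · intro i hi
      rw [Finset.mem_range] at hi
      rw [eval_mul, show n - 1 - (n - 1 - i) = i by omega, derivative_shellPowerSum,
        show n - 1 - i + 1 = n - i by omega,
        show 2 * e + 1 - 2 * i + 2 * l + 1 = 2 * (n - i) by omega]
      change _ = shellVal (2 * e + 1) i * _
      have hc : (((n - 1 - i : ℕ) : ℝ) + 1) = ((2 * e + 1 - 2 * i : ℕ) + 2 * l + 1) / 2 := by
        rw [eq_div_iff two_ne_zero]
        have : (n - 1 - i + 1) * 2 = 2 * e + 1 - 2 * i + 2 * l + 1 := by omega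
        exact_mod_cast this
      rw [hc]
      simp only [eval_smul, eval_mul, eval_C, smul_eq_mul, inv_div]
      ring
  have he : (e.factorial : ℝ) ≠ 0 := by positivity
  have hl : (l.factorial : ℝ) ≠ 0 := by positivity
  have hsgn : (-1 : ℝ) ^ e * (-1) ^ e = 1 := by rw [← mul_pow]; simp
  have hr : (shellQuot ρ n).eval (1 / 2) = (-1) ^ e / (e.factorial * l.factorial) *
      (derivative (shellPoly ρ n)).eval (1 / 2) := by
    rw [h1]
    field_simp
    linear_combination -((shellQuot ρ n).eval (1 / 2)) * hsgn
  have hG : Real.Gamma ((((2 * e + 1 : ℕ) : ℝ) + 1) / 2) = e.factorial := by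
    rw [← Real.Gamma_nat_eq_factorial]
    congr 1
    push_cast
    ring
  rw [shiftedCoeff, hr, hG, h2, Finset.mul_sum, Finset.mul_sum, Finset.mul_sum, Finset.sum_div]
  refine Finset.sum_congr rfl fun i hi => ?_
  rw [Finset.mem_range] at hi
  have hs : (-1 : ℝ) ^ (n - i) = -((-1) ^ e * (-1) ^ l * (-1) ^ i) := by
    have h3 : (-1 : ℝ) ^ (n - i) * (-1) ^ (i + i) = (-1) ^ e * (-1) ^ l * (-1) ^ i * (-1) := by
      rw [← pow_add, ← pow_add, ← pow_add, ← pow_succ]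
      congr 1
      omega
    rw [pow_add, ← mul_pow] at h3
    simpa using h3
  rw [hs]
  field_simp
  rw [pow_two, hsgn]
  ring

end

end SphereHeat

/-! ### Asymptotic expansion of the spectral sum -/

namespace SphereHeat

noncomputable section

open Polynomial

/-- `g` has the asymptotic power series `∑ cₙ tⁿ` at `0+`, with explicit error bounds. -/
def HasPowerExp (g : ℝ → ℝ) (c : ℕ → ℝ) : Prop :=
  ∀ N : ℕ, ∃ C : ℝ, ∀ t : ℝ, 0 < t → t ≤ 1 →
    |g t - ∑ n ∈ Finset.range N, c n * t ^ n| ≤ C * t ^ N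

/-- The error may be cruder than the number of terms suggests, since surplus terms are themselves
O(t^N). This leaves room for the half-integral powers below. -/
theorem hasPowerExp_of_cofinal {g : ℝ → ℝ} {c : ℕ → ℝ}
    (h : ∀ N : ℕ, ∃ M, N ≤ M ∧ ∃ C : ℝ, ∀ t : ℝ, 0 < t → t ≤ 1 →
      |g t - ∑ n ∈ Finset.range M, c n * t ^ n| ≤ C * t ^ N) : HasPowerExp g c := by
  intro N
  obtain ⟨M, hM, C, hC⟩ := h N
  refine ⟨C + ∑ n ∈ Finset.Ico N M, |c n|, fun t ht ht1 => ?_⟩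
  have h1 : g t - ∑ n ∈ Finset.range N, c n * t ^ n =
      (g t - ∑ n ∈ Finset.range M, c n * t ^ n) + ∑ n ∈ Finset.Ico N M, c n * t ^ n := by
    rw [Finset.sum_Ico_eq_sub _ hM]
    ring
  rw [h1, add_mul, Finset.sum_mul]
  refine (abs_add_le _ _).trans (add_le_add (hC t ht ht1) ?_)
  refine (Finset.abs_sum_le_sum_abs _ _).trans (Finset.sum_le_sum fun n hn => ?_)
  rw [abs_mul, abs_pow, abs_of_pos ht]
  exact mul_le_mul_of_nonneg_left
    (pow_le_pow_of_le_one ht.le ht1 (Finset.mem_Ico.1 hn).1) (abs_nonneg _)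

theorem abs_partialSum_le (c : ℕ → ℝ) (N : ℕ) {t : ℝ} (ht : 0 < t) (ht1 : t ≤ 1) :
    |∑ n ∈ Finset.range N, c n * t ^ n| ≤ ∑ n ∈ Finset.range N, |c n| := by
  refine (Finset.abs_sum_le_sum_abs _ _).trans (Finset.sum_le_sum fun n _ => ?_)
  rw [abs_mul, abs_pow, abs_of_pos ht]
  exact mul_le_of_le_one_right (abs_nonneg _) (pow_le_one₀ ht.le ht1)

theorem HasPowerExp.mul {g h : ℝ → ℝ} {c e : ℕ → ℝ} (hg : HasPowerExp g c)
    (hh : HasPowerExp h e) : HasPowerExp (fun t => g t * h t)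
      (fun n => ∑ i ∈ Finset.range (n + 1), c i * e (n - i)) := by
  intro N
  obtain ⟨C₁, h₁⟩ := hg N
  obtain ⟨C₂, h₂⟩ := hh N
  obtain ⟨C₃, h₃⟩ := hh 0
  set A := ∑ n ∈ Finset.range N, |c n|
  set s := Finset.range N ×ˢ Finset.range N
  refine ⟨C₁ * C₃ + A * C₂ + ∑ x ∈ s with ¬ x.1 + x.2 < N, |c x.1 * e x.2|, fun t ht ht1 => ?_⟩
  set P := ∑ n ∈ Finset.range N, c n * t ^ n
  set Q := ∑ n ∈ Finset.range N, e n * t ^ n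
  have hS : ∑ n ∈ Finset.range N, (∑ i ∈ Finset.range (n + 1), c i * e (n - i)) * t ^ n =
      ∑ x ∈ s with x.1 + x.2 < N, c x.1 * e x.2 * t ^ (x.1 + x.2) := by
    rw [← Finset.sum_fiberwise_of_maps_to (t := Finset.range N) (g := fun x : ℕ × ℕ => x.1 + x.2)
      (fun x hx => by simpa using (Finset.mem_filter.1 hx).2)]
    refine Finset.sum_congr rfl fun n hn => ?_
    rw [Finset.mem_range] at hn
    rw [← Finset.Nat.sum_antidiagonal_eq_sum_range_succ (fun i j => c i * e j), Finset.sum_mul]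
    have hset : Finset.HasAntidiagonal.antidiagonal n =
        ((s.filter fun x => x.1 + x.2 < N).filter fun x => x.1 + x.2 = n) := by
      ext ⟨i, j⟩
      simp only [Finset.HasAntidiagonal.mem_antidiagonal, Finset.mem_filter, s, Finset.mem_product,
        Finset.mem_range]
      omega
    rw [hset]
    refine Finset.sum_congr rfl fun x hx => ?_
    rw [(Finset.mem_filter.1 hx).2]
  have hPQ : P * Q = ∑ x ∈ s with x.1 + x.2 < N, c x.1 * e x.2 * t ^ (x.1 + x.2) +
      ∑ x ∈ s with ¬ x.1 + x.2 < N, c x.1 * e x.2 * t ^ (x.1 + x.2) := by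
    rw [Finset.sum_filter_add_sum_filter_not, Finset.sum_mul_sum, ← Finset.sum_product']
    refine Finset.sum_congr rfl fun x _ => ?_
    rw [pow_add]
    ring
  have hdec : g t * h t - ∑ n ∈ Finset.range N,
      (∑ i ∈ Finset.range (n + 1), c i * e (n - i)) * t ^ n =
      (g t - P) * h t + P * (h t - Q) +
        ∑ x ∈ s with ¬ x.1 + x.2 < N, c x.1 * e x.2 * t ^ (x.1 + x.2) := by
    rw [hS]
    linear_combination hPQ
  have htN : 0 < t ^ N := by positivity
  rw [hdec, add_mul, add_mul]
  refine (abs_add_le _ _).trans (add_le_add ((abs_add_le _ _).trans (add_le_add ?_ ?_)) ?_)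
  · rw [abs_mul, mul_right_comm]
    have h4 := h₃ t ht ht1
    simp only [Finset.range_zero, Finset.sum_empty, sub_zero, pow_zero, mul_one] at h4
    exact mul_le_mul (h₁ t ht ht1) h4 (abs_nonneg _) ((abs_nonneg _).trans (h₁ t ht ht1))
  · rw [abs_mul, mul_assoc]
    exact mul_le_mul (abs_partialSum_le c N ht ht1) (h₂ t ht ht1) (abs_nonneg _)
      (Finset.sum_nonneg fun _ _ => abs_nonneg _)
  · rw [Finset.sum_mul]
    refine (Finset.abs_sum_le_sum_abs _ _).trans (Finset.sum_le_sum fun x hx => ?_)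
    rw [abs_mul, abs_pow, abs_of_pos ht]
    exact mul_le_mul_of_nonneg_left (pow_le_pow_of_le_one ht.le ht1
      (not_lt.1 (Finset.mem_filter.1 hx).2)) (abs_nonneg _)

theorem hasPowerExp_exp (b : ℝ) :
    HasPowerExp (fun t => Real.exp (b * t)) (fun n => b ^ n / n.factorial) := by
  intro N
  refine ⟨|b| ^ N * Real.exp |b|, fun t ht ht1 => ?_⟩
  have h := Complex.norm_exp_sub_sum_le_norm_mul_exp ((b * t : ℝ) : ℂ) N
  have h2 : Complex.exp ((b * t : ℝ) : ℂ) - ∑ m ∈ Finset.range N,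
      ((b * t : ℝ) : ℂ) ^ m / m.factorial =
      ((Real.exp (b * t) - ∑ n ∈ Finset.range N, b ^ n / n.factorial * t ^ n : ℝ) : ℂ) := by
    push_cast
    congr 1
    refine Finset.sum_congr rfl fun n _ => ?_
    ring
  rw [h2, Complex.norm_real, Complex.norm_real, Real.norm_eq_abs, Real.norm_eq_abs, abs_mul,
    abs_of_pos ht] at h
  refine h.trans ?_
  rw [mul_pow, mul_right_comm]
  gcongr
  exact mul_le_of_le_one_right (abs_nonneg _) ht1

/-- With s = √t, the Gaussian moments yield the coefficients with 2i ≤ d for any grid offset a; only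
the boundary terms, of weight s^{d+1}, see a. -/
theorem tsum_multPoly_asymptotics (d L : ℕ) {a : ℝ} (ha0 : 0 ≤ a) (ha1 : a ≤ 1) :
    ∃ C : ℝ, 0 ≤ C ∧ ∀ s : ℝ, 0 < s →
      |s ^ (d + 1) * ((∑' k : ℕ, multPoly d (a + k) * Real.exp (-s ^ 2 * (a + k) ^ 2)) /
          d.factorial) -
        ∑ i ∈ Finset.range (d / 2 + 1), shiftedCoeff d i * (s ^ 2) ^ i +
        ∑ l ∈ Finset.range (L + 1), s ^ (d + 1) * ((-1) ^ l / l.factorial *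
          (∑ i ∈ Finset.range (d / 2 + 1), 2 * (-1) ^ i * shellVal d i *
            ((bernoulliReal (d - 2 * i + 2 * l + 1)).eval a / ((d - 2 * i : ℕ) + 2 * l + 1))) /
              d.factorial) * (s ^ 2) ^ l| ≤ C * s ^ (d + 1 + (2 * L + 1)) := by
  choose C hC using fun i => gauss_sum_asymptotics (d - 2 * i) L ha0 ha1
  refine ⟨∑ i ∈ Finset.range (d / 2 + 1), |2 * (-1) ^ i * shellVal d i / d.factorial| * |C i|,
    Finset.sum_nonneg fun _ _ => by positivity, fun s hs => ?_⟩
  have h1 : ∑' k : ℕ, multPoly d (a + k) * Real.exp (-s ^ 2 * (a + k) ^ 2) =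
      ∑ i ∈ Finset.range (d / 2 + 1), 2 * (-1) ^ i * shellVal d i *
        ∑' k : ℕ, (a + k) ^ (d - 2 * i) * Real.exp (-s ^ 2 * (a + k) ^ 2) := by
    simp_rw [multPoly, Finset.sum_mul, ← tsum_mul_left, mul_assoc]
    refine Summable.tsum_finsetSum fun i _ => ?_
    exact (((summable_pow_mul_exp_neg_sq (d - 2 * i) ha0 ha1
      (by positivity : 0 < s ^ 2)).mul_left _).mul_left _).mul_left _
  have h2 : s ^ (d + 1) * ((∑' k : ℕ, multPoly d (a + k) * Real.exp (-s ^ 2 * (a + k) ^ 2)) /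
          d.factorial) -
        ∑ i ∈ Finset.range (d / 2 + 1), shiftedCoeff d i * (s ^ 2) ^ i +
        ∑ l ∈ Finset.range (L + 1), s ^ (d + 1) * ((-1) ^ l / l.factorial *
          (∑ i ∈ Finset.range (d / 2 + 1), 2 * (-1) ^ i * shellVal d i *
            ((bernoulliReal (d - 2 * i + 2 * l + 1)).eval a / ((d - 2 * i : ℕ) + 2 * l + 1))) /
              d.factorial) * (s ^ 2) ^ l =
      ∑ i ∈ Finset.range (d / 2 + 1), 2 * (-1) ^ i * shellVal d i / d.factorial *
        (s ^ (d + 1) * ((∑' k : ℕ, (a + k) ^ (d - 2 * i) * Real.exp (-s ^ 2 * (a + k) ^ 2)) -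
        Real.Gamma ((((d - 2 * i : ℕ) : ℝ) + 1) / 2) / 2 / s ^ (d - 2 * i + 1) +
        ∑ l ∈ Finset.range (L + 1), (bernoulliReal (d - 2 * i + 2 * l + 1)).eval a /
          ((d - 2 * i : ℕ) + 2 * l + 1) * ((-1) ^ l * (s ^ 2) ^ l / l.factorial))) := by
    rw [h1]
    simp_rw [Finset.mul_sum, Finset.sum_div, Finset.mul_sum, Finset.sum_mul]
    rw [Finset.sum_comm (s := Finset.range (L + 1)), ← Finset.sum_sub_distrib,
      ← Finset.sum_add_distrib]
    refine Finset.sum_congr rfl fun i hi => ?_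
    rw [Finset.mem_range] at hi
    rw [mul_add, mul_add, Finset.mul_sum, Finset.mul_sum, mul_sub, mul_sub]
    congr 1
    · congr 1
      · ring
      · rw [shiftedCoeff_of_le (by omega)]
        have : s ^ (d + 1) = (s ^ 2) ^ i * s ^ (d - 2 * i + 1) := by
          rw [← pow_mul, ← pow_add]; congr 1; omega
        rw [this]
        field_simp
    · refine Finset.sum_congr rfl fun l _ => ?_
      ring
  rw [h2, Finset.sum_mul]
  refine (Finset.abs_sum_le_sum_abs _ _).trans (Finset.sum_le_sum fun i _ => ?_)
  rw [abs_mul, abs_mul, abs_of_pos (by positivity : 0 < s ^ (d + 1)), mul_assoc |_| |C i|,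
    pow_add s (d + 1), mul_left_comm |C i|]
  gcongr
  exact (hC i s hs).trans (mul_le_mul_of_nonneg_right (le_abs_self _) (by positivity))

/-- The sum `∑ μ_k e^{-tλ_k}` over the spectrum of the sphere of dimension `d + 1`. -/
def spectralSum (d : ℕ) (t : ℝ) : ℝ :=
  ∑' k : ℕ, sphMultiplicity k (d + 1) * Real.exp (-t * sphEigenvalue k (d + 1))

theorem exp_mul_spectralSum (d : ℕ) (t : ℝ) :
    Real.exp (-((d : ℝ) / 2) ^ 2 * t) * spectralSum d t =
      ∑' k : ℕ, sphMultiplicity k (d + 1) * Real.exp (-t * (k + (d : ℝ) / 2) ^ 2) := by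
  rw [spectralSum, ← tsum_mul_left]
  refine tsum_congr fun k => ?_
  rw [mul_left_comm, ← Real.exp_add, sphEigenvalue]
  congr 2
  push_cast
  ring

theorem summable_multPoly (d : ℕ) {a t : ℝ} (ha0 : 0 ≤ a) (ha1 : a ≤ 1) (ht : 0 < t) :
    Summable fun k : ℕ => multPoly d (a + k) * Real.exp (-t * (a + k) ^ 2) := by
  simp_rw [multPoly, Finset.sum_mul, mul_assoc]
  refine summable_sum fun i _ => ?_
  exact (((summable_pow_mul_exp_neg_sq (d - 2 * i) ha0 ha1 ht).mul_left _).mul_left _).mul_left _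

theorem tsum_multPoly_odd (e : ℕ) {t : ℝ} (ht : 0 < t) :
    Real.exp (-(((2 * e + 1 : ℕ) : ℝ) / 2) ^ 2 * t) * spectralSum (2 * e + 1) t =
      (∑' k : ℕ, multPoly (2 * e + 1) (1 / 2 + k) * Real.exp (-t * (1 / 2 + k) ^ 2)) /
        (2 * e + 1).factorial := by
  rw [exp_mul_spectralSum, ← (summable_multPoly (2 * e + 1) (a := 1 / 2) (by norm_num) (by norm_num)
    ht).sum_add_tsum_nat_add e, Finset.sum_eq_zero, zero_add, ← tsum_div_const]
  · refine tsum_congr fun k => ?_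
    rw [sphMultiplicity_odd, div_mul_eq_mul_div]
    congr 4
    push_cast
    ring
  · intro k hk
    rw [multPoly_odd_eq_zero (Finset.mem_range.1 hk), zero_mul]

theorem tsum_multPoly_even (e : ℕ) {t : ℝ} (ht : 0 < t) :
    Real.exp (-(((2 * (e + 1) : ℕ) : ℝ) / 2) ^ 2 * t) * spectralSum (2 * (e + 1)) t =
      (∑' k : ℕ, multPoly (2 * (e + 1)) (1 + k) * Real.exp (-t * (1 + k) ^ 2)) /
        (2 * (e + 1)).factorial := by
  rw [exp_mul_spectralSum, ← (summable_multPoly (2 * (e + 1)) (a := 1) (by norm_num) (by norm_num)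
    ht).sum_add_tsum_nat_add e, Finset.sum_eq_zero, zero_add, ← tsum_div_const]
  · refine tsum_congr fun k => ?_
    rw [sphMultiplicity_even, div_mul_eq_mul_div]
    congr 4
    push_cast
    ring
  · intro k hk
    rw [multPoly_even_eq_zero (Finset.mem_range.1 hk), zero_mul]

/-- On the circle the constants have multiplicity 1, not the value 2 of the polynomial, so the mode
k = 0 is kept apart. -/
theorem tsum_multPoly_zero {t : ℝ} (ht : 0 < t) :
    Real.exp (-(((0 : ℕ) : ℝ) / 2) ^ 2 * t) * spectralSum 0 t =
      1 + (∑' k : ℕ, multPoly 0 (1 + k) * Real.exp (-t * (1 + k) ^ 2)) / (Nat.factorial 0) := by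
  have hs : Summable fun k : ℕ => sphMultiplicity k (0 + 1) *
      Real.exp (-t * (k + ((0 : ℕ) : ℝ) / 2) ^ 2) := by
    rw [← summable_nat_add_iff 1]
    refine (summable_multPoly 0 (a := 1) (by norm_num) (by norm_num) ht).congr fun k => ?_
    rw [sphMultiplicity_zero_succ, multPoly_zero]
    congr 3
    push_cast
    ring
  rw [exp_mul_spectralSum, hs.tsum_eq_zero_add]
  congr 1
  · simp [sphMultiplicity]
  · rw [← tsum_div_const]
    refine tsum_congr fun k => ?_
    rw [sphMultiplicity_zero_succ, multPoly_zero]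
    simp only [Nat.factorial_zero, Nat.cast_one, div_one]
    congr 3
    push_cast
    ring

theorem pow_succ_sqrt_eq_rpow (d : ℕ) {t : ℝ} (ht : 0 < t) :
    t ^ (((d : ℝ) + 1) / 2) = √t ^ (d + 1) := by
  rw [Real.sqrt_eq_rpow, ← Real.rpow_natCast, ← Real.rpow_mul ht.le]
  congr 1
  push_cast
  ring

theorem mul_sqrt_pow_le {C : ℝ} (hC : 0 ≤ C) {t : ℝ} (ht : 0 < t) (ht1 : t ≤ 1) (d L : ℕ) :
    C * √t ^ (d + 1 + (2 * L + 1)) ≤ C * t ^ L := by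
  refine mul_le_mul_of_nonneg_left ?_ hC
  have h : t ^ L = √t ^ (2 * L) := by rw [pow_mul, Real.sq_sqrt ht.le]
  rw [h]
  exact pow_le_pow_of_le_one (Real.sqrt_nonneg t) (Real.sqrt_le_one.2 ht1) (by omega)

theorem hasPowerExp_odd (e : ℕ) : HasPowerExp (fun t => t ^ ((((2 * e + 1 : ℕ) : ℝ) + 1) / 2) *
    (Real.exp (-(((2 * e + 1 : ℕ) : ℝ) / 2) ^ 2 * t) * spectralSum (2 * e + 1) t))
      (shiftedCoeff (2 * e + 1)) := by
  refine hasPowerExp_of_cofinal fun N => ?_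
  obtain ⟨C, hC0, hC⟩ := tsum_multPoly_asymptotics (2 * e + 1) N (a := 1 / 2) (by norm_num)
    (by norm_num)
  refine ⟨e + 1 + (N + 1), by omega, C, fun t ht ht1 => ?_⟩
  refine le_trans (le_of_eq ?_) ((hC √t (Real.sqrt_pos.2 ht)).trans
    (mul_sqrt_pow_le hC0 ht ht1 _ _))
  congr 1
  rw [tsum_multPoly_odd e ht, pow_succ_sqrt_eq_rpow _ ht, Real.sq_sqrt ht.le, Finset.sum_range_add,
    show (2 * e + 1) / 2 = e by omega, sub_add_eq_sub_sub, sub_eq_add_neg _ (Finset.sum _ _),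
    ← Finset.sum_neg_distrib]
  congr 1
  refine Finset.sum_congr rfl fun l _ => ?_
  -- For odd d the weight s^{d+1} is t^{e+1}, so the l-th boundary term is the coefficient of index
  -- e + 1 + l.
  rw [shiftedCoeff_odd, show 2 * e + 1 + 1 = 2 * (e + 1) by ring, pow_mul √t, Real.sq_sqrt ht.le,
    pow_add]
  ring

theorem sum_shiftedCoeff_even (e M : ℕ) (hM : e + 1 ≤ M) (t : ℝ) :
    ∑ n ∈ Finset.range M, shiftedCoeff (2 * e) n * t ^ n =
      ∑ n ∈ Finset.range (2 * e / 2 + 1), shiftedCoeff (2 * e) n * t ^ n := by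
  rw [show 2 * e / 2 = e by omega]
  refine (Finset.sum_subset (Finset.range_subset_range.2 hM) fun n _ hn => ?_).symm
  rw [Finset.mem_range] at hn
  rw [shiftedCoeff_even_eq_zero (by omega), zero_mul]

theorem hasPowerExp_even (e : ℕ) :
    HasPowerExp (fun t => t ^ ((((2 * (e + 1) : ℕ) : ℝ) + 1) / 2) *
      (Real.exp (-(((2 * (e + 1) : ℕ) : ℝ) / 2) ^ 2 * t) * spectralSum (2 * (e + 1)) t))
      (shiftedCoeff (2 * (e + 1))) := by
  refine hasPowerExp_of_cofinal fun N => ?_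
  obtain ⟨C, hC0, hC⟩ := tsum_multPoly_asymptotics (2 * (e + 1)) N (a := 1) (by norm_num)
    (by norm_num)
  refine ⟨e + 2 + N, by omega, C, fun t ht ht1 => ?_⟩
  refine le_trans (le_of_eq ?_) ((hC √t (Real.sqrt_pos.2 ht)).trans
    (mul_sqrt_pow_le hC0 ht ht1 _ _))
  congr 1
  rw [tsum_multPoly_even e ht, pow_succ_sqrt_eq_rpow _ ht, Real.sq_sqrt ht.le,
    sum_shiftedCoeff_even (e + 1) _ (by omega), Finset.sum_eq_zero (s := Finset.range (N + 1)),
    add_zero]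
  intro l _
  rw [Finset.sum_eq_zero]
  · simp
  · intro i hi
    rw [Finset.mem_range] at hi
    -- B₁(1) ≠ 0 could enter only through i = e + 1, where q_i(1/2) = 0; all other indices are odd
    -- and at least 3.
    rcases (by omega : i = e + 1 ∨ i ≤ e) with rfl | h
    · rw [shellVal_even_eq_zero (Nat.lt_succ_self e)]
      simp
    · rw [show 2 * (e + 1) - 2 * i + 2 * l + 1 = 2 * (e + 1 - i + l) + 1 by omega,
        bernoulliReal_eval_one_odd (by omega)]
      simp

theorem bernoulliReal_one_eval_one : (bernoulliReal 1).eval 1 = 1 / 2 := by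
  simp [bernoulliReal]
  norm_num

theorem hasPowerExp_zero :
    HasPowerExp (fun t => t ^ ((((0 : ℕ) : ℝ) + 1) / 2) *
      (Real.exp (-(((0 : ℕ) : ℝ) / 2) ^ 2 * t) * spectralSum 0 t)) (shiftedCoeff 0) := by
  refine hasPowerExp_of_cofinal fun N => ?_
  obtain ⟨C, hC0, hC⟩ := tsum_multPoly_asymptotics 0 N (a := 1) (by norm_num) (by norm_num)
  refine ⟨1 + N, by omega, C, fun t ht ht1 => ?_⟩
  refine le_trans (le_of_eq ?_) ((hC √t (Real.sqrt_pos.2 ht)).trans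
    (mul_sqrt_pow_le hC0 ht ht1 _ _))
  congr 1
  rw [tsum_multPoly_zero ht, pow_succ_sqrt_eq_rpow _ ht, Real.sq_sqrt ht.le]
  have h0 := sum_shiftedCoeff_even 0 (1 + N) (by omega) t
  rw [mul_zero] at h0
  rw [h0, Finset.sum_range_succ' _ N, Finset.sum_eq_zero (s := Finset.range N), mul_add]
  -- The boundary term 2 B₁(1) = 1 cancels the separate constant mode.
  · simp [shellVal_zero, bernoulliReal_one_eval_one]
    ring
  · intro l _
    simp only [Nat.zero_div, zero_add, Finset.sum_range_one, mul_zero]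
    rw [show 0 - 0 + 2 * (l + 1) + 1 = 2 * (l + 1) + 1 by omega, bernoulliReal_eval_one_odd (Nat.succ_ne_zero l)]
    simp

theorem hasPowerExp_shifted (d : ℕ) : HasPowerExp (fun t => t ^ (((d : ℝ) + 1) / 2) *
    (Real.exp (-((d : ℝ) / 2) ^ 2 * t) * spectralSum d t)) (shiftedCoeff d) := by
  rcases Nat.even_or_odd' d with ⟨e, rfl | rfl⟩
  · rcases e with _ | e
    · exact hasPowerExp_zero
    · exact hasPowerExp_even e
  · exact hasPowerExp_odd e

/-- The heat coefficients of the sphere of dimension `d + 1`. -/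
def heatCoeff (d n : ℕ) : ℝ :=
  ∑ i ∈ Finset.range (n + 1), shiftedCoeff d i * ((((d : ℝ) / 2) ^ 2) ^ (n - i) / (n - i).factorial)

theorem heatSum_eq_heatCoeff (d n w : ℕ) (hn : 1 ≤ n) (hw : 2 * n ≤ w) :
    heatSum n (d + 1) w = heatCoeff d n := by
  rw [heatSum_eq_sum d n w hn hw, heatCoeff]
  exact Finset.sum_congr rfl fun i _ => mul_comm _ _

theorem hasPowerExp_spectralSum (d : ℕ) :
    HasPowerExp (fun t => t ^ (((d : ℝ) + 1) / 2) * spectralSum d t) (heatCoeff d) := by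
  have h := (hasPowerExp_shifted d).mul (hasPowerExp_exp (((d : ℝ) / 2) ^ 2))
  have e : (fun t : ℝ => t ^ (((d : ℝ) + 1) / 2) * (Real.exp (-((d : ℝ) / 2) ^ 2 * t) *
      spectralSum d t) * Real.exp (((d : ℝ) / 2) ^ 2 * t)) =
      fun t => t ^ (((d : ℝ) + 1) / 2) * spectralSum d t := by
    funext t
    have : Real.exp (-((d : ℝ) / 2) ^ 2 * t) * Real.exp (((d : ℝ) / 2) ^ 2 * t) = 1 := by
      rw [← Real.exp_add, neg_mul, neg_add_cancel, Real.exp_zero]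
    linear_combination (t ^ (((d : ℝ) + 1) / 2) * spectralSum d t) * this
  rw [e] at h
  exact h

theorem summable_spectralSum (d : ℕ) {t : ℝ} (ht : 0 < t) : Summable fun k : ℕ =>
    sphMultiplicity k (d + 1) * Real.exp (-t * sphEigenvalue k (d + 1)) := by
  have hexp : ∀ (k : ℕ) (x : ℝ), x = k + (d : ℝ) / 2 →
      Real.exp (-t * sphEigenvalue k (d + 1)) =
        Real.exp (((d : ℝ) / 2) ^ 2 * t) * Real.exp (-t * x ^ 2) := by
    rintro k x rfl
    rw [← Real.exp_add, sphEigenvalue]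
    congr 1
    push_cast
    ring
  rcases Nat.even_or_odd' d with ⟨e, rfl | rfl⟩
  · rcases e with _ | e
    · rw [← summable_nat_add_iff 1]
      refine ((summable_multPoly 0 (a := 1) (by norm_num) (by norm_num) ht).mul_left
        (Real.exp ((((2 * 0 : ℕ) : ℝ) / 2) ^ 2 * t))).congr fun k => ?_
      rw [hexp (k + 1) (1 + k) (by push_cast; ring), mul_zero, sphMultiplicity_zero_succ,
        multPoly_zero]
      ring
    · refine (((summable_nat_add_iff e).2 (summable_multPoly (2 * (e + 1)) (a := 1) (by norm_num)
        (by norm_num) ht)).mul_left (Real.exp ((((2 * (e + 1) : ℕ) : ℝ) / 2) ^ 2 * t) /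
          (2 * (e + 1)).factorial)).congr fun k => ?_
      rw [hexp k (1 + (k + e : ℕ)) (by push_cast; ring), sphMultiplicity_even]
      ring
  · refine (((summable_nat_add_iff e).2 (summable_multPoly (2 * e + 1) (a := 1 / 2) (by norm_num)
      (by norm_num) ht)).mul_left (Real.exp ((((2 * e + 1 : ℕ) : ℝ) / 2) ^ 2 * t) /
        (2 * e + 1).factorial)).congr fun k => ?_
    rw [hexp k (1 / 2 + (k + e : ℕ)) (by push_cast; ring), sphMultiplicity_odd]
    ring

end

end SphereHeat

/-! ### Euclidean calculus of ‖x‖^{2m} p(x) -/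

namespace SphereHeat

noncomputable section

open MvPolynomial
open scoped Manifold ContDiff Topology

/-- The `i`-th partial derivative of a function on Euclidean space. -/
def partialDeriv {d : ℕ} (i : Fin (d + 1)) (F : Ambient d → ℝ) (x : Ambient d) : ℝ :=
  fderiv ℝ F x (EuclideanSpace.single i 1)

theorem laplacian_eq_sum_partialDeriv {d : ℕ} {F : Ambient d → ℝ} {x : Ambient d}
    (h : ContDiffAt ℝ ∞ F x) :
    Laplacian.laplacian F x = ∑ i, partialDeriv i (partialDeriv i F) x := by
  rw [InnerProductSpace.laplacian_eq_iteratedFDeriv_orthonormalBasis F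
    (EuclideanSpace.basisFun (Fin (d + 1)) ℝ)]
  refine Finset.sum_congr rfl fun i _ => ?_
  have h1 : DifferentiableAt ℝ (fderiv ℝ F) x :=
    (h.fderiv_right (m := 1) (by norm_cast)).differentiableAt (by norm_num)
  have h2 := fderiv_clm_apply h1 (differentiableAt_const (EuclideanSpace.single i (1 : ℝ)))
  rw [iteratedFDeriv_two_apply]
  simp only [partialDeriv]
  change _ = fderiv ℝ (fun y => fderiv ℝ F y (EuclideanSpace.single i 1)) x _
  rw [h2]
  simp

theorem contDiffAt_partialDeriv {d : ℕ} {F : Ambient d → ℝ} {x : Ambient d}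
    (h : ContDiffAt ℝ ∞ F x) (i : Fin (d + 1)) : ContDiffAt ℝ ∞ (partialDeriv i F) x :=
  (h.fderiv_right (m := ∞) (by norm_cast)).clm_apply contDiffAt_const

theorem partialDeriv_mul {d : ℕ} {F G : Ambient d → ℝ} {x : Ambient d}
    (hF : DifferentiableAt ℝ F x) (hG : DifferentiableAt ℝ G x) (i : Fin (d + 1)) :
    partialDeriv i (fun y => F y * G y) x =
      F x * partialDeriv i G x + partialDeriv i F x * G x := by
  simp only [partialDeriv]
  rw [fderiv_fun_mul hF hG]
  simp [mul_comm]

theorem partialDeriv_congr {d : ℕ} {F G : Ambient d → ℝ} {x : Ambient d}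
    (h : F =ᶠ[𝓝 x] G) (i : Fin (d + 1)) : partialDeriv i F x = partialDeriv i G x := by
  simp only [partialDeriv, h.fderiv_eq]

theorem sum_mul_partialDeriv {d : ℕ} (F : Ambient d → ℝ) (x : Ambient d) :
    ∑ i, x i * partialDeriv i F x = fderiv ℝ F x x := by
  have h : x = ∑ i, x i • EuclideanSpace.single i (1 : ℝ) := by
    ext j
    simp [Finset.sum_apply, Pi.single_apply]
  conv_rhs => rw [h]
  simp only [map_sum, map_smul, smul_eq_mul]
  rw [← h]
  rfl

theorem hasFDerivAt_eval {d : ℕ} (p : MvPolynomial (Fin (d + 1)) ℝ) (x : Ambient d) :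
    HasFDerivAt (fun y : Ambient d => eval y.ofLp p)
      (∑ i, eval x.ofLp (pderiv i p) • (EuclideanSpace.proj i : Ambient d →L[ℝ] ℝ)) x := by
  induction p using MvPolynomial.induction_on with
  | C a => simpa using hasFDerivAt_const a x
  | add p q hp hq =>
    simp only [map_add, add_smul, Finset.sum_add_distrib]
    exact hp.add hq
  | mul_X p j hp =>
    have h := hp.mul ((EuclideanSpace.proj j : Ambient d →L[ℝ] ℝ).hasFDerivAt (x := x))
    have e : (∑ i, eval x.ofLp (pderiv i (p * X j)) •
        (EuclideanSpace.proj i : Ambient d →L[ℝ] ℝ)) =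
        eval x.ofLp p • (EuclideanSpace.proj j : Ambient d →L[ℝ] ℝ) + x j •
        ∑ i, eval x.ofLp (pderiv i p) • (EuclideanSpace.proj i : Ambient d →L[ℝ] ℝ) := by
      ext y
      simp [pderiv_X, Pi.single_apply, mul_add, Finset.sum_add_distrib, Finset.mul_sum,
        mul_comm, mul_left_comm, apply_ite (eval x.ofLp)]
    have e' : (fun y : Ambient d => eval y.ofLp (p * X j)) =
        (fun y : Ambient d => eval y.ofLp p) * ⇑(EuclideanSpace.proj j : Ambient d →L[ℝ] ℝ) := by
      ext y
      simp
    rw [e, e']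
    exact h

theorem contDiff_eval {d : ℕ} (p : MvPolynomial (Fin (d + 1)) ℝ) :
    ContDiff ℝ ∞ (fun y : Ambient d => eval y.ofLp p) := by
  induction p using MvPolynomial.induction_on with
  | C a => simpa using contDiff_const
  | add p q hp hq => simpa using hp.add hq
  | mul_X p j hp =>
    simpa using hp.mul (EuclideanSpace.proj j : Ambient d →L[ℝ] ℝ).contDiff

theorem partialDeriv_eval {d : ℕ} (p : MvPolynomial (Fin (d + 1)) ℝ) (x : Ambient d)
    (i : Fin (d + 1)) :
    partialDeriv i (fun y => eval y.ofLp p) x = eval x.ofLp (pderiv i p) := by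
  simp [partialDeriv, (hasFDerivAt_eval p x).fderiv]

/-- The function `‖x‖ ^ (2 m)`. -/
def normSqPow {d : ℕ} (m : ℝ) (x : Ambient d) : ℝ := (‖x‖ ^ 2) ^ m

theorem contDiffAt_normSqPow {d : ℕ} (m : ℝ) {x : Ambient d} (hx : x ≠ 0) :
    ContDiffAt ℝ ∞ (normSqPow m) x :=
  (contDiff_norm_sq ℝ).contDiffAt.rpow_const_of_ne (by positivity)

theorem partialDeriv_normSqPow {d : ℕ} (m : ℝ) {x : Ambient d} (hx : x ≠ 0) (i : Fin (d + 1)) :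
    partialDeriv i (normSqPow m) x = 2 * m * x i * normSqPow (m - 1) x := by
  have h1 : HasFDerivAt (fun y : Ambient d => ‖y‖ ^ 2) (2 • innerSL ℝ x) x :=
    (hasStrictFDerivAt_norm_sq x).hasFDerivAt
  have h2 := h1.rpow_const (p := m) (Or.inl (by positivity))
  unfold partialDeriv
  change fderiv ℝ (fun y : Ambient d => (‖y‖ ^ 2) ^ m) x _ = _
  rw [h2.fderiv]
  simp [normSqPow, EuclideanSpace.inner_single_right]
  ring

theorem partialDeriv_normSqPow_mul_eval {d : ℕ} (m : ℝ) (p : MvPolynomial (Fin (d + 1)) ℝ)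
    {x : Ambient d} (hx : x ≠ 0) (i : Fin (d + 1)) :
    partialDeriv i (fun y => normSqPow m y * eval y.ofLp p) x =
      normSqPow (m - 1) x * eval x.ofLp (C (2 * m) * X i * p) +
        normSqPow m x * eval x.ofLp (pderiv i p) := by
  rw [partialDeriv_mul ((contDiffAt_normSqPow m hx).differentiableAt (by norm_num))
    ((contDiff_eval p).contDiffAt.differentiableAt (by norm_num)), partialDeriv_eval,
    partialDeriv_normSqPow m hx]
  simp only [map_mul, eval_C, eval_X]
  ring

theorem partialDeriv_add {d : ℕ} {F G : Ambient d → ℝ} {x : Ambient d}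
    (hF : DifferentiableAt ℝ F x) (hG : DifferentiableAt ℝ G x) (i : Fin (d + 1)) :
    partialDeriv i (fun y => F y + G y) x = partialDeriv i F x + partialDeriv i G x := by
  simp only [partialDeriv]
  rw [fderiv_fun_add hF hG]
  simp

/-- The Laplacian of a polynomial. -/
def polyLaplacian {d : ℕ} (p : MvPolynomial (Fin (d + 1)) ℝ) : MvPolynomial (Fin (d + 1)) ℝ :=
  ∑ i, pderiv i (pderiv i p)

/-- On the unit sphere the radial power contributes 2m(2m+d-1) p, and the cross term 4m x·∇p equals
4mk p by Euler's identity. -/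
theorem sum_partialDeriv_normSqPow_mul_eval {d : ℕ} (m : ℝ) {k : ℕ}
    {p : MvPolynomial (Fin (d + 1)) ℝ} (hp : p.IsHomogeneous k) {x : Ambient d} (hx : ‖x‖ = 1) :
    ∑ i, partialDeriv i (partialDeriv i (fun y => normSqPow m y * eval y.ofLp p)) x =
      2 * m * (2 * m + 2 * k + d - 1) * eval x.ofLp p + eval x.ofLp (polyLaplacian p) := by
  have hx0 : x ≠ 0 := by rintro rfl; simp at hx
  have hone : ∀ s : ℝ, normSqPow s x = 1 := fun s => by simp [normSqPow, hx]
  have key : ∀ i, partialDeriv i (partialDeriv i (fun y => normSqPow m y * eval y.ofLp p)) x =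
      4 * m * (m - 1) * (x i * x i) * eval x.ofLp p + 2 * m * eval x.ofLp p +
      4 * m * eval x.ofLp (X i * pderiv i p) + eval x.ofLp (pderiv i (pderiv i p)) := by
    intro i
    have h1 : partialDeriv i (fun y => normSqPow m y * eval y.ofLp p) =ᶠ[𝓝 x]
        fun y => normSqPow (m - 1) y * eval y.ofLp (C (2 * m) * X i * p) +
          normSqPow m y * eval y.ofLp (pderiv i p) := by
      filter_upwards [isOpen_ne.mem_nhds hx0] with y hy
      exact partialDeriv_normSqPow_mul_eval m p hy i
    have hd : ∀ (s : ℝ) (q : MvPolynomial (Fin (d + 1)) ℝ),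
        DifferentiableAt ℝ (fun y : Ambient d => normSqPow s y * eval y.ofLp q) x := fun s q =>
      ((contDiffAt_normSqPow s hx0).mul (contDiff_eval q).contDiffAt).differentiableAt
        (by norm_num)
    rw [partialDeriv_congr h1, partialDeriv_add (hd _ _) (hd _ _),
      partialDeriv_normSqPow_mul_eval _ _ hx0, partialDeriv_normSqPow_mul_eval _ _ hx0]
    simp only [hone, map_mul, eval_C, eval_X, pderiv_mul, pderiv_C, pderiv_X_self, map_add,
      map_zero]
    simp
    ring
  have hs : ∑ i, x i * x i = 1 := by
    have := EuclideanSpace.real_norm_sq_eq x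
    rw [hx] at this
    simpa [pow_two] using this.symm
  have he : ∑ i, eval x.ofLp (X i * pderiv i p) = k * eval x.ofLp p := by
    rw [← map_sum, hp.sum_X_mul_pderiv, nsmul_eq_mul, map_mul, map_natCast]
  simp only [key, Finset.sum_add_distrib, ← Finset.mul_sum, ← Finset.sum_mul, hs, he]
  simp [polyLaplacian]
  ring

end

end SphereHeat

/-! ### The Laplace-Beltrami operator on polynomials -/

namespace SphereHeat

noncomputable section

open MvPolynomial
open scoped Manifold ContDiff Topology

theorem eval_smul_of_isHomogeneous {σ : Type*} {k : ℕ} {p : MvPolynomial σ ℝ}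
    (hp : p.IsHomogeneous k) (c : ℝ) (x : σ → ℝ) : eval (c • x) p = c ^ k * eval x p := by
  rw [eval_eq, eval_eq, Finset.mul_sum]
  refine Finset.sum_congr rfl fun m hm => ?_
  have h := hp (mem_support_iff.1 hm)
  rw [Finsupp.weight_apply, Finsupp.sum] at h
  simp only [Pi.one_apply, smul_eq_mul, mul_one] at h
  simp only [Pi.smul_apply, smul_eq_mul, mul_pow, Finset.prod_mul_distrib, Finset.prod_pow_eq_pow_sum, h]
  ring

/-- The restriction of polynomials to the sphere. -/
def polyRestrict (d : ℕ) : MvPolynomial (Fin (d + 1)) ℝ →ₗ[ℝ] SmoothFun d where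
  toFun p := ⟨fun x => eval (x : Ambient d).ofLp p, by
    have : Fact (Module.finrank ℝ (Ambient d) = d + 1) := ⟨finrank_euclideanSpace_fin⟩
    exact (contDiff_eval p).contMDiff.comp contMDiff_coe_sphere⟩
  map_add' p q := by
    ext x
    exact map_add (eval (x : Ambient d).ofLp) p q
  map_smul' c p := by
    ext x
    exact smul_eval _ p c

theorem polyRestrict_apply {d : ℕ} (p : MvPolynomial (Fin (d + 1)) ℝ) (x : Sph d) :
    polyRestrict d p x = eval (x : Ambient d).ofLp p := rfl

theorem rayExtension_polyRestrict {d k : ℕ} {p : MvPolynomial (Fin (d + 1)) ℝ}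
    (hp : p.IsHomogeneous k) {x : Ambient d} (hx : x ≠ 0) :
    rayExtension (polyRestrict d p) x = normSqPow (-(k : ℝ) / 2) x * eval x.ofLp p := by
  have hn : 0 < ‖x‖ := norm_pos_iff.2 hx
  rw [rayExtension, polyRestrict_apply, coe_radial hx, WithLp.ofLp_smul, eval_smul_of_isHomogeneous hp]
  congr 1
  rw [normSqPow, ← Real.rpow_natCast ‖x‖ 2, ← Real.rpow_mul hn.le, inv_pow, ← Real.rpow_natCast,
    ← Real.rpow_neg hn.le]
  congr 1
  push_cast
  ring

theorem laplaceBeltrami_apply {d : ℕ} (f : SmoothFun d) (x : Sph d) :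
    laplaceBeltrami d f x = -(Laplacian.laplacian (rayExtension f) (x : Ambient d)) := rfl

/-- The extension constant along rays is ‖x‖^{-k} p, so 2m = -k and the scalar 2m(2m+2k+d-1) becomes
-k(k+d-1). -/
theorem laplaceBeltrami_polyRestrict {d k : ℕ} {p : MvPolynomial (Fin (d + 1)) ℝ}
    (hp : p.IsHomogeneous k) :
    laplaceBeltrami d (polyRestrict d p) =
      sphEigenvalue k d • polyRestrict d p - polyRestrict d (polyLaplacian p) := by
  ext x
  have hx : ‖(x : Ambient d)‖ = 1 := by simp
  have hx0 := sph_ne_zero x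
  have h1 : rayExtension (polyRestrict d p) =ᶠ[𝓝 (x : Ambient d)]
      fun y => normSqPow (-(k : ℝ) / 2) y * eval y.ofLp p := by
    filter_upwards [isOpen_ne.mem_nhds hx0] with y hy
    exact rayExtension_polyRestrict hp hy
  rw [laplaceBeltrami_apply, (InnerProductSpace.laplacian_congr_nhds h1).eq_of_nhds,
    laplacian_eq_sum_partialDeriv
      ((contDiffAt_normSqPow _ hx0).mul (contDiff_eval p).contDiffAt),
    sum_partialDeriv_normSqPow_mul_eval _ hp hx]
  change _ = sphEigenvalue k d * eval (x : Ambient d).ofLp p -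
    eval (x : Ambient d).ofLp (polyLaplacian p)
  rw [sphEigenvalue]
  ring

end

end SphereHeat

/-! ### Scalar product and symmetry of Δ by integration over a shell -/

namespace SphereHeat

noncomputable section

open MeasureTheory
open scoped Manifold ContDiff Topology

section Cutoff

variable {d : ℕ} {H : ℝ → ℝ} {K : Ambient d → ℝ}

theorem cutoff_mul_eventuallyEq_zero (h0 : ∀ s, s ≤ 1 → H s = 0) (K : Ambient d → ℝ) :
    (fun x : Ambient d => H (‖x‖ ^ 2) * K x) =ᶠ[𝓝 0] fun _ => 0 := by
  filter_upwards [Metric.ball_mem_nhds (0 : Ambient d) one_pos] with x hx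
  rw [mem_ball_zero_iff] at hx
  rw [h0 _ (by nlinarith [norm_nonneg x]), zero_mul]

theorem contDiff_cutoff_mul {n : WithTop ℕ∞} (hH : ContDiff ℝ n H) (h0 : ∀ s, s ≤ 1 → H s = 0)
    (hK : ∀ x, x ≠ 0 → ContDiffAt ℝ n K x) :
    ContDiff ℝ n fun x : Ambient d => H (‖x‖ ^ 2) * K x := by
  rw [contDiff_iff_contDiffAt]
  intro x
  rcases eq_or_ne x 0 with rfl | hx
  · exact contDiffAt_const.congr_of_eventuallyEq (cutoff_mul_eventuallyEq_zero h0 K)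
  · exact (hH.comp (contDiff_norm_sq ℝ)).contDiffAt.mul (hK x hx)

theorem hasCompactSupport_cutoff_mul (h3 : ∀ s, 3 ≤ s → H s = 0) (K : Ambient d → ℝ) :
    HasCompactSupport fun x : Ambient d => H (‖x‖ ^ 2) * K x := by
  refine HasCompactSupport.intro (isCompact_closedBall 0 2) fun x hx => ?_
  rw [mem_closedBall_zero_iff, not_le] at hx
  rw [h3 _ (by nlinarith), zero_mul]

theorem integrable_cutoff_mul (hH : ContDiff ℝ 0 H) (h0 : ∀ s, s ≤ 1 → H s = 0)
    (h3 : ∀ s, 3 ≤ s → H s = 0) (hK : ∀ x, x ≠ 0 → ContDiffAt ℝ 0 K x) :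
    Integrable fun x : Ambient d => H (‖x‖ ^ 2) * K x :=
  (contDiff_cutoff_mul hH h0 hK).continuous.integrable_of_hasCompactSupport
    (hasCompactSupport_cutoff_mul h3 K)

theorem integrable_partialDeriv {U : Ambient d → ℝ} (hU : ContDiff ℝ 1 U)
    (hc : HasCompactSupport U) (i : Fin (d + 1)) : Integrable (partialDeriv i U) :=
  ((hU.continuous_fderiv (by norm_num)).clm_apply
    continuous_const).integrable_of_hasCompactSupport
    (hc.fderiv_apply ℝ (EuclideanSpace.single i (1 : ℝ)))

theorem integral_partialDeriv {U : Ambient d → ℝ} (hU : ContDiff ℝ 1 U)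
    (hc : HasCompactSupport U) (i : Fin (d + 1)) : ∫ x, partialDeriv i U x = 0 := by
  have h := integral_mul_fderiv_eq_neg_fderiv_mul_of_integrable (μ := volume) (𝕜 := ℝ)
    (f := fun _ : Ambient d => (1 : ℝ)) (g := U) (v := EuclideanSpace.single i (1 : ℝ))
    (by simp) (by simp only [one_mul]; exact integrable_partialDeriv hU hc i)
    (by simpa using hU.continuous.integrable_of_hasCompactSupport hc)
    (fun _ _ => differentiableAt_const _) (fun x _ => hU.differentiable (by norm_num) x)
  simpa [partialDeriv] using h

theorem partialDeriv_comp_norm_sq (hH : ContDiff ℝ ∞ H) (x : Ambient d) (i : Fin (d + 1)) :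
    partialDeriv i (fun y => H (‖y‖ ^ 2)) x = 2 * deriv H (‖x‖ ^ 2) * x i := by
  have h1 : HasFDerivAt (fun y : Ambient d => ‖y‖ ^ 2) (2 • innerSL ℝ x) x :=
    (hasStrictFDerivAt_norm_sq x).hasFDerivAt
  have h2 := (hH.differentiable (by norm_num) (‖x‖ ^ 2)).hasDerivAt.comp_hasFDerivAt x h1
  unfold partialDeriv
  change fderiv ℝ (H ∘ fun y : Ambient d => ‖y‖ ^ 2) x _ = _
  rw [h2.fderiv]
  simp [EuclideanSpace.inner_single_right]
  ring

end Cutoff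

section Green

variable {d : ℕ} {H : ℝ → ℝ} {F G : Ambient d → ℝ}

/-- The gradient of the cutoff is radial and F, G have no radial derivative, so the cutoff passes
through the divergence of F∇G - G∇F. -/
theorem sum_partialDeriv_cutoff_wronskian (hH : ContDiff ℝ ∞ H) (h0 : ∀ s, s ≤ 1 → H s = 0)
    (hF : ∀ x, x ≠ 0 → ContDiffAt ℝ ∞ F x) (hG : ∀ x, x ≠ 0 → ContDiffAt ℝ ∞ G x)
    (rF : ∀ x, x ≠ 0 → fderiv ℝ F x x = 0) (rG : ∀ x, x ≠ 0 → fderiv ℝ G x x = 0)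
    (x : Ambient d) :
    ∑ i, partialDeriv i (fun y => H (‖y‖ ^ 2) *
        (F y * partialDeriv i G y - partialDeriv i F y * G y)) x =
      H (‖x‖ ^ 2) * (F x * Laplacian.laplacian G x - Laplacian.laplacian F x * G x) := by
  rcases eq_or_ne x 0 with rfl | hx
  · rw [Finset.sum_eq_zero, h0 _ (by simp), zero_mul]
    intro i _
    rw [partialDeriv_congr (cutoff_mul_eventuallyEq_zero h0 _)]
    simp [partialDeriv]
  have dF := (hF x hx).differentiableAt (by norm_num)
  have dG := (hG x hx).differentiableAt (by norm_num)
  have dF' := fun i => (contDiffAt_partialDeriv (hF x hx) i).differentiableAt (by norm_num)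
  have dG' := fun i => (contDiffAt_partialDeriv (hG x hx) i).differentiableAt (by norm_num)
  have key : ∀ i, partialDeriv i (fun y => H (‖y‖ ^ 2) *
      (F y * partialDeriv i G y - partialDeriv i F y * G y)) x =
      H (‖x‖ ^ 2) * (F x * partialDeriv i (partialDeriv i G) x) -
      H (‖x‖ ^ 2) * (partialDeriv i (partialDeriv i F) x * G x) +
      (2 * deriv H (‖x‖ ^ 2) * F x * (x i * partialDeriv i G x) -
        2 * deriv H (‖x‖ ^ 2) * G x * (x i * partialDeriv i F x)) := by
    intro i
    have e1 : DifferentiableAt ℝ (fun y => F y * partialDeriv i G y) x := dF.mul (dG' i)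
    have e2 : DifferentiableAt ℝ (fun y => partialDeriv i F y * G y) x := (dF' i).mul dG
    have e3 : DifferentiableAt ℝ (fun y : Ambient d => H (‖y‖ ^ 2)) x :=
      (hH.comp (contDiff_norm_sq ℝ)).differentiable (by norm_num) x
    have h1 : partialDeriv i (fun y => F y * partialDeriv i G y - partialDeriv i F y * G y) x =
        partialDeriv i (fun y => F y * partialDeriv i G y) x -
        partialDeriv i (fun y => partialDeriv i F y * G y) x := by
      rw [partialDeriv, fderiv_fun_sub e1 e2]
      rfl
    rw [partialDeriv_mul (G := fun y => F y * partialDeriv i G y - partialDeriv i F y * G y)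
      e3 (e1.sub e2), h1, partialDeriv_mul dF (dG' i),
      partialDeriv_mul (dF' i) dG, partialDeriv_comp_norm_sq hH]
    ring
  simp only [key, Finset.sum_add_distrib, Finset.sum_sub_distrib, ← Finset.mul_sum,
    ← Finset.sum_mul, sum_mul_partialDeriv, rF x hx, rG x hx,
    ← laplacian_eq_sum_partialDeriv (hF x hx), ← laplacian_eq_sum_partialDeriv (hG x hx)]
  ring

theorem integral_cutoff_wronskian (hH : ContDiff ℝ ∞ H) (h0 : ∀ s, s ≤ 1 → H s = 0)
    (h3 : ∀ s, 3 ≤ s → H s = 0)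
    (hF : ∀ x, x ≠ 0 → ContDiffAt ℝ ∞ F x) (hG : ∀ x, x ≠ 0 → ContDiffAt ℝ ∞ G x)
    (rF : ∀ x, x ≠ 0 → fderiv ℝ F x x = 0) (rG : ∀ x, x ≠ 0 → fderiv ℝ G x x = 0) :
    ∫ x : Ambient d, H (‖x‖ ^ 2) *
      (F x * Laplacian.laplacian G x - Laplacian.laplacian F x * G x) = 0 := by
  have hU : ∀ i, ContDiff ℝ 1 (fun y => H (‖y‖ ^ 2) *
      (F y * partialDeriv i G y - partialDeriv i F y * G y)) := fun i =>
    (contDiff_cutoff_mul hH h0 fun x hx =>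
      ((hF x hx).mul (contDiffAt_partialDeriv (hG x hx) i)).sub
        ((contDiffAt_partialDeriv (hF x hx) i).mul (hG x hx))).of_le (by norm_cast)
  have hc := fun i => hasCompactSupport_cutoff_mul h3
    (fun y => F y * partialDeriv i G y - partialDeriv i F y * G y)
  simp_rw [← sum_partialDeriv_cutoff_wronskian hH h0 hF hG rF rG]
  rw [integral_finsetSum _ fun i _ => integrable_partialDeriv (hU i) (hc i) i]
  exact Finset.sum_eq_zero fun i _ => integral_partialDeriv (hU i) (hc i) i

end Green

section RayExtension

variable {d : ℕ}

theorem radial_smul (x : Ambient d) {c : ℝ} (hc : 0 < c) : radial d (c • x) = radial d x := by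
  rcases eq_or_ne x 0 with rfl | hx
  · simp
  · ext1
    rw [coe_radial hx, coe_radial (smul_ne_zero hc.ne' hx), smul_smul, norm_smul,
      Real.norm_of_nonneg hc.le]
    congr 1
    field_simp

theorem rayExtension_smul (f : Sph d → ℝ) (x : Ambient d) {c : ℝ} (hc : 0 < c) :
    rayExtension f (c • x) = rayExtension f x := by
  rw [rayExtension, radial_smul x hc, rayExtension]

theorem fderiv_rayExtension_self (f : SmoothFun d) {x : Ambient d} (hx : x ≠ 0) :
    fderiv ℝ (rayExtension f) x x = 0 := by
  have h1 : HasFDerivAt (rayExtension f) (fderiv ℝ (rayExtension f) x) ((1 : ℝ) • x) := by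
    rw [one_smul]
    exact ((contDiffAt_rayExtension f hx).differentiableAt (by norm_num)).hasFDerivAt
  have h2 : HasDerivAt (fun c : ℝ => c • x) x 1 := by
    simpa using (hasDerivAt_id (1 : ℝ)).smul_const x
  have h3 := h1.comp_hasDerivAt (1 : ℝ) h2
  have h4 : HasDerivAt (rayExtension f ∘ fun c : ℝ => c • x) 0 1 := by
    refine (hasDerivAt_const (1 : ℝ) (rayExtension f x)).congr_of_eventuallyEq ?_
    filter_upwards [lt_mem_nhds one_pos] with c hc
    exact rayExtension_smul f x hc
  exact h3.unique h4

theorem partialDeriv_smul_of_homogeneous {K : Ambient d → ℝ} {c a : ℝ} (hc : c ≠ 0)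
    (h : ∀ y, K (c • y) = a * K y) (x : Ambient d) (i : Fin (d + 1)) :
    partialDeriv i K (c • x) = c⁻¹ * a * partialDeriv i K x := by
  have h1 := fderiv_comp_smul (𝕜 := ℝ) (f := K) (x := x) c
  have h2 : (fun y => K (c • y)) = fun y => a • K y := funext h
  have h4 : fderiv ℝ (fun y => a • K y) x = a • fderiv ℝ K x :=
    congrFun (fderiv_const_smul_field (f := K) a) x
  rw [h2, h4] at h1
  have h3 := congrArg (fun L : Ambient d →L[ℝ] ℝ => L (EuclideanSpace.single i 1)) h1
  simp only [smul_apply, smul_eq_mul] at h3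
  rw [partialDeriv, partialDeriv, mul_assoc, h3]
  field_simp

theorem laplacian_rayExtension_smul (f : SmoothFun d) {x : Ambient d} (hx : x ≠ 0) {c : ℝ}
    (hc : 0 < c) : Laplacian.laplacian (rayExtension f) (c • x) =
      (c ^ 2)⁻¹ * Laplacian.laplacian (rayExtension f) x := by
  rw [laplacian_eq_sum_partialDeriv (contDiffAt_rayExtension f hx), laplacian_eq_sum_partialDeriv
    (contDiffAt_rayExtension f (smul_ne_zero hc.ne' hx)), Finset.mul_sum]
  refine Finset.sum_congr rfl fun i _ => ?_
  have h1 : ∀ y, partialDeriv i (rayExtension f) (c • y) =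
      c⁻¹ * partialDeriv i (rayExtension f) y := fun y => by
    rw [partialDeriv_smul_of_homogeneous hc.ne'
      (fun z => (rayExtension_smul f z hc).trans (one_mul _).symm), mul_one]
  rw [partialDeriv_smul_of_homogeneous hc.ne' h1]
  congr 1
  field_simp

theorem rayExtension_laplaceBeltrami (f : SmoothFun d) {x : Ambient d} (hx : x ≠ 0) :
    rayExtension (laplaceBeltrami d f) x =
      -(‖x‖ ^ 2 * Laplacian.laplacian (rayExtension f) x) := by
  have hn : 0 < ‖x‖ := norm_pos_iff.2 hx
  rw [rayExtension, laplaceBeltrami_apply, coe_radial hx,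
    laplacian_rayExtension_smul f hx (inv_pos.2 hn)]
  field_simp

end RayExtension

/-- A bump function on the line, positive near `2` and vanishing off `(1, 3)`. -/
def shellBump : ContDiffBump (2 : ℝ) := ⟨1 / 2, 1, by norm_num, by norm_num⟩

theorem shellBump_of_le {s : ℝ} (hs : s ≤ 1) : shellBump s = 0 :=
  shellBump.zero_of_le_dist (by
    rw [Real.dist_eq, abs_of_nonpos (by linarith)]
    change (1 : ℝ) ≤ _
    linarith)

theorem shellBump_of_ge {s : ℝ} (hs : 3 ≤ s) : shellBump s = 0 :=
  shellBump.zero_of_le_dist (by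
    rw [Real.dist_eq, abs_of_nonneg (by linarith)]
    change (1 : ℝ) ≤ _
    linarith)

variable {d : ℕ}

theorem contDiffAt_rayExtension_mul (f g : SmoothFun d) {x : Ambient d} (hx : x ≠ 0) :
    ContDiffAt ℝ ∞ (fun y => rayExtension f y * rayExtension g y) x :=
  (contDiffAt_rayExtension f hx).mul (contDiffAt_rayExtension g hx)

theorem integrable_shell (f g : SmoothFun d) :
    Integrable fun x : Ambient d =>
      shellBump (‖x‖ ^ 2) * (rayExtension f x * rayExtension g x) :=
  integrable_cutoff_mul shellBump.contDiff (fun _ => shellBump_of_le) (fun _ => shellBump_of_ge)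
    fun _ hx => (contDiffAt_rayExtension_mul f g hx).of_le (by norm_cast)

/-- A scalar product on smooth functions on the sphere, proportional to that of `L²(S^d)`. -/
def sphInner (d : ℕ) : LinearMap.BilinForm ℝ (SmoothFun d) :=
  LinearMap.mk₂ ℝ (fun f g => ∫ x : Ambient d,
    shellBump (‖x‖ ^ 2) * (rayExtension f x * rayExtension g x))
    (fun f f' g => by
      rw [← integral_add (integrable_shell f g) (integrable_shell f' g)]
      refine integral_congr_ae (.of_forall fun x => ?_)
      change _ * ((rayExtension f x + rayExtension f' x) * _) = _
      ring)
    (fun c f g => by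
      rw [smul_eq_mul, ← integral_const_mul]
      refine integral_congr_ae (.of_forall fun x => ?_)
      change _ * (c * rayExtension f x * _) = _
      ring)
    (fun f g g' => by
      rw [← integral_add (integrable_shell f g) (integrable_shell f g')]
      refine integral_congr_ae (.of_forall fun x => ?_)
      change _ * (_ * (rayExtension g x + rayExtension g' x)) = _
      ring)
    (fun c f g => by
      rw [smul_eq_mul, ← integral_const_mul]
      refine integral_congr_ae (.of_forall fun x => ?_)
      change _ * (_ * (c * rayExtension g x)) = _
      ring)

theorem sphInner_apply (f g : SmoothFun d) : sphInner d f g = ∫ x : Ambient d,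
    shellBump (‖x‖ ^ 2) * (rayExtension f x * rayExtension g x) := rfl

theorem sphInner_comm (f g : SmoothFun d) : sphInner d f g = sphInner d g f := by
  simp only [sphInner_apply, mul_comm (rayExtension f _)]

theorem sphInner_laplaceBeltrami (f g : SmoothFun d) :
    sphInner d (laplaceBeltrami d f) g = sphInner d f (laplaceBeltrami d g) := by
  -- The extra factor s = ‖x‖² compensates the homogeneity of degree -2 of the Euclidean Laplacian
  -- of a ray extension.
  have h := integral_cutoff_wronskian (d := d) (H := fun s => s * shellBump s)
    (F := rayExtension f) (G := rayExtension g)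
    (contDiff_id.mul shellBump.contDiff) (fun s hs => by simp [shellBump_of_le hs])
    (fun s hs => by simp [shellBump_of_ge hs]) (fun x hx => contDiffAt_rayExtension f hx)
    (fun x hx => contDiffAt_rayExtension g hx) (fun x hx => fderiv_rayExtension_self f hx)
    (fun x hx => fderiv_rayExtension_self g hx)
  rw [← sub_eq_zero, ← h, sphInner_apply, sphInner_apply,
    ← integral_sub (integrable_shell _ _) (integrable_shell _ _)]
  refine integral_congr_ae (.of_forall fun x => ?_)
  rcases eq_or_ne x 0 with rfl | hx
  · simp [shellBump_of_le]
  · simp only [rayExtension_laplaceBeltrami _ hx]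
    ring

theorem eq_zero_of_shell_eq_zero {K : Sph d → ℝ} (hK : Continuous K) (hnn : ∀ x, 0 ≤ K x)
    (h : ∫ x : Ambient d, shellBump (‖x‖ ^ 2) * K (radial d x) = 0) (x : Sph d) : K x = 0 := by
  by_contra hx
  have hcont : Continuous fun x : Ambient d => shellBump (‖x‖ ^ 2) * K (radial d x) :=
    (contDiff_cutoff_mul (n := 0) (H := shellBump) (K := fun x => K (radial d x))
      shellBump.contDiff (fun _ => shellBump_of_le) fun y hy => by
        refine contDiffAt_zero.2 ⟨{0}ᶜ, isOpen_compl_singleton.mem_nhds hy, fun z hz => ?_⟩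
        exact (hK.continuousAt.comp (contMDiffAt_radial hz).continuousAt).continuousWithinAt).continuous
  have hx1 : ‖(x : Ambient d)‖ = 1 := by simp
  refine (hcont.integral_pos_of_hasCompactSupport_nonneg_nonzero (μ := volume)
    (hasCompactSupport_cutoff_mul (fun _ => shellBump_of_ge) _)
    (fun y => mul_nonneg shellBump.nonneg (hnn _)) (x := Real.sqrt 2 • (x : Ambient d)) ?_).ne' h
  have hr : radial d (x : Ambient d) = x := by
    ext1
    rw [coe_radial (sph_ne_zero x), hx1, inv_one, one_smul]
  rw [radial_smul _ (by positivity), hr, norm_smul, hx1]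
  refine mul_ne_zero ?_ hx
  have : shellBump (2 : ℝ) ≠ 0 := (shellBump.pos_of_mem_ball (by
    simpa using shellBump.rOut_pos)).ne'
  simpa using this

theorem eq_zero_of_sphInner_self {f : SmoothFun d} (h : sphInner d f f = 0) : f = 0 := by
  ext x
  have := eq_zero_of_shell_eq_zero (K := fun x => f x * f x)
    (f.contMDiff.continuous.mul f.contMDiff.continuous) (fun x => mul_self_nonneg _) h x
  exact mul_self_eq_zero.1 this

end

end SphereHeat

/-! ### Polynomial spaces, orthogonal splitting and density -/

namespace SphereHeat

noncomputable section

open MvPolynomial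
open scoped Manifold ContDiff Topology

section Algebra

theorem polyLaplacian_isHomogeneous {d k : ℕ} {p : MvPolynomial (Fin (d + 1)) ℝ}
    (hp : p.IsHomogeneous (k + 2)) : (polyLaplacian p).IsHomogeneous k :=
  IsHomogeneous.sum _ _ _ fun _ _ => hp.pderiv.pderiv

theorem polyLaplacian_eq_zero {d k : ℕ} (hk : k < 2) {p : MvPolynomial (Fin (d + 1)) ℝ}
    (hp : p.IsHomogeneous k) : polyLaplacian p = 0 := by
  refine Finset.sum_eq_zero fun i _ => ?_
  have h : (pderiv i p).IsHomogeneous 0 := by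
    have := hp.pderiv (i := i)
    rwa [show k - 1 = 0 by omega] at this
  rw [← totalDegree_zero_iff_isHomogeneous, totalDegree_eq_zero_iff_eq_C] at h
  rw [h, pderiv_C]

theorem finrank_homogeneousSubmodule (d k : ℕ) :
    Module.finrank ℝ (homogeneousSubmodule (Fin (d + 1)) ℝ k) = (d + k).choose k := by
  classical
  have e : ({m : Fin (d + 1) →₀ ℕ | m.degree = k} : Set (Fin (d + 1) →₀ ℕ)) =
      ((Finset.univ : Finset (Fin (d + 1))).finsuppAntidiag k : Set (Fin (d + 1) →₀ ℕ)) := by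
    ext m
    simp [Finsupp.degree_eq_sum]
  rw [homogeneousSubmodule_eq_finsupp_supported, e,
    (AddMonoidAlgebra.supportedEquivFinsupp
      (R := ℝ) (S := ℝ) (((Finset.univ : Finset (Fin (d + 1))).finsuppAntidiag k :
        Set (Fin (d + 1) →₀ ℕ)))).finrank_eq, Module.finrank_finsupp_self]
  simp only [Finset.coe_sort_coe, Fintype.card_coe]
  rw [Finset.card_finsuppAntidiag_nat_eq_choose]
  simp [show d + 1 + k - 1 = d + k by omega]

end Algebra

section Spaces

/-- Restrictions to the sphere of homogeneous polynomials of degree `k`. -/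
def polySpace (d k : ℕ) : Submodule ℝ (SmoothFun d) :=
  (homogeneousSubmodule (Fin (d + 1)) ℝ k).map (polyRestrict d)

/-- Restrictions to the sphere of homogeneous polynomials of degree `k - 2`. -/
def lowerSpace (d : ℕ) : ℕ → Submodule ℝ (SmoothFun d)
  | 0 => ⊥
  | 1 => ⊥
  | k + 2 => polySpace d k

variable {d : ℕ}

instance (k : ℕ) : FiniteDimensional ℝ (polySpace d k) := by
  have : Module.Finite ℝ (homogeneousSubmodule (Fin (d + 1)) ℝ k) :=
    Module.Finite.iff_fg.2 (homogeneousSubmodule_fg _ _ k)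
  unfold polySpace
  infer_instance

theorem norm_smul_coe_radial (x : Ambient d) : ‖x‖ • (radial d x : Ambient d) = x := by
  rcases eq_or_ne x 0 with rfl | hx
  · simp
  · rw [coe_radial hx, smul_inv_smul₀ (norm_ne_zero_iff.2 hx)]

theorem eq_zero_of_polyRestrict_eq_zero {k : ℕ} {p : MvPolynomial (Fin (d + 1)) ℝ}
    (hp : p.IsHomogeneous k) (h : polyRestrict d p = 0) : p = 0 := by
  refine MvPolynomial.funext fun r => ?_
  have h1 : r = ‖WithLp.toLp 2 r‖ • (radial d (WithLp.toLp 2 r) : Ambient d).ofLp := by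
    rw [← WithLp.ofLp_smul, norm_smul_coe_radial]
  have h2 : eval (radial d (WithLp.toLp 2 r) : Ambient d).ofLp p = 0 :=
    DFunLike.congr_fun h (radial d (WithLp.toLp 2 r))
  rw [h1, eval_smul_of_isHomogeneous hp, h2, mul_zero, map_zero]

theorem finrank_polySpace (d k : ℕ) :
    Module.finrank ℝ (polySpace d k) = (d + k).choose k := by
  rw [← finrank_homogeneousSubmodule, polySpace]
  rw [← LinearMap.range_domRestrict]
  refine LinearMap.finrank_range_of_inj ((injective_iff_map_eq_zero _).2 fun p hp => ?_)
  exact Subtype.ext (eq_zero_of_polyRestrict_eq_zero p.2 hp)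

theorem polySpace_le_add_two (d k : ℕ) : polySpace d k ≤ polySpace d (k + 2) := by
  rintro _ ⟨p, hp, rfl⟩
  refine ⟨p * ∑ i, X i ^ 2, ?_, ?_⟩
  · exact IsHomogeneous.mul hp (IsHomogeneous.sum _ _ _ fun i _ => isHomogeneous_X_pow i 2)
  · ext x
    have h := EuclideanSpace.real_norm_sq_eq (x : Ambient d)
    have hx : ‖(x : Ambient d)‖ = 1 := by simp
    rw [hx] at h
    simp only [polyRestrict_apply, map_mul, map_sum, map_pow, eval_X, ← h]
    ring

theorem lowerSpace_le : ∀ k, lowerSpace d k ≤ polySpace d k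
  | 0 => bot_le
  | 1 => bot_le
  | k + 2 => polySpace_le_add_two d k

theorem laplaceBeltrami_sub_mem_lowerSpace {k : ℕ} {f : SmoothFun d} (hf : f ∈ polySpace d k) :
    laplaceBeltrami d f - sphEigenvalue k d • f ∈ lowerSpace d k := by
  obtain ⟨p, hp, rfl⟩ := hf
  replace hp : p.IsHomogeneous k := hp
  rw [laplaceBeltrami_polyRestrict hp, sub_sub_cancel_left, Submodule.neg_mem_iff]
  match k with
  | 0 => simp [polyLaplacian_eq_zero (by norm_num) hp]
  | 1 => simp [polyLaplacian_eq_zero (by norm_num) hp]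
  | k + 2 => exact ⟨_, polyLaplacian_isHomogeneous hp, rfl⟩

theorem laplaceBeltrami_mem_polySpace {k : ℕ} {f : SmoothFun d} (hf : f ∈ polySpace d k) :
    laplaceBeltrami d f ∈ polySpace d k := by
  rw [← sub_add_cancel (laplaceBeltrami d f) (sphEigenvalue k d • f)]
  exact add_mem (lowerSpace_le k (laplaceBeltrami_sub_mem_lowerSpace hf))
    (Submodule.smul_mem _ _ hf)

theorem laplaceBeltrami_mem_lowerSpace {k : ℕ} {f : SmoothFun d} (hf : f ∈ lowerSpace d k) :
    laplaceBeltrami d f ∈ lowerSpace d k := by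
  match k with
  | 0 => simp_all [lowerSpace]
  | 1 => simp_all [lowerSpace]
  | k + 2 => exact laplaceBeltrami_mem_polySpace hf

/-- Orthogonal projection to a finite-dimensional space of functions. -/
theorem exists_orthogonal_decomposition (W : Submodule ℝ (SmoothFun d)) [FiniteDimensional ℝ W]
    (f : SmoothFun d) : ∃ h ∈ W, ∀ w ∈ W, sphInner d (f - h) w = 0 := by
  let T : W →ₗ[ℝ] Module.Dual ℝ W := (sphInner d).domRestrict₁₂ W W
  have hT : Function.Injective T := by
    refine (injective_iff_map_eq_zero T).2 fun w hw => ?_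
    have h : sphInner d w w = 0 := LinearMap.congr_fun hw w
    exact Subtype.ext (eq_zero_of_sphInner_self h)
  have hs : Function.Surjective T :=
    (LinearMap.injective_iff_surjective_of_finrank_eq_finrank
      (Subspace.dual_finrank_eq (V := W)).symm).1 hT
  obtain ⟨h, hh⟩ := hs ((sphInner d f).domRestrict W)
  refine ⟨h, h.2, fun w hw => ?_⟩
  have h1 : sphInner d h w = sphInner d f w := LinearMap.congr_fun hh ⟨w, hw⟩
  rw [map_sub, LinearMap.sub_apply, h1, sub_self]

theorem mem_eigenspace_iff {lam : ℝ} {f : SmoothFun d} :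
    f ∈ eigenspace d lam ↔ laplaceBeltrami d f = lam • f :=
  Module.End.mem_eigenspace_iff

theorem finiteDimensional_lowerSpace (d : ℕ) : ∀ k, FiniteDimensional ℝ (lowerSpace d k)
  | 0 => inferInstanceAs (FiniteDimensional ℝ (⊥ : Submodule ℝ (SmoothFun d)))
  | 1 => inferInstanceAs (FiniteDimensional ℝ (⊥ : Submodule ℝ (SmoothFun d)))
  | k + 2 => inferInstanceAs (FiniteDimensional ℝ (polySpace d k))

theorem sphInner_laplaceBeltrami_sub (lam : ℝ) (f g : SmoothFun d) :
    sphInner d (laplaceBeltrami d f - lam • f) g =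
      sphInner d f (laplaceBeltrami d g - lam • g) := by
  simp [sphInner_laplaceBeltrami]

/-- Let v = f - h be orthogonal to the lower space and A = Δ - λ_k. Then A v lies in the lower
space, which A preserves, so ⟨Av, Av⟩ = ⟨v, A(Av)⟩ = 0. -/
theorem exists_add_of_mem_polySpace {k : ℕ} {f : SmoothFun d} (hf : f ∈ polySpace d k) :
    ∃ h ∈ lowerSpace d k, f - h ∈ eigenspace d (sphEigenvalue k d) := by
  have := finiteDimensional_lowerSpace d k
  obtain ⟨h, hh, hw⟩ := exists_orthogonal_decomposition (lowerSpace d k) f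
  refine ⟨h, hh, ?_⟩
  have h1 : f - h ∈ polySpace d k := sub_mem hf (lowerSpace_le k hh)
  have h2 := laplaceBeltrami_sub_mem_lowerSpace h1
  rw [mem_eigenspace_iff, ← sub_eq_zero]
  refine eq_zero_of_sphInner_self ?_
  rw [sphInner_laplaceBeltrami_sub]
  exact hw _ (sub_mem (laplaceBeltrami_mem_lowerSpace h2) (Submodule.smul_mem _ _ h2))

theorem sphInner_eq_zero_of_eigenvalue_ne {lam lam' : ℝ} (hne : lam ≠ lam') {f g : SmoothFun d}
    (hf : f ∈ eigenspace d lam) (hg : g ∈ eigenspace d lam') : sphInner d f g = 0 := by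
  have h := sphInner_laplaceBeltrami f g
  rw [mem_eigenspace_iff.1 hf, mem_eigenspace_iff.1 hg] at h
  simp only [map_smul, LinearMap.smul_apply, smul_eq_mul] at h
  exact (mul_eq_zero.1 (by linarith : (lam - lam') * sphInner d f g = 0)).resolve_left
    (sub_ne_zero.2 hne)

/-- A function of degree j is an eigenfunction plus one of degree j - 2: distinct eigenvalues handle
the former, induction the latter. Degrees with eigenvalue `lam` are left to the hypothesis. -/
theorem sphInner_polySpace_eq_zero {lam : ℝ} {g : SmoothFun d} (hg : g ∈ eigenspace d lam) (j : ℕ)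
    (h : ∀ i ≤ j, sphEigenvalue i d = lam → ∀ f ∈ polySpace d i, sphInner d g f = 0) :
    ∀ f ∈ polySpace d j, sphInner d g f = 0 := by
  induction j using Nat.strong_induction_on with
  | _ j ih =>
    intro f hf
    by_cases hj : sphEigenvalue j d = lam
    · exact h j le_rfl hj f hf
    obtain ⟨w, hw, hfw⟩ := exists_add_of_mem_polySpace hf
    have h1 : sphInner d g w = 0 := by
      match j with
      | 0 => rw [(Submodule.mem_bot ℝ).1 hw, map_zero]
      | 1 => rw [(Submodule.mem_bot ℝ).1 hw, map_zero]
      | j + 2 => exact ih j (by omega) (fun i hi => h i (by omega)) w hw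
    have h2 := sphInner_eq_zero_of_eigenvalue_ne (Ne.symm hj) hg hfw
    rw [map_sub, h1, sub_zero] at h2
    exact h2

end Spaces

section Density

variable {d : ℕ}

/-- The algebra homomorphism restricting polynomials to continuous functions on the sphere. -/
def polyToContinuous (d : ℕ) : MvPolynomial (Fin (d + 1)) ℝ →ₐ[ℝ] C(Sph d, ℝ) :=
  aeval fun i => ⟨fun x => (x : Ambient d) i, by fun_prop⟩

theorem polyToContinuous_apply (p : MvPolynomial (Fin (d + 1)) ℝ) (x : Sph d) :
    polyToContinuous d p x = polyRestrict d p x := by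
  rw [polyRestrict_apply]
  induction p using MvPolynomial.induction_on with
  | C a => simp [polyToContinuous, ← MvPolynomial.algebraMap_eq]
  | add p q hp hq => simp [hp, hq]
  | mul_X p i hp => simp [hp]; simp [polyToContinuous]

theorem exists_polyRestrict_near (f : SmoothFun d) {ε : ℝ} (hε : 0 < ε) :
    ∃ p, ∀ x, |f x - polyRestrict d p x| ≤ ε := by
  have hsep : (polyToContinuous d).range.SeparatesPoints := by
    intro x y hxy
    have : ∃ i, (x : Ambient d) i ≠ (y : Ambient d) i := by
      by_contra! h
      exact hxy (Subtype.ext (PiLp.ext h))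
    obtain ⟨i, hi⟩ := this
    refine ⟨polyToContinuous d (X i), ⟨_, ⟨X i, rfl⟩, rfl⟩, ?_⟩
    rw [polyToContinuous_apply, polyToContinuous_apply]
    simpa [polyRestrict_apply] using hi
  obtain ⟨⟨_, p, rfl⟩, hg⟩ :=
    ContinuousMap.exists_mem_subalgebra_near_continuous_of_separatesPoints
      (polyToContinuous d).range hsep f f.contMDiff.continuous ε hε
  refine ⟨p, fun x => ?_⟩
  have := (hg x).le
  rw [Real.norm_eq_abs, abs_sub_comm] at this
  rw [← polyToContinuous_apply]
  exact this

theorem sphInner_self_le {f : SmoothFun d} {ε : ℝ} (h : ∀ x, |f x| ≤ ε) :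
    sphInner d f f ≤ ε ^ 2 * sphInner d (polyRestrict d 1) (polyRestrict d 1) := by
  rw [sphInner_apply, sphInner_apply, ← MeasureTheory.integral_const_mul]
  refine MeasureTheory.integral_mono (integrable_shell f f)
    ((integrable_shell _ _).const_mul _) fun x => ?_
  have h1 : rayExtension (polyRestrict d 1) x = 1 := by
    simp [rayExtension, polyRestrict_apply]
  have h2 : rayExtension f x * rayExtension f x ≤ ε ^ 2 := by
    rw [← pow_two, ← sq_abs]
    exact pow_le_pow_left₀ (abs_nonneg _) (h _) 2
  simp only [h1]
  have h3 : 0 ≤ shellBump (‖x‖ ^ 2) := shellBump.nonneg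
  nlinarith [mul_le_mul_of_nonneg_left h2 h3]

theorem sphInner_self_nonneg (f : SmoothFun d) : 0 ≤ sphInner d f f :=
  MeasureTheory.integral_nonneg fun _ => mul_nonneg shellBump.nonneg (mul_self_nonneg _)

/-- If f is orthogonal to every polynomial p, then ⟨f, f⟩ ≤ ⟨f - p, f - p⟩, which Stone-Weierstrass
makes arbitrarily small. -/
theorem eq_zero_of_sphInner_polySpace {f : SmoothFun d}
    (h : ∀ k, ∀ g ∈ polySpace d k, sphInner d f g = 0) : f = 0 := by
  have hp : ∀ p, sphInner d f (polyRestrict d p) = 0 := fun p => by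
    rw [← sum_homogeneousComponent p, map_sum, map_sum]
    exact Finset.sum_eq_zero fun i _ => h i _
      ⟨_, homogeneousComponent_isHomogeneous i p, rfl⟩
  set M := sphInner d (polyRestrict d 1) (polyRestrict d 1)
  have hM : 0 ≤ M := sphInner_self_nonneg _
  have key : ∀ ε : ℝ, 0 < ε → sphInner d f f ≤ ε ^ 2 * M := fun ε hε => by
    obtain ⟨p, hfp⟩ := exists_polyRestrict_near f hε
    refine le_trans ?_ (sphInner_self_le (f := f - polyRestrict d p) hfp)
    have h1 := sphInner_self_nonneg (polyRestrict d p)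
    have h2 := hp p
    have h3 := sphInner_comm (polyRestrict d p) f
    simp only [map_sub, LinearMap.sub_apply]
    linarith
  refine eq_zero_of_sphInner_self (le_antisymm ?_ (sphInner_self_nonneg f))
  refine le_of_forall_pos_le_add fun δ hδ => ?_
  have h1 := key (Real.sqrt (δ / (M + 1))) (by positivity)
  rw [Real.sq_sqrt (by positivity)] at h1
  have h2 : δ / (M + 1) * M ≤ δ := by
    rw [div_mul_eq_mul_div, div_le_iff₀ (by positivity)]
    nlinarith
  linarith

end Density

end

end SphereHeat

/-! ### The spectrum with multiplicities, and the heat expansion -/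

namespace SphereHeat

noncomputable section

open scoped Manifold ContDiff Topology

variable {d : ℕ}

theorem sphEigenvalue_strictMono (hd : 1 ≤ d) : StrictMono fun k => sphEigenvalue k d := by
  refine strictMono_nat_of_lt_succ fun k => ?_
  have h1 : (1 : ℝ) ≤ d := by exact_mod_cast hd
  have h2 : (0 : ℝ) ≤ k := by positivity
  simp only [sphEigenvalue]
  push_cast
  nlinarith

theorem eigenspace_eq_bot {lam : ℝ} (h : ∀ k, sphEigenvalue k d ≠ lam) :
    eigenspace d lam = ⊥ :=
  (Submodule.eq_bot_iff _).2 fun _ hg => eq_zero_of_sphInner_polySpace fun k =>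
    sphInner_polySpace_eq_zero hg k fun i _ hi => absurd hi (h i)

/-- The projection h of an eigenfunction f to the Δ-stable space is again an eigenfunction, by
symmetry. Then f - h is orthogonal to degree k and, λ being injective, to every other degree, so it
vanishes. -/
theorem eigenspace_le_polySpace (hd : 1 ≤ d) (k : ℕ) :
    eigenspace d (sphEigenvalue k d) ≤ polySpace d k := by
  intro f hf
  obtain ⟨h, hh, hw⟩ := exists_orthogonal_decomposition (polySpace d k) f
  have hf' := mem_eigenspace_iff.1 hf
  have he : h ∈ eigenspace d (sphEigenvalue k d) := by
    rw [mem_eigenspace_iff, ← sub_eq_zero]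
    have hv : ∀ u ∈ polySpace d k, laplaceBeltrami d u - sphEigenvalue k d • u ∈ polySpace d k :=
      fun u hu => sub_mem (laplaceBeltrami_mem_polySpace hu) (Submodule.smul_mem _ _ hu)
    set v := laplaceBeltrami d h - sphEigenvalue k d • h
    have h1 := sphInner_laplaceBeltrami_sub (sphEigenvalue k d) f v
    rw [hf', sub_self, map_zero, LinearMap.zero_apply] at h1
    have h2 := hw _ (hv v (hv h hh))
    rw [LinearMap.map_sub₂, ← h1, zero_sub, neg_eq_zero,
      ← sphInner_laplaceBeltrami_sub] at h2
    exact eq_zero_of_sphInner_self h2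
  have hz : f - h = 0 := eq_zero_of_sphInner_polySpace fun j =>
    sphInner_polySpace_eq_zero (sub_mem hf he) j fun i _ hi => by
      rw [(sphEigenvalue_strictMono hd).injective hi]
      exact hw
  rw [sub_eq_zero.1 hz]
  exact hh

theorem finiteDimensional_eigenspace (hd : 1 ≤ d) (lam : ℝ) :
    FiniteDimensional ℝ (eigenspace d lam) := by
  by_cases h : ∃ k, sphEigenvalue k d = lam
  · obtain ⟨k, rfl⟩ := h
    exact Submodule.finiteDimensional_of_le (eigenspace_le_polySpace hd k)
  · push Not at h
    rw [eigenspace_eq_bot h]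
    infer_instance

theorem disjoint_eigenspace_lowerSpace (hd : 1 ≤ d) (k : ℕ) :
    Disjoint (eigenspace d (sphEigenvalue k d)) (lowerSpace d k) := by
  rw [Submodule.disjoint_def]
  intro f hf hl
  match k with
  | 0 => exact hl
  | 1 => exact hl
  | k + 2 =>
    refine eq_zero_of_sphInner_self (sphInner_polySpace_eq_zero hf k (fun i hi he => ?_) f hl)
    have := (sphEigenvalue_strictMono hd).injective he
    omega

theorem eigenspace_sup_lowerSpace (hd : 1 ≤ d) (k : ℕ) :
    eigenspace d (sphEigenvalue k d) ⊔ lowerSpace d k = polySpace d k := by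
  refine le_antisymm (sup_le (eigenspace_le_polySpace hd k) (lowerSpace_le k)) fun f hf => ?_
  obtain ⟨h, hh, he⟩ := exists_add_of_mem_polySpace hf
  exact Submodule.mem_sup.2 ⟨_, he, h, hh, sub_add_cancel f h⟩

theorem finrank_eigenspace_add (hd : 1 ≤ d) (k : ℕ) :
    Module.finrank ℝ (eigenspace d (sphEigenvalue k d)) + Module.finrank ℝ (lowerSpace d k) =
      (d + k).choose k := by
  have := finiteDimensional_eigenspace hd (sphEigenvalue k d)
  have := finiteDimensional_lowerSpace d k
  have h := Submodule.finrank_sup_add_finrank_inf_eq (eigenspace d (sphEigenvalue k d))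
    (lowerSpace d k)
  rw [(disjoint_eigenspace_lowerSpace hd k).eq_bot, finrank_bot, add_zero,
    eigenspace_sup_lowerSpace hd, finrank_polySpace] at h
  exact h.symm

theorem finrank_eigenspace (k : ℕ) :
    (Module.finrank ℝ (eigenspace (d + 1) (sphEigenvalue k (d + 1))) : ℝ) =
      sphMultiplicity k (d + 1) := by
  have h := finrank_eigenspace_add (d := d + 1) (by omega) k
  match k with
  | 0 =>
    have h0 : Module.finrank ℝ (lowerSpace (d + 1) 0) = 0 := finrank_bot ℝ _
    rw [h0] at h
    simp only [add_zero, Nat.choose_zero_right] at h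
    rw [h]
    simp [sphMultiplicity]
  | 1 =>
    have h0 : Module.finrank ℝ (lowerSpace (d + 1) 1) = 0 := finrank_bot ℝ _
    rw [h0] at h
    simp only [add_zero, Nat.choose_one_right] at h
    rw [h, show (1 : ℕ) = 0 + 1 by rfl, sphMultiplicity_succ]
    have : (d.factorial : ℝ) ≠ 0 := by positivity
    simp only [zero_add, Nat.factorial_one, Nat.cast_zero, mul_zero]
    push_cast
    field_simp
    ring
  | k + 2 =>
    have h0 : Module.finrank ℝ (lowerSpace (d + 1) (k + 2)) = (d + 1 + k).choose k :=
      finrank_polySpace (d + 1) k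
    rw [h0] at h
    have h1 : (Module.finrank ℝ (eigenspace (d + 1) (sphEigenvalue (k + 2) (d + 1))) : ℝ) =
        ((d + 1 + (k + 2)).choose (k + 2) : ℝ) - ((d + 1 + k).choose k : ℝ) := by
      rw [← h]
      push_cast
      ring
    rw [h1, show k + 2 = (k + 1) + 1 by rfl, sphMultiplicity_succ,
      add_comm (d + 1), add_comm (d + 1), Nat.cast_add_choose, Nat.cast_add_choose]
    rw [show k + 1 + 1 + (d + 1) = (d + k) + 1 + 1 + 1 by ring,
      show k + (d + 1) = (d + k) + 1 by ring, show k + 1 + d = (d + k) + 1 by ring]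
    simp only [Nat.factorial_succ]
    have e1 : (d.factorial : ℝ) ≠ 0 := by positivity
    have e2 : (k.factorial : ℝ) ≠ 0 := by positivity
    push_cast
    field_simp
    ring

theorem heatTerm_sphEigenvalue (t : ℝ) (k : ℕ) :
    heatTerm (d + 1) t (sphEigenvalue k (d + 1)) =
      sphMultiplicity k (d + 1) * Real.exp (-t * sphEigenvalue k (d + 1)) := by
  rw [heatTerm, finrank_eigenspace]

theorem heatTerm_eq_zero {t lam : ℝ} (h : lam ∉ Set.range fun k => sphEigenvalue k d) :
    heatTerm d t lam = 0 := by
  rw [heatTerm, eigenspace_eq_bot fun k hk => h ⟨k, hk⟩, finrank_bot]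
  simp

theorem heatTrace_eq_spectralSum (t : ℝ) : heatTrace (d + 1) t = spectralSum d t := by
  have hinj := (sphEigenvalue_strictMono (d := d + 1) (by omega)).injective
  rw [heatTrace, spectralSum, ← hinj.tsum_eq fun lam hl => by
    by_contra h
    exact hl (heatTerm_eq_zero h)]
  exact tsum_congr fun k => heatTerm_sphEigenvalue t k

theorem summable_heatTerm {t : ℝ} (ht : 0 < t) : Summable (heatTerm (d + 1) t) := by
  have hinj := (sphEigenvalue_strictMono (d := d + 1) (by omega)).injective
  rw [← hinj.summable_iff fun lam hl => heatTerm_eq_zero hl]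
  exact (summable_spectralSum d ht).congr fun k => (heatTerm_sphEigenvalue t k).symm

theorem hasHeatExpansion_heatCoeff (d : ℕ) : HasHeatExpansion (d + 1) (heatCoeff d) := by
  intro N
  -- Order N + 1 keeps exactly the terms n ≤ N with error O(t^{N+1}); the spare factor t turns O
  -- into o.
  obtain ⟨C, hC⟩ := hasPowerExp_spectralSum d (N + 1)
  have hev : ∀ᶠ t : ℝ in 𝓝[>] 0, 0 < t ∧ t ≤ 1 := by
    filter_upwards [Ioc_mem_nhdsGT (zero_lt_one (α := ℝ))] with t ht using ht
  have hbig : (fun t : ℝ => heatTrace (d + 1) t -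
      ∑ n ∈ Finset.range (N + 1), heatCoeff d n * t ^ ((n : ℝ) - ((d + 1 : ℕ) : ℝ) / 2))
      =O[𝓝[>] (0 : ℝ)] fun t : ℝ => t * t ^ ((N : ℝ) - ((d + 1 : ℕ) : ℝ) / 2) := by
    refine Asymptotics.IsBigO.of_bound C ?_
    filter_upwards [hev] with t ht
    have h1 : ∀ n : ℕ, t ^ ((n : ℝ) - ((d + 1 : ℕ) : ℝ) / 2) =
        t ^ (-(((d : ℝ) + 1) / 2)) * t ^ n := fun n => by
      rw [← Real.rpow_natCast t n, ← Real.rpow_add ht.1]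
      congr 1
      push_cast
      ring
    have h2 : heatTrace (d + 1) t - ∑ n ∈ Finset.range (N + 1), heatCoeff d n *
        t ^ ((n : ℝ) - ((d + 1 : ℕ) : ℝ) / 2) = t ^ (-(((d : ℝ) + 1) / 2)) *
        (t ^ (((d : ℝ) + 1) / 2) * spectralSum d t -
          ∑ n ∈ Finset.range (N + 1), heatCoeff d n * t ^ n) := by
      rw [mul_sub, ← mul_assoc, ← Real.rpow_add ht.1, neg_add_cancel, Real.rpow_zero, one_mul,
        heatTrace_eq_spectralSum, Finset.mul_sum]
      congr 1
      refine Finset.sum_congr rfl fun n _ => ?_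
      rw [h1]
      ring
    have h3 := hC t ht.1 ht.2
    have h4 : 0 < t ^ (-(((d : ℝ) + 1) / 2)) := Real.rpow_pos_of_pos ht.1 _
    rw [h2, h1 N, Real.norm_eq_abs, Real.norm_eq_abs, abs_mul, abs_of_pos h4,
      abs_of_pos (by have := ht.1; positivity : 0 < t * (t ^ (-(((d : ℝ) + 1) / 2)) * t ^ N))]
    calc _ ≤ t ^ (-(((d : ℝ) + 1) / 2)) * (C * t ^ (N + 1)) :=
          mul_le_mul_of_nonneg_left h3 h4.le
      _ = _ := by ring
  refine hbig.trans_isLittleO ?_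
  have h5 : (fun t : ℝ => t) =o[𝓝[>] (0 : ℝ)] fun _ => (1 : ℝ) :=
    (Asymptotics.isLittleO_one_iff ℝ).2 (tendsto_nhdsWithin_of_tendsto_nhds Filter.tendsto_id)
  simpa using h5.mul_isBigO (Asymptotics.isBigO_refl
    (fun t : ℝ => t ^ ((N : ℝ) - ((d + 1 : ℕ) : ℝ) / 2)) (𝓝[>] 0))

theorem HasHeatExpansion.unique {a b : ℕ → ℝ} (ha : HasHeatExpansion d a)
    (hb : HasHeatExpansion d b) (n : ℕ) : a n = b n := by
  induction n using Nat.strong_induction_on with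
  | _ n ih =>
    have h := (hb n).sub (ha n)
    have h1 : (fun t : ℝ => (a n - b n) * t ^ ((n : ℝ) - (d : ℝ) / 2)) =o[𝓝[>] (0 : ℝ)]
        fun t : ℝ => t ^ ((n : ℝ) - (d : ℝ) / 2) := by
      refine h.congr_left fun t => ?_
      rw [Finset.sum_range_succ, Finset.sum_range_succ,
        Finset.sum_congr rfl fun m hm => by rw [← ih m (Finset.mem_range.1 hm)]]
      ring
    by_contra hne
    have h2 : (fun t : ℝ => t ^ ((n : ℝ) - (d : ℝ) / 2)) =o[𝓝[>] (0 : ℝ)]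
        fun t : ℝ => t ^ ((n : ℝ) - (d : ℝ) / 2) :=
      (Asymptotics.isLittleO_const_mul_left_iff (sub_ne_zero.2 hne)).1 h1
    have h3 := Asymptotics.isLittleO_irrefl' (f' := fun t : ℝ => t ^ ((n : ℝ) - (d : ℝ) / 2))
      (l := 𝓝[>] (0 : ℝ)) (Filter.Eventually.frequently (by
        filter_upwards [self_mem_nhdsWithin] with t ht
        exact (norm_pos_iff.2 (Real.rpow_pos_of_pos ht _).ne').ne'))
    exact h3 h2

end

end SphereHeat

/-! ### Conclusion -/

theorem theorem1p1 (d : ℕ) (hd : 1 ≤ d) :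
    -- the trace of the heat operator is well defined
    ((∀ lam : ℝ, FiniteDimensional ℝ (SphereHeat.eigenspace d lam)) ∧
      (∀ t : ℝ, 0 < t → Summable (SphereHeat.heatTerm d t))) ∧
    -- the heat trace coefficients exist
    (∃ a : ℕ → ℝ, SphereHeat.HasHeatExpansion d a) ∧
    -- and they are given by the double sum
    (∀ a : ℕ → ℝ, SphereHeat.HasHeatExpansion d a →
      ∀ n : ℕ, 1 ≤ n → ∀ ω : ℕ, 2 * n ≤ ω → a n = SphereHeat.heatSum n d ω) := by
  -- From here on `d` is the dimension minus one, the parameter of `heatCoeff`.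
  obtain ⟨d, rfl⟩ := Nat.exists_eq_add_of_le' hd
  refine ⟨⟨SphereHeat.finiteDimensional_eigenspace hd, fun t ht => SphereHeat.summable_heatTerm ht⟩,
    ⟨_, SphereHeat.hasHeatExpansion_heatCoeff d⟩, fun a ha n hn ω hω => ?_⟩
  rw [ha.unique (SphereHeat.hasHeatExpansion_heatCoeff d) n,
    SphereHeat.heatSum_eq_heatCoeff d n ω hn hω]
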